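/- **Tangency principle for translating solitons in $\mathbb{H}^2\times\mathbb{R}$.** Let $\mathbb{H}^2\times\mathbb{R}$ carry the product metric $\langle\cdot,\cdot\rangle$ (with $\mathbb{H}^2$ the Poincaré disk, curvature $-1$; global coordinates $(x_1,x_2,z)$), and let $\partial_z$ be the vertical unit Killing field. A *translating soliton* is a smooth immersed surface $f:M\to\mathbb{H}^2\times\mathbb{R}$, possibly with boundary, with a smooth unit normal field $\eta$ whose mean curvature $H=\tfrac12(\kappa_1+\kappa_2)$ with respect to $\eta$ satisfies $H=\langle\eta,\partial_z\rangle$ at every point. Let $f_1:M_1\to\mathbb{H}^2\times\mathbb{R}$ and $f_2:M_2\to\mathbb{H}^2\times\mathbb{R}$ be connected translating solitons with unit normals $\eta_1,\eta_2$ and possibly non-empty boundaries. Let $p_1\in M_1$, $p_2\in M_2$ be such that $f_1(p_1)=f_2(p_2)=:p$ and $\eta_1(p_1)=\eta_2(p_2)$, and suppose that either $p_1,p_2$ are both interior points, or they are both boundary points and the interior unit conormals of $\partial M_1$ at $p_1$ and of $\partial M_2$ at $p_2$ are equal. Assume that $M_1$ lies locally around $p$ on one side of $M_2$: for some direction $v$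 in the coordinate space $\mathbb{R}^3$ that is transverse to the common tangent plane at $p$, when $M_1$ near $p_1$ and $M_2$ near $p_2$ are written as graphs of functions $u_1,u_2$ in the direction $v$, then $u_1\ge u_2$ wherever both are defined. (Replacing $v$ by $-v$ covers the other side.) Then: 1. $M_1$ and $M_2$ agree near $p$: for every direction transverse to the common tangent plane, when both surfaces are written near $p_1$, $p_2$ as graphs in that direction, the two functions are equal near $p$ wherever both are defined. 2. If $p_1,p_2$ are interior points, there are arbitrarily small neighbourhoods $U_1$ of $p_1$ and $U_2$ of $p_2$ with $f_1(U_1)=f_2(U_2)$. The same holds at a boundary contact point if the boundary curves coincide near $p$, that is, if there are arbitrarily small neighbourhoods $V_i$ of $p_i$ with $f_1(V_1\cap\partial M_1)=f_2(V_2\cap\partial M_2)$. 3. If moreover both surfaces are complete for their intrinsic distances and neither boundary meets the interior of the other surface, i.e. $f_1(\partial M_1)\cap f_2(\operatorname{int}M_2)=\varnothing$ and $f_2(\partial M_2)\cap f_1(\operatorname{int}M_1)=\varnothing$ (in particular if both are complete without boundary), then the surfaces coincide together with their unit normals: $\{(f_1(x),\eta_1(x)):x\in M_1\}=\{(f_2(y),\eta_2(y)):y\in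 M_2\}$. -/

import Mathlib

open scoped Manifold ContDiff Topology

noncomputable section

namespace H2R

/-- The coordinate space `ℝ³` with coordinates `(x 0, x 1, x 2) = (x₁, x₂, z)`. -/
abbrev E3 : Type := EuclideanSpace ℝ (Fin 3)

/-- The space `ℍ² × ℝ`, with the Poincaré disk model for `ℍ²`, as an open subset of `ℝ³`. -/
def space : Set E3 := {x | x 0 ^ 2 + x 1 ^ 2 < 1}

/-- The conformal factor `λ = 2 / (1 - x₁² - x₂²)` of the Poincaré disk. -/
def conf (x : E3) : ℝ := 2 / (1 - x 0 ^ 2 - x 1 ^ 2)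

/-- The product metric `λ² (dx₁² + dx₂²) + dz²` at the point `x`. -/
def metric (x v w : E3) : ℝ := conf x ^ 2 * (v 0 * w 0 + v 1 * w 1) + v 2 * w 2

/-- The vertical unit Killing field `∂_z`. -/
def dz : E3 := !₂[0, 0, 1]

/-- The Christoffel tensor of the product metric: the Levi-Civita connection is
`∇_v W = DW(v) + Γ(v, W)`. With `⬝` the Euclidean product of the horizontal parts, the horizontal
part of `Γ(v, w)` is `λ ((x ⬝ v) w + (x ⬝ w) v - (v ⬝ w) x)`, and the vertical part is `0`. -/
def christoffel (x v w : E3) : E3 :=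
  !₂[conf x * ((x 0 * v 0 + x 1 * v 1) * w 0 + (x 0 * w 0 + x 1 * w 1) * v 0
        - (v 0 * w 0 + v 1 * w 1) * x 0),
     conf x * ((x 0 * v 0 + x 1 * v 1) * w 1 + (x 0 * w 0 + x 1 * w 1) * v 1
        - (v 0 * w 0 + v 1 * w 1) * x 1),
     0]

/-- The connection given by `christoffel` is torsion free. -/
theorem christoffel_symm (x v w : E3) : christoffel x v w = christoffel x w v := by
  have h : ∀ i, christoffel x v w i = christoffel x w v i := by
    intro i
    fin_cases i
    · change conf x * _ = conf x * _
      ring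
    · change conf x * _ = conf x * _
      ring
    · rfl
  ext i
  exact h i

/-- The connection given by `christoffel` is compatible with the metric; so it is the Levi-Civita
connection of `ℍ² × ℝ`. -/
theorem metric_compatible {x : E3} (hx : x ∈ space) (u v w : E3) :
    HasDerivAt (fun t : ℝ => metric (x + t • u) v w)
      (metric x (christoffel x u v) w + metric x v (christoffel x u w)) 0 := by
  have hne : (1 : ℝ) - x 0 ^ 2 - x 1 ^ 2 ≠ 0 := by
    have h : x 0 ^ 2 + x 1 ^ 2 < 1 := hx
    intro h0
    linarith
  have hl : ∀ a b : ℝ, HasDerivAt (fun t : ℝ => a + t * b) b 0 := fun a b => by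
    simpa using ((hasDerivAt_id (0 : ℝ)).mul_const b).const_add a
  have hd := (((hl (x 0) (u 0)).pow 2).const_sub 1).sub ((hl (x 1) (u 1)).pow 2)
  have hc := (hasDerivAt_const (0 : ℝ) (2 : ℝ)).div hd (by simpa using hne)
  have hm := ((hc.pow 2).mul_const (v 0 * w 0 + v 1 * w 1)).add_const (v 2 * w 2)
  refine HasDerivAt.congr_deriv (f := fun t : ℝ => metric (x + t • u) v w) hm ?_
  simp [metric, christoffel, conf]
  field_simp
  ring

section Surfaces

variable {M : Type*} [TopologicalSpace M] [ChartedSpace (EuclideanHalfSpace 2) M]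

/-- The differential at `x` of a map from a surface (possibly with boundary) to `ℝ³`. The tangent
space `T_x M` is identified with `ℝ²` by the preferred chart at `x`. -/
def diff (f : M → E3) (x : M) : EuclideanSpace ℝ (Fin 2) →L[ℝ] E3 :=
  mfderiv (𝓡∂ 2) 𝓘(ℝ, E3) f x

/-- `f` is a smooth immersion of the surface `M` in `ℍ² × ℝ`, and `η` is a smooth
unit normal field along it. -/
structure IsOrientedImmersion (f η : M → E3) : Prop where
  mem_space : ∀ x, f x ∈ space
  smooth : ContMDiff (𝓡∂ 2) 𝓘(ℝ, E3) ∞ f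
  immersion : ∀ x, Function.Injective (diff f x)
  normal_smooth : ContMDiff (𝓡∂ 2) 𝓘(ℝ, E3) ∞ η
  normal_unit : ∀ x, metric (f x) (η x) (η x) = 1
  normal_orthogonal : ∀ x u, metric (f x) (η x) (diff f x u) = 0

/-- The first fundamental form at `x`, `I(u, w) = ⟨df u, df w⟩`. -/
def firstForm (f : M → E3) (x : M) (u w : EuclideanSpace ℝ (Fin 2)) : ℝ :=
  metric (f x) (diff f x u) (diff f x w)

/-- The second fundamental form at `x` with respect to `η`, `II(u, w) = -⟨∇_u η, df w⟩`. -/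
def secondForm (f η : M → E3) (x : M) (u w : EuclideanSpace ℝ (Fin 2)) : ℝ :=
  - metric (f x) (diff η x u + christoffel (f x) (diff f x u) (η x)) (diff f x w)

/-- The matrix of a form on `ℝ²` in the standard basis. -/
def formMatrix (B : EuclideanSpace ℝ (Fin 2) → EuclideanSpace ℝ (Fin 2) → ℝ) :
    Matrix (Fin 2) (Fin 2) ℝ :=
  Matrix.of fun i j => B (EuclideanSpace.single i 1) (EuclideanSpace.single j 1)

/-- The mean curvature `H = (κ₁ + κ₂) / 2 = (1/2) trace (I⁻¹ II)` with respect to `η`. -/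
def meanCurvature (f η : M → E3) (x : M) : ℝ :=
  (1 / 2) * ((formMatrix (firstForm f x))⁻¹ * formMatrix (secondForm f η x)).trace

/-- `f` is an immersed translating soliton of `ℍ² × ℝ` with unit normal `η`:
`H = ⟨η, ∂_z⟩` at every point. -/
structure IsTranslatingSoliton (f η : M → E3) : Prop extends IsOrientedImmersion f η where
  soliton : ∀ x, meanCurvature f η x = metric (f x) (η x) dz

/-- `ξ` is the interior unit conormal at the boundary point `x`. In the preferred chart at `x`, with
values in `{y | 0 ≤ y 0}`, the vectors tangent to `∂M` are those with `u 0 = 0` and the vectors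
that point into `M` are those with `0 < u 0`. -/
def IsInteriorConormal (f : M → E3) (x : M) (ξ : E3) : Prop :=
  (∃ u : EuclideanSpace ℝ (Fin 2), 0 < u 0 ∧ diff f x u = ξ) ∧
  metric (f x) ξ ξ = 1 ∧
  ∀ u : EuclideanSpace ℝ (Fin 2), u 0 = 0 → metric (f x) ξ (diff f x u) = 0

/-- The length, in the metric of `ℍ² × ℝ`, of a curve `c : [0, 1] → ℍ² × ℝ`. -/
def length (c : ℝ → E3) : ENNReal :=
  ∫⁻ t in Set.Icc (0 : ℝ) 1, ENNReal.ofReal (Real.sqrt (metric (c t) (deriv c t) (deriv c t)))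

/-- The intrinsic (Riemannian) distance on `M` for the metric induced by `f`: the infimum of the
lengths of the `C¹` curves of `M` that join `x` to `y`. -/
def intrinsicDist (f : M → E3) (x y : M) : ENNReal :=
  ⨅ (γ : ℝ → M) (_ : γ 0 = x ∧ γ 1 = y ∧ ContMDiffOn 𝓘(ℝ, ℝ) (𝓡∂ 2) 1 γ (Set.Icc 0 1)),
    length (f ∘ γ)

/-- `M` is complete for the intrinsic distance: every Cauchy sequence converges. -/
def IsCompleteSurface (f : M → E3) : Prop :=
  ∀ u : ℕ → M,
    (∀ ε : ENNReal, 0 < ε → ∃ N, ∀ m ≥ N, ∀ n ≥ N, intrinsicDist f (u m) (u n) < ε) →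
    ∃ x, Filter.Tendsto u Filter.atTop (𝓝 x)

end Surfaces

section Contact

variable {M₁ M₂ : Type*} [TopologicalSpace M₁] [TopologicalSpace M₂]

/-- Near the contact point, the first surface lies on one side of the second one: for some direction
`v` transverse to the tangent plane with normal `n`, wherever a line parallel to `v` meets both
surfaces near the contact point, it meets the first one on the side of `v` of the second one (for
surfaces written as graphs `h₁`, `h₂` in the direction `v`: `h₁ ≥ h₂` on the common domain).
As `v` may be replaced by `-v`, this covers both sides. -/
def LiesOnOneSide (f₁ : M₁ → E3) (f₂ : M₂ → E3) (p₁ : M₁) (p₂ : M₂) (n : E3) : Prop :=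
  ∃ v : E3, metric (f₁ p₁) v n ≠ 0 ∧
    ∀ᶠ q : M₁ × M₂ in 𝓝 (p₁, p₂), ∀ s : ℝ, f₁ q.1 = f₂ q.2 + s • v → 0 ≤ s

/-- Near the contact point, the two surfaces agree as graphs: for every direction `v` transverse to
the tangent plane with normal `n`, a line parallel to `v` that meets both surfaces near the contact
point meets them in the same point (`h₁ = h₂` on the common domain). -/
def AgreeAsGraphs (f₁ : M₁ → E3) (f₂ : M₂ → E3) (p₁ : M₁) (p₂ : M₂) (n : E3) : Prop :=
  ∀ v : E3, metric (f₁ p₁) v n ≠ 0 →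
    ∀ᶠ q : M₁ × M₂ in 𝓝 (p₁, p₂), ∀ s : ℝ, f₁ q.1 = f₂ q.2 + s • v → s = 0

/-- The images of `A₁` near `p₁` and of `A₂` near `p₂` are the same: there are arbitrarily small
neighbourhoods `V₁` of `p₁` and `V₂` of `p₂` with `f₁ (V₁ ∩ A₁) = f₂ (V₂ ∩ A₂)`. -/
def SameGerm (f₁ : M₁ → E3) (A₁ : Set M₁) (p₁ : M₁) (f₂ : M₂ → E3) (A₂ : Set M₂) (p₂ : M₂) :
    Prop :=
  ∀ W₁ ∈ 𝓝 p₁, ∀ W₂ ∈ 𝓝 p₂, ∃ V₁ ∈ 𝓝 p₁, ∃ V₂ ∈ 𝓝 p₂,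
    V₁ ⊆ W₁ ∧ V₂ ⊆ W₂ ∧ f₁ '' (V₁ ∩ A₁) = f₂ '' (V₂ ∩ A₂)

end Contact

end H2R

end

/-! In linear coordinates of `ℝ³` whose last axis is a direction transverse to the common tangent
plane, each surface is near the contact point the graph of a function `u` over a planar region `{ρ ≥
0}`. The condition `H = ⟨η, ∂_z⟩` becomes a quasilinear elliptic equation for `u`, whose
coefficients are smooth functions of the first jet (`solitonEq_of_graph`). Freezing the coefficients
at `u₁` and subtracting, `w = u₁ - u₂` satisfies a linear inequality `|L w| ≤ K (|∇w| + |w|)` with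
`L` uniformly elliptic (`exists_ellipticIneq`).

At the contact point `w` and `dw` vanish, and `w ≥ 0` on the common domain. At an interior contact
point the strong minimum principle gives `w = 0` nearby. At a boundary contact point the equality of
the conormals makes the inward gradients of `ρ₁` and `ρ₂` positively proportional, so that a small
disc lies in both domains and touches their boundaries at the contact point. If `w` were positive in
the disc, Hopf's lemma would make its inward derivative positive, against `dw = 0`. So `w` has a
zero in the disc, and the strong minimum principle spreads it (`eq_zero_of_boundary_contact`). The
two domains may still differ. Agreement in other directions, which compares points with different
projections, is deduced from differentiability and from the interior cones of the two domains
(`agreeAsGraphs_of_eq`).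

The global statement is an analytic continuation argument. Interior points `x`, `y` match when the
two surfaces have the same image germ and the same normal there (`IsMatch`). Matching is an open
condition. That limits of matching pairs match again (`isMatch_of_frequently`) cannot come from a
minimum principle, since nothing is known there about the sign of `w`; it is a unique continuation
theorem. In two variables the principal part of an elliptic operator factors into two conjugate
first order operators `∂x - (α ± iβ) ∂y`. A Carleman estimate for one such factor
(`carleman_estimate`), applied once to each, gives `unique_continuation`.

Finally a curve in the interior of one surface is lifted to the other along matching points. The
lift has the same image in space, hence the same length, so completeness provides limits. The
assumption on the boundaries keeps these limits interior, and the lift continues up to the end of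
the curve. Connectedness reaches every point, and exchanging the surfaces gives the other inclusion.
-/

noncomputable section

/-! ### Planar calculus, barriers and Hopf's boundary point lemma. -/

namespace H2R

open Complex Metric

/-- The partial derivative `∂w/∂x` of a real function on the plane. -/
def dx (w : ℂ → ℝ) (z : ℂ) : ℝ := fderiv ℝ w z 1

/-- The partial derivative `∂w/∂y` of a real function on the plane. -/
def dy (w : ℂ → ℝ) (z : ℂ) : ℝ := fderiv ℝ w z I

/-- The second order operator `a₁₁ ∂²/∂x² + 2 a₁₂ ∂²/∂x∂y + a₂₂ ∂²/∂y²`. -/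
def secondOrder (a₁₁ a₁₂ a₂₂ w : ℂ → ℝ) (z : ℂ) : ℝ :=
  a₁₁ z * dx (dx w) z + 2 * a₁₂ z * dx (dy w) z + a₂₂ z * dy (dy w) z

theorem fderiv_apply_eq (w : ℂ → ℝ) (z ξ : ℂ) :
    fderiv ℝ w z ξ = ξ.re * dx w z + ξ.im * dy w z := by
  have : ξ = ξ.re • (1 : ℂ) + ξ.im • I := by
    simp
  conv_lhs => rw [this]
  rw [map_add, map_smul, map_smul]
  rfl

theorem _root_.HasFDerivAt.dx_eq {w : ℂ → ℝ} {L : ℂ →L[ℝ] ℝ} {z : ℂ} (h : HasFDerivAt w L z) :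
    dx w z = L 1 := by rw [dx, h.fderiv]

theorem _root_.HasFDerivAt.dy_eq {w : ℂ → ℝ} {L : ℂ →L[ℝ] ℝ} {z : ℂ} (h : HasFDerivAt w L z) :
    dy w z = L I := by rw [dy, h.fderiv]

theorem dx_add {f g : ℂ → ℝ} {z : ℂ} (hf : DifferentiableAt ℝ f z) (hg : DifferentiableAt ℝ g z) :
    dx (fun z => f z + g z) z = dx f z + dx g z :=
  HasFDerivAt.dx_eq (hf.hasFDerivAt.add hg.hasFDerivAt)

theorem dx_sub {f g : ℂ → ℝ} {z : ℂ} (hf : DifferentiableAt ℝ f z) (hg : DifferentiableAt ℝ g z) :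
    dx (fun z => f z - g z) z = dx f z - dx g z :=
  HasFDerivAt.dx_eq (hf.hasFDerivAt.sub hg.hasFDerivAt)

theorem dx_mul {f g : ℂ → ℝ} {z : ℂ} (hf : DifferentiableAt ℝ f z) (hg : DifferentiableAt ℝ g z) :
    dx (fun z => f z * g z) z = f z * dx g z + g z * dx f z :=
  HasFDerivAt.dx_eq (hf.hasFDerivAt.mul hg.hasFDerivAt)

theorem dx_const_mul {g : ℂ → ℝ} {z : ℂ} (a : ℝ) (hg : DifferentiableAt ℝ g z) :
    dx (fun z => a * g z) z = a * dx g z :=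
  HasFDerivAt.dx_eq (hg.hasFDerivAt.const_mul a)

theorem dx_congr {f g : ℂ → ℝ} {z : ℂ} (h : f =ᶠ[𝓝 z] g) : dx f z = dx g z := by
  rw [dx, dx, h.fderiv_eq]

theorem dy_add {f g : ℂ → ℝ} {z : ℂ} (hf : DifferentiableAt ℝ f z) (hg : DifferentiableAt ℝ g z) :
    dy (fun z => f z + g z) z = dy f z + dy g z :=
  HasFDerivAt.dy_eq (hf.hasFDerivAt.add hg.hasFDerivAt)

theorem dy_sub {f g : ℂ → ℝ} {z : ℂ} (hf : DifferentiableAt ℝ f z) (hg : DifferentiableAt ℝ g z) :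
    dy (fun z => f z - g z) z = dy f z - dy g z :=
  HasFDerivAt.dy_eq (hf.hasFDerivAt.sub hg.hasFDerivAt)

theorem dy_mul {f g : ℂ → ℝ} {z : ℂ} (hf : DifferentiableAt ℝ f z) (hg : DifferentiableAt ℝ g z) :
    dy (fun z => f z * g z) z = f z * dy g z + g z * dy f z :=
  HasFDerivAt.dy_eq (hf.hasFDerivAt.mul hg.hasFDerivAt)

theorem dy_const_mul {g : ℂ → ℝ} {z : ℂ} (a : ℝ) (hg : DifferentiableAt ℝ g z) :
    dy (fun z => a * g z) z = a * dy g z :=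
  HasFDerivAt.dy_eq (hg.hasFDerivAt.const_mul a)

theorem dy_congr {f g : ℂ → ℝ} {z : ℂ} (h : f =ᶠ[𝓝 z] g) : dy f z = dy g z := by
  rw [dy, dy, h.fderiv_eq]

theorem contDiffAt_dx {w : ℂ → ℝ} {z : ℂ} {m n : WithTop ℕ∞} (h : ContDiffAt ℝ n w z)
    (hmn : m + 1 ≤ n) : ContDiffAt ℝ m (dx w) z :=
  (h.fderiv_right hmn).clm_apply contDiffAt_const

theorem contDiffAt_dy {w : ℂ → ℝ} {z : ℂ} {m n : WithTop ℕ∞} (h : ContDiffAt ℝ n w z)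
    (hmn : m + 1 ≤ n) : ContDiffAt ℝ m (dy w) z :=
  (h.fderiv_right hmn).clm_apply contDiffAt_const

theorem dx_dy_comm {w : ℂ → ℝ} {z : ℂ} (h : ContDiffAt ℝ 2 w z) : dx (dy w) z = dy (dx w) z := by
  have hs : IsSymmSndFDerivAt ℝ w z := h.isSymmSndFDerivAt (by simp)
  have hd : DifferentiableAt ℝ (fderiv ℝ w) z :=
    (h.fderiv_right (m := 1) (by norm_num)).differentiableAt (by norm_num)
  have h1 : dx (dy w) z = fderiv ℝ (fderiv ℝ w) z 1 I := by
    refine (HasFDerivAt.dx_eq (hd.hasFDerivAt.clm_apply (hasFDerivAt_const I z))).trans ?_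
    simp
  have h2 : dy (dx w) z = fderiv ℝ (fderiv ℝ w) z I 1 := by
    refine (HasFDerivAt.dy_eq (hd.hasFDerivAt.clm_apply (hasFDerivAt_const (1 : ℂ) z))).trans ?_
    simp
  rw [h1, h2, hs.eq]

/-- At a local minimum the second derivative in each direction is nonnegative. -/
theorem hessian_nonneg_of_isLocalMin {w : ℂ → ℝ} {z : ℂ} (h : ContDiffAt ℝ 2 w z)
    (hmin : IsLocalMin w z) (p q : ℝ) :
    0 ≤ p ^ 2 * dx (dx w) z + 2 * (p * q) * dx (dy w) z + q ^ 2 * dy (dy w) z := by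
  set ξ : ℂ := p + q * I with hξ
  have hre : ξ.re = p := by simp [hξ]
  have him : ξ.im = q := by simp [hξ]
  set l : ℝ → ℂ := fun t => z + t • ξ with hl
  have hl0 : l 0 = z := by simp [hl]
  have hlc : Continuous l := by fun_prop
  have hld : ∀ t, HasDerivAt l ξ t := fun t => by
    simpa only [one_smul] using! ((hasDerivAt_id t).smul_const ξ).const_add z
  have hev : ∀ᶠ y in 𝓝 z, ContDiffAt ℝ 2 w y := h.eventually (by simp)
  have hev' : ∀ᶠ t in 𝓝 (0 : ℝ), ContDiffAt ℝ 2 w (l t) := by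
    have : Filter.Tendsto l (𝓝 0) (𝓝 z) := by simpa [hl0] using hlc.tendsto 0
    exact this.eventually hev
  have hd1 : ∀ᶠ t in 𝓝 (0 : ℝ), deriv (w ∘ l) t = p * dx w (l t) + q * dy w (l t) := by
    filter_upwards [hev'] with t ht
    have := ((ht.differentiableAt (by norm_num)).hasFDerivAt.comp_hasDerivAt t (hld t)).deriv
    rw [this, fderiv_apply_eq, hre, him]
  have hdx := ((contDiffAt_dx (m := 1) h (by norm_num)).differentiableAt (by norm_num)).hasFDerivAt
  have hdy := ((contDiffAt_dy (m := 1) h (by norm_num)).differentiableAt (by norm_num)).hasFDerivAt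
  have hd2 : deriv (deriv (w ∘ l)) 0
      = p ^ 2 * dx (dx w) z + 2 * (p * q) * dx (dy w) z + q ^ 2 * dy (dy w) z := by
    rw [Filter.EventuallyEq.deriv_eq hd1]
    rw [← hl0] at hdx hdy
    have e := (((hdx.comp_hasDerivAt 0 (hld 0)).const_mul p).add
      ((hdy.comp_hasDerivAt 0 (hld 0)).const_mul q)).deriv
    have e2 : deriv (fun t => p * dx w (l t) + q * dy w (l t)) 0 = _ := e
    rw [e2, fderiv_apply_eq, fderiv_apply_eq, hre, him, hl0, dx_dy_comm h]
    ring
  rw [← hd2]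
  by_contra hneg
  push Not at hneg
  have hcl : ContinuousAt (w ∘ l) 0 := by
    apply ContinuousAt.comp _ hlc.continuousAt
    rw [hl0]; exact h.continuousAt
  have hmin' : IsLocalMin (w ∘ l) 0 := by
    have : Filter.Tendsto l (𝓝 0) (𝓝 z) := by simpa [hl0] using hlc.tendsto 0
    have := this.eventually hmin
    filter_upwards [this] with t ht
    simpa [hl0] using ht
  -- A negative second derivative would make the minimum along the line a local maximum as well. The
  -- restriction would then be constant near `0`, with second derivative `0`.
  have hmax : IsLocalMax (w ∘ l) 0 :=
    isLocalMax_of_deriv_deriv_neg hneg hmin'.deriv_eq_zero hcl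
  have hconst : (w ∘ l) =ᶠ[𝓝 0] fun _ => (w ∘ l) 0 := by
    filter_upwards [hmin', hmax] with t h1 h2 using le_antisymm h2 h1
  have : deriv (deriv (w ∘ l)) 0 = 0 := by
    have h1 : deriv (w ∘ l) =ᶠ[𝓝 0] fun _ => 0 := by
      filter_upwards [hconst.eventuallyEq_nhds] with t ht
      rw [ht.deriv_eq]; simp
    rw [h1.deriv_eq]; simp
  linarith

/-- Completing the square: `a₁₁ L w` is the Hessian form at the vector `(a₁₁, a₁₂)` plus the
determinant of the coefficients times `w_yy`. Both terms are nonnegative at a minimum. -/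
theorem secondOrder_nonneg_of_isLocalMin {a₁₁ a₁₂ a₂₂ w : ℂ → ℝ} {z : ℂ} (h : ContDiffAt ℝ 2 w z)
    (hmin : IsLocalMin w z) (ha : 0 < a₁₁ z) (hdet : 0 ≤ a₁₁ z * a₂₂ z - a₁₂ z ^ 2) :
    0 ≤ secondOrder a₁₁ a₁₂ a₂₂ w z := by
  have h1 := hessian_nonneg_of_isLocalMin h hmin (a₁₁ z) (a₁₂ z)
  have h2 := hessian_nonneg_of_isLocalMin h hmin 0 1
  have h3 : a₁₁ z * secondOrder a₁₁ a₁₂ a₂₂ w z =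
      (a₁₁ z ^ 2 * dx (dx w) z + 2 * (a₁₁ z * a₁₂ z) * dx (dy w) z + a₁₂ z ^ 2 * dy (dy w) z)
      + (a₁₁ z * a₂₂ z - a₁₂ z ^ 2) * dy (dy w) z := by
    unfold secondOrder; ring
  have h4 : 0 ≤ dy (dy w) z := by simpa using h2
  have h5 : 0 ≤ a₁₁ z * secondOrder a₁₁ a₁₂ a₂₂ w z := by
    rw [h3]; have := mul_nonneg hdet h4; linarith
  exact nonneg_of_mul_nonneg_right h5 ha

/-- The barrier `exp (-k |z - c|²) - exp (-k R²)`. -/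
def barrier (k R : ℝ) (c z : ℂ) : ℝ :=
  Real.exp (-k * ((z.re - c.re) ^ 2 + (z.im - c.im) ^ 2)) - Real.exp (-k * R ^ 2)

section Barrier

variable (k R : ℝ) (c : ℂ)

theorem hasFDerivAt_re_sub (z : ℂ) : HasFDerivAt (fun z : ℂ => z.re - c.re) reCLM z :=
  reCLM.hasFDerivAt.sub_const _

theorem hasFDerivAt_im_sub (z : ℂ) : HasFDerivAt (fun z : ℂ => z.im - c.im) imCLM z :=
  imCLM.hasFDerivAt.sub_const _

theorem contDiff_barrier {n : WithTop ℕ∞} : ContDiff ℝ n (barrier k R c) := by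
  have h1 : ContDiff ℝ n (fun z : ℂ => z.re) := reCLM.contDiff
  have h2 : ContDiff ℝ n (fun z : ℂ => z.im) := imCLM.contDiff
  unfold barrier
  fun_prop

theorem hasFDerivAt_gauss (z : ℂ) :
    HasFDerivAt (fun z : ℂ => Real.exp (-k * ((z.re - c.re) ^ 2 + (z.im - c.im) ^ 2)))
      (Real.exp (-k * ((z.re - c.re) ^ 2 + (z.im - c.im) ^ 2)) •
        (-k) • ((2 * (z.re - c.re)) • reCLM + (2 * (z.im - c.im)) • imCLM)) z := by
  have := ((((hasFDerivAt_re_sub c z).pow 2).add ((hasFDerivAt_im_sub c z).pow 2)).const_mul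
    (-k)).exp
  refine HasFDerivAt.congr_fderiv this (ContinuousLinearMap.ext fun ξ => ?_)
  simp

theorem dx_barrier : dx (barrier k R c) = fun z =>
    -2 * k * ((z.re - c.re) * Real.exp (-k * ((z.re - c.re) ^ 2 + (z.im - c.im) ^ 2))) := by
  funext z
  refine (HasFDerivAt.dx_eq ((hasFDerivAt_gauss k c z).sub_const _)).trans ?_
  simp
  ring

theorem dy_barrier : dy (barrier k R c) = fun z =>
    -2 * k * ((z.im - c.im) * Real.exp (-k * ((z.re - c.re) ^ 2 + (z.im - c.im) ^ 2))) := by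
  funext z
  refine (HasFDerivAt.dy_eq ((hasFDerivAt_gauss k c z).sub_const _)).trans ?_
  simp
  ring

/-- The term in `k²` is the quadratic form of the coefficients at `z - c`. Away from `c` ellipticity
bounds it below, so it dominates the term in `k` when `k` is large. -/
theorem secondOrder_barrier (a₁₁ a₁₂ a₂₂ : ℂ → ℝ) (z : ℂ) :
    secondOrder a₁₁ a₁₂ a₂₂ (barrier k R c) z =
      Real.exp (-k * ((z.re - c.re) ^ 2 + (z.im - c.im) ^ 2)) *
      (4 * k ^ 2 * (a₁₁ z * (z.re - c.re) ^ 2 + 2 * a₁₂ z * ((z.re - c.re) * (z.im - c.im))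
        + a₂₂ z * (z.im - c.im) ^ 2) - 2 * k * (a₁₁ z + a₂₂ z)) := by
  have h1 := (((hasFDerivAt_re_sub c z).mul (hasFDerivAt_gauss k c z)).const_mul (-2 * k))
  have h2 := (((hasFDerivAt_im_sub c z).mul (hasFDerivAt_gauss k c z)).const_mul (-2 * k))
  have e1 := HasFDerivAt.dx_eq (w := fun z => -2 * k * ((z.re - c.re) *
    Real.exp (-k * ((z.re - c.re) ^ 2 + (z.im - c.im) ^ 2)))) h1
  have e2 := HasFDerivAt.dx_eq (w := fun z => -2 * k * ((z.im - c.im) *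
    Real.exp (-k * ((z.re - c.re) ^ 2 + (z.im - c.im) ^ 2)))) h2
  have e3 := HasFDerivAt.dy_eq (w := fun z => -2 * k * ((z.im - c.im) *
    Real.exp (-k * ((z.re - c.re) ^ 2 + (z.im - c.im) ^ 2)))) h2
  unfold secondOrder
  rw [dx_barrier, dy_barrier, e1, e2, e3]
  simp
  ring

end Barrier

theorem secondOrder_sub_const_mul {w h a₁₁ a₁₂ a₂₂ : ℂ → ℝ} {x : ℂ} (m : ℝ)
    (hw : ContDiffAt ℝ 2 w x) (hh : ContDiffAt ℝ 2 h x) :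
    secondOrder a₁₁ a₁₂ a₂₂ (fun z => w z - m * h z) x
      = secondOrder a₁₁ a₁₂ a₂₂ w x - m * secondOrder a₁₁ a₁₂ a₂₂ h x := by
  have hdx : dx (fun z => w z - m * h z) =ᶠ[𝓝 x] fun z => dx w z - m * dx h z := by
    filter_upwards [hw.eventually (by simp), hh.eventually (by simp)] with z hz hz'
    have h1 := hz.differentiableAt (by norm_num)
    have h2 := hz'.differentiableAt (by norm_num)
    rw [dx_sub h1 (h2.const_mul m), dx_const_mul m h2]
  have hdy : dy (fun z => w z - m * h z) =ᶠ[𝓝 x] fun z => dy w z - m * dy h z := by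
    filter_upwards [hw.eventually (by simp), hh.eventually (by simp)] with z hz hz'
    have h1 := hz.differentiableAt (by norm_num)
    have h2 := hz'.differentiableAt (by norm_num)
    rw [dy_sub h1 (h2.const_mul m), dy_const_mul m h2]
  have D1 := (contDiffAt_dx (m := 1) hw (by norm_num)).differentiableAt (by norm_num)
  have D2 := (contDiffAt_dy (m := 1) hw (by norm_num)).differentiableAt (by norm_num)
  have D3 := (contDiffAt_dx (m := 1) hh (by norm_num)).differentiableAt (by norm_num)
  have D4 := (contDiffAt_dy (m := 1) hh (by norm_num)).differentiableAt (by norm_num)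
  unfold secondOrder
  rw [dx_congr hdx, dx_congr hdy, dy_congr hdy, dx_sub D1 (D3.const_mul m), dx_const_mul m D3,
    dx_sub D2 (D4.const_mul m), dx_const_mul m D4, dy_sub D2 (D4.const_mul m), dy_const_mul m D4]
  ring

/-- At such a minimum `∇w = m ∇h` and `0 ≤ w < m h`, where `h` is the barrier. The inequality for
`w` therefore bounds `L w` by `m K e (4 k R + 1)`, with `e` the Gaussian factor of `h`. But `L (w -
m h) ≥ 0` forces `L w ≥ m L h ≥ m e (k² l R² - 2 k Λ)`. The assumption on `k` says that these are
incompatible. -/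
theorem not_isLocalMin_sub_barrier {w a₁₁ a₁₂ a₂₂ : ℂ → ℝ} {c x : ℂ} {R K l Λ k m : ℝ}
    (hR : 0 < R) (hK : 0 ≤ K) (hl : 0 < l) (hk0 : 0 < k)
    (hk : 0 < k ^ 2 * l * R ^ 2 - 2 * k * Λ - 4 * k * K * R - K) (hm0 : 0 < m)
    (hwx : ContDiffAt ℝ 2 w x)
    (hell : ∀ p q : ℝ,
      l * (p ^ 2 + q ^ 2) ≤ a₁₁ x * p ^ 2 + 2 * a₁₂ x * (p * q) + a₂₂ x * q ^ 2)
    (htr : a₁₁ x + a₂₂ x ≤ Λ)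
    (hpde : secondOrder a₁₁ a₁₂ a₂₂ w x ≤ K * (|dx w x| + |dy w x| + |w x|))
    (hw0 : 0 ≤ w x) (hx1 : dist x c < R) (hx2 : R / 2 < dist x c)
    (hxneg : w x - m * barrier k R c x < 0)
    (hmin : IsLocalMin (fun z => w z - m * barrier k R c z) x) : False := by
  have ha : 0 < a₁₁ x := by have := hell 1 0; simp at this; linarith
  -- The quadratic form at `(a₁₂, -a₁₁)` equals `a₁₁` times the determinant.
  have hdet : 0 ≤ a₁₁ x * a₂₂ x - a₁₂ x ^ 2 := by
    have h1 := hell (a₁₂ x) (-a₁₁ x)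
    have h2 : 0 ≤ l * (a₁₂ x ^ 2 + (-a₁₁ x) ^ 2) := by positivity
    have h3 : 0 ≤ a₁₁ x * (a₁₁ x * a₂₂ x - a₁₂ x ^ 2) := by
      have : a₁₁ x * (a₁₁ x * a₂₂ x - a₁₂ x ^ 2) = a₁₁ x * a₁₂ x ^ 2
        + 2 * a₁₂ x * (a₁₂ x * -a₁₁ x) + a₂₂ x * (-a₁₁ x) ^ 2 := by ring
      linarith
    exact nonneg_of_mul_nonneg_right h3 ha
  set h := barrier k R c with hh
  have hhx : ContDiffAt ℝ 2 h x := (contDiff_barrier k R c).contDiffAt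
  have hL := secondOrder_nonneg_of_isLocalMin (a₁₁ := a₁₁) (a₁₂ := a₁₂) (a₂₂ := a₂₂)
    (hwx.sub (contDiffAt_const.mul hhx)) hmin ha hdet
  rw [secondOrder_sub_const_mul m hwx hhx] at hL
  have hwd := hwx.differentiableAt (by norm_num)
  have hhd := hhx.differentiableAt (by norm_num)
  have hcrit := hmin.fderiv_eq_zero
  have c1 : dx w x = m * dx h x := by
    have := dx_sub hwd (hhd.const_mul m)
    rw [dx_const_mul m hhd, dx, hcrit] at this; simp at this; linarith
  have c2 : dy w x = m * dy h x := by
    have := dy_sub hwd (hhd.const_mul m)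
    rw [dy_const_mul m hhd, dy, hcrit] at this; simp at this; linarith
  have hX0 : (x.re - c.re) ^ 2 + (x.im - c.im) ^ 2 = dist x c ^ 2 := by
    rw [Complex.dist_eq, Complex.sq_norm, Complex.normSq_apply]; simp; ring
  set X := x.re - c.re with hX
  set Y := x.im - c.im with hY
  set e := Real.exp (-k * (X ^ 2 + Y ^ 2)) with he
  have he0 : 0 < e := Real.exp_pos _
  have hsx : X ^ 2 + Y ^ 2 = dist x c ^ 2 := hX0
  have hXR : |X| ≤ R := by
    apply abs_le_of_sq_le_sq _ hR.le
    nlinarith [sq_nonneg Y, dist_nonneg (x := x) (y := c)]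
  have hYR : |Y| ≤ R := by
    apply abs_le_of_sq_le_sq _ hR.le
    nlinarith [sq_nonneg X, dist_nonneg (x := x) (y := c)]
  have hdxh : |dx h x| ≤ 2 * k * R * e := by
    rw [hh, dx_barrier]
    simp only [abs_mul, abs_neg, abs_two, abs_of_pos hk0, ← hX, ← hY, ← he, abs_of_pos he0]
    have := mul_le_mul_of_nonneg_left hXR (mul_nonneg (mul_nonneg zero_le_two hk0.le) he0.le)
    linarith
  have hdyh : |dy h x| ≤ 2 * k * R * e := by
    rw [hh, dy_barrier]
    simp only [abs_mul, abs_neg, abs_two, abs_of_pos hk0, ← hX, ← hY, ← he, abs_of_pos he0]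
    have := mul_le_mul_of_nonneg_left hYR (mul_nonneg (mul_nonneg zero_le_two hk0.le) he0.le)
    linarith
  have hhe : h x ≤ e := by
    simp only [hh, barrier, ← hX, ← hY, ← he]
    linarith [Real.exp_pos (-k * R ^ 2)]
  have hLh : e * (k ^ 2 * l * R ^ 2 - 2 * k * Λ) ≤ secondOrder a₁₁ a₁₂ a₂₂ h x := by
    rw [hh, secondOrder_barrier, ← hX, ← hY, ← he]
    have h1 := hell X Y
    have h2 := htr
    -- Being outside the half disc turns `4 k² l |x - c|²` into at least `k² l R²`.
    have h3 : l * (R / 2) ^ 2 ≤ l * (X ^ 2 + Y ^ 2) := by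
      rw [hsx]; gcongr
    apply mul_le_mul_of_nonneg_left _ he0.le
    have h4 : k * (a₁₁ x + a₂₂ x) ≤ k * Λ := by gcongr
    have h5 : 4 * k ^ 2 * (l * (R / 2) ^ 2)
        ≤ 4 * k ^ 2 * (a₁₁ x * X ^ 2 + 2 * a₁₂ x * (X * Y) + a₂₂ x * Y ^ 2) := by
      gcongr; linarith only [h1, h3]
    linarith only [h4, h5]
  have hbound : K * (|dx w x| + |dy w x| + |w x|) ≤ m * (K * (e * (4 * k * R + 1))) := by
    rw [c1, c2, abs_mul, abs_mul, abs_of_pos hm0, abs_of_nonneg hw0]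
    have h1 : w x ≤ m * e := by
      have := mul_le_mul_of_nonneg_left hhe hm0.le
      linarith
    have h2 := mul_le_mul_of_nonneg_left hdxh hm0.le
    have h3 := mul_le_mul_of_nonneg_left hdyh hm0.le
    have h4 : m * |dx h x| + m * |dy h x| + w x ≤ m * (e * (4 * k * R + 1)) := by linarith
    have := mul_le_mul_of_nonneg_left h4 hK
    linarith
  have hfin := mul_le_mul_of_nonneg_left hLh hm0.le
  have hp : 0 < m * e * (k ^ 2 * l * R ^ 2 - 2 * k * Λ - 4 * k * K * R - K) := by positivity
  have : m * (e * (k ^ 2 * l * R ^ 2 - 2 * k * Λ)) ≤ m * (K * (e * (4 * k * R + 1))) := by linarith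
  linarith

/-- Hopf's boundary point lemma, for a differential inequality. -/
theorem hopf_boundary {w a₁₁ a₁₂ a₂₂ : ℂ → ℝ} {c z₀ : ℂ} {R K l Λ : ℝ} (hR : 0 < R)
    (hK : 0 ≤ K) (hl : 0 < l)
    (hw : ∀ z ∈ closedBall c R, ContDiffAt ℝ 2 w z)
    (hnonneg : ∀ z ∈ closedBall c R, 0 ≤ w z) (hpos : ∀ z ∈ ball c R, 0 < w z)
    (hell : ∀ z ∈ ball c R, ∀ p q : ℝ,
      l * (p ^ 2 + q ^ 2) ≤ a₁₁ z * p ^ 2 + 2 * a₁₂ z * (p * q) + a₂₂ z * q ^ 2)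
    (htr : ∀ z ∈ ball c R, a₁₁ z + a₂₂ z ≤ Λ)
    (hpde : ∀ z ∈ ball c R, secondOrder a₁₁ a₁₂ a₂₂ w z ≤ K * (|dx w z| + |dy w z| + |w z|))
    (hz₀ : dist z₀ c = R) (hz₀' : w z₀ = 0) : 0 < fderiv ℝ w z₀ (c - z₀) := by
  have hs : ∀ z : ℂ, (z.re - c.re) ^ 2 + (z.im - c.im) ^ 2 = dist z c ^ 2 := fun z => by
    rw [Complex.dist_eq, Complex.sq_norm, Complex.normSq_apply]; simp; ring
  -- The quadratic term in `k` beats the others. `C` collects their coefficients, and `k ≥ 1` lets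
  -- `K` be absorbed in `k K`.
  obtain ⟨k, hk0, hk⟩ : ∃ k : ℝ, 0 < k ∧
      0 < k ^ 2 * l * R ^ 2 - 2 * k * Λ - 4 * k * K * R - K := by
    set C := 2 * |Λ| + 4 * K * R + K with hC
    have hC0 : 0 ≤ C := by positivity
    have hd : 0 < l * R ^ 2 := by positivity
    refine ⟨(C + 1) / (l * R ^ 2) + 1, by positivity, ?_⟩
    set k := (C + 1) / (l * R ^ 2) + 1 with hkd
    have hk1 : 1 ≤ k := by have : 0 ≤ (C + 1) / (l * R ^ 2) := by positivity
                           linarith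
    have : k * (l * R ^ 2) = C + 1 + l * R ^ 2 := by rw [hkd]; field_simp
    have h1 : k ^ 2 * l * R ^ 2 = k * (C + 1 + l * R ^ 2) := by rw [← this]; ring
    have h2 : k * Λ ≤ k * |Λ| := by gcongr; exact le_abs_self _
    have h3 : K ≤ k * K := by nlinarith
    rw [h1, hC]
    nlinarith
  -- With `m` the minimum of `w` on the inner disc and `h ≤ 1`, one has `w ≥ m h` on the inner
  -- circle. On the outer circle `h = 0`.
  obtain ⟨m, hm0, hm⟩ : ∃ m : ℝ, 0 < m ∧ ∀ z ∈ closedBall c (R / 2), m ≤ w z := by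
    have hsub : closedBall c (R / 2) ⊆ ball c R := closedBall_subset_ball (by linarith)
    obtain ⟨y, hy, hmin⟩ := (isCompact_closedBall c (R / 2)).exists_isMinOn
      ⟨c, mem_closedBall_self (by linarith)⟩
      (fun z hz => (hw z (ball_subset_closedBall (hsub hz))).continuousAt.continuousWithinAt)
    exact ⟨w y, hpos y (hsub hy), fun z hz => hmin hz⟩
  set h := barrier k R c with hh
  have hle1 : ∀ z, h z ≤ 1 := fun z => by
    have h1 : Real.exp (-k * ((z.re - c.re) ^ 2 + (z.im - c.im) ^ 2)) ≤ 1 := by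
      rw [Real.exp_le_one_iff]
      have := mul_nonneg hk0.le (add_nonneg (sq_nonneg (z.re - c.re)) (sq_nonneg (z.im - c.im)))
      linarith
    have h2 := (Real.exp_pos (-k * R ^ 2)).le
    simp only [hh, barrier]; linarith
  have hφC : ∀ z ∈ closedBall c R, ContDiffAt ℝ 2 (fun z => w z - m * h z) z := fun z hz =>
    (hw z hz).sub (contDiffAt_const.mul (contDiff_barrier k R c).contDiffAt)
  -- Comparison on the annulus: a negative minimum of `w - m h` cannot lie on either circle, and
  -- `not_isLocalMin_sub_barrier` excludes the open annulus.
  have key : ∀ z ∈ closedBall c R, R / 2 ≤ dist z c → 0 ≤ w z - m * h z := by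
    by_contra hcon
    push Not at hcon
    obtain ⟨y, hy1, hy2, hy3⟩ := hcon
    have hcomp : IsCompact (closedBall c R ∩ {z | R / 2 ≤ dist z c}) :=
      (isCompact_closedBall c R).inter_right (isClosed_le continuous_const (by fun_prop))
    obtain ⟨x, hx, hxmin⟩ := hcomp.exists_isMinOn ⟨y, hy1, hy2⟩
      (fun z hz => (hφC z hz.1).continuousAt.continuousWithinAt)
    have hxneg : w x - m * h x < 0 := lt_of_le_of_lt (hxmin ⟨hy1, hy2⟩) hy3
    have hx1 : dist x c < R := by
      refine lt_of_le_of_ne hx.1 fun he => ?_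
      have h0 : h x = 0 := by simp only [hh, barrier]; rw [hs, he]; simp
      have := hnonneg x hx.1
      rw [h0] at hxneg; linarith
    have hx2 : R / 2 < dist x c := by
      refine lt_of_le_of_ne hx.2 fun he => ?_
      have h1 := hm x (by rw [mem_closedBall]; exact he.ge)
      have h2 : m * h x ≤ m * 1 := by gcongr; exact hle1 x
      linarith
    have hmin : IsLocalMin (fun z => w z - m * h z) x := by
      have hopen : IsOpen (ball c R ∩ {z | R / 2 < dist z c}) :=
        isOpen_ball.inter (isOpen_lt continuous_const (by fun_prop))
      filter_upwards [hopen.mem_nhds ⟨hx1, hx2⟩] with z hz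
      exact hxmin ⟨ball_subset_closedBall hz.1, (show R / 2 < dist z c from hz.2).le⟩
    exact not_isLocalMin_sub_barrier hR hK hl hk0 hk hm0 (hw x hx.1) (hell x hx1) (htr x hx1)
      (hpde x hx1) (hnonneg x hx.1) hx1 hx2 hxneg hmin
  set L : ℝ → ℂ := fun t => z₀ + t • (c - z₀) with hL
  have hLd : HasDerivAt L (c - z₀) 0 := by
    simpa only [one_smul] using! ((hasDerivAt_id (0 : ℝ)).smul_const (c - z₀)).const_add z₀
  have hL0 : L 0 = z₀ := by simp [hL]
  have hz₀b : z₀ ∈ closedBall c R := by rw [mem_closedBall, hz₀]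
  have hφd : HasFDerivAt (fun z => w z - m * h z) (fderiv ℝ w z₀ - m • fderiv ℝ h z₀) (L 0) := by
    rw [hL0]
    exact ((hw z₀ hz₀b).differentiableAt (by norm_num)).hasFDerivAt.sub
      (((contDiff_barrier (n := 1) k R c).differentiable (by norm_num) z₀).hasFDerivAt.const_mul m)
  have hφd' := (hφd.comp_hasDerivAt 0 hLd).hasDerivWithinAt (s := Set.Ici 0)
  -- `w - m h` vanishes at `z₀` and is nonnegative along the radius towards `c` as long as this
  -- stays in the annulus, that is for parameters below `1/2`. The inward derivative of `h` is
  -- positive and gives the strict inequality for `w`.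
  have hge : 0 ≤ (fderiv ℝ w z₀ - m • fderiv ℝ h z₀) (c - z₀) := by
    have hzero : w (L 0) - m * h (L 0) = 0 := by
      rw [hL0, hz₀']; simp only [hh, barrier]; rw [hs, hz₀]; simp
    have hmem : ∀ᶠ t in 𝓝[>] (0 : ℝ), 0 ≤ slope ((fun z => w z - m * h z) ∘ L) 0 t := by
      filter_upwards [Ioo_mem_nhdsGT (show (0 : ℝ) < 1 / 2 by norm_num)] with t ht
      have hd : dist (L t) c = (1 - t) * R := by
        have : L t - c = (1 - t) • (z₀ - c) := by simp only [hL, smul_sub, sub_smul, one_smul]; abel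
        rw [dist_eq_norm, this, norm_smul, ← dist_eq_norm z₀, hz₀, Real.norm_of_nonneg]
        linarith [ht.2]
      have := key (L t) (by rw [mem_closedBall, hd]; nlinarith [ht.1]) (by rw [hd]; nlinarith [ht.2])
      rw [slope_def_field]
      apply div_nonneg _ (by linarith [ht.1])
      simp only [Function.comp]
      linarith
    have htend := (hasDerivWithinAt_iff_tendsto_slope.1 hφd')
    rw [show Set.Ici (0 : ℝ) \ {0} = Set.Ioi 0 by ext; simp [lt_iff_le_and_ne, eq_comm]] at htend
    exact ge_of_tendsto htend hmem
  have hhc : fderiv ℝ h z₀ (c - z₀) = 2 * k * R ^ 2 * Real.exp (-k * R ^ 2) := by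
    rw [fderiv_apply_eq, hh, dx_barrier, dy_barrier]
    simp only [hs, hz₀, Complex.sub_re, Complex.sub_im]
    rw [← hz₀, ← hs]; ring
  simp only [sub_apply, smul_apply, smul_eq_mul, hhc] at hge
  have : 0 < m * (2 * k * R ^ 2 * Real.exp (-k * R ^ 2)) := by positivity
  linarith

end H2R

end

/-! ### The strong minimum principle and contact at the boundary. -/

noncomputable section

namespace H2R

open Complex Metric

/-- At `z`, the operator with coefficients `a₁₁, a₁₂, a₂₂` is elliptic with constants `l`, `Λ`, and
`w` satisfies the differential inequality `|L w| ≤ K (|w_x| + |w_y| + |w|)`. -/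
structure EllipticIneq (a₁₁ a₁₂ a₂₂ w : ℂ → ℝ) (l Λ K : ℝ) (z : ℂ) : Prop where
  ell : ∀ p q : ℝ, l * (p ^ 2 + q ^ 2) ≤ a₁₁ z * p ^ 2 + 2 * a₁₂ z * (p * q) + a₂₂ z * q ^ 2
  tr : a₁₁ z + a₂₂ z ≤ Λ
  ineq : |secondOrder a₁₁ a₁₂ a₂₂ w z| ≤ K * (|dx w z| + |dy w z| + |w z|)

section StrongMinimum

variable {w a₁₁ a₁₂ a₂₂ : ℂ → ℝ} {l Λ K : ℝ} {O : Set ℂ}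

/-- The strong minimum principle: the zeros of a nonnegative solution form an open set. -/
theorem eventually_eq_zero_of_nonneg (hK : 0 ≤ K) (hl : 0 < l) (hO : IsOpen O)
    (hw : ∀ z ∈ O, ContDiffAt ℝ 2 w z) (hnonneg : ∀ z ∈ O, 0 ≤ w z)
    (hL : ∀ z ∈ O, EllipticIneq a₁₁ a₁₂ a₂₂ w l Λ K z) {z₀ : ℂ} (hz₀ : z₀ ∈ O) (h0 : w z₀ = 0) :
    ∀ᶠ z in 𝓝 z₀, w z = 0 := by
  obtain ⟨ε, hε, hball⟩ := Metric.isOpen_iff.1 hO z₀ hz₀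
  set r := ε / 3 with hr
  have hr0 : 0 < r := by positivity
  have hsub : closedBall z₀ (2 * r) ⊆ O := (closedBall_subset_ball (by linarith)).trans hball
  filter_upwards [ball_mem_nhds z₀ hr0] with z₁ hz₁
  by_contra hne
  have hz₁' : dist z₁ z₀ < r := hz₁
  have hZ : IsCompact (closedBall z₀ (2 * r) ∩ w ⁻¹' {0}) := by
    refine IsCompact.of_isClosed_subset (isCompact_closedBall z₀ (2 * r)) ?_
      Set.inter_subset_left
    exact ContinuousOn.preimage_isClosed_of_isClosed
      (fun z hz => (hw z (hsub hz)).continuousAt.continuousWithinAt) isClosed_closedBall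
      isClosed_singleton
  have hZne : (closedBall z₀ (2 * r) ∩ w ⁻¹' {0}).Nonempty :=
    ⟨z₀, mem_closedBall_self (by linarith), h0⟩
  -- The disc centred at `z₁` that reaches the nearest zero `z₂` contains no zero in its interior.
  -- Hopf's lemma makes the derivative at `z₂` nonzero, while `z₂` is an interior minimum of `w`.
  -- The radius `2r` leaves room for this disc, as `z₁` is within `r` of the zero `z₀`.
  obtain ⟨z₂, hz₂, hd⟩ := hZ.exists_infDist_eq_dist hZne z₁
  set d := dist z₁ z₂ with hdd
  have hmin : ∀ y ∈ closedBall z₀ (2 * r) ∩ w ⁻¹' {0}, d ≤ dist z₁ y := fun y hy => by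
    rw [← hd]; exact infDist_le_dist_of_mem hy
  have hdr : d < r := lt_of_le_of_lt (hmin z₀ ⟨mem_closedBall_self (by linarith), h0⟩) hz₁'
  have hd0 : 0 < d := dist_pos.2 fun h => hne (by rw [h]; exact hz₂.2)
  have hcb : closedBall z₁ d ⊆ closedBall z₀ (2 * r) := fun y hy => by
    have h1 : dist y z₁ ≤ d := hy
    have := dist_triangle y z₁ z₀
    rw [mem_closedBall]; linarith
  have hpos : ∀ z ∈ ball z₁ d, 0 < w z := fun z hz => by
    refine lt_of_le_of_ne (hnonneg z (hsub (hcb (ball_subset_closedBall hz)))) fun he => ?_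
    have h1 := hmin z ⟨hcb (ball_subset_closedBall hz), he.symm⟩
    have h2 : dist z z₁ < d := hz
    rw [dist_comm] at h2; linarith
  have hin : ∀ z ∈ closedBall z₁ d, z ∈ O := fun z hz => hsub (hcb hz)
  have hin' : ∀ z ∈ ball z₁ d, z ∈ O := fun z hz => hin z (ball_subset_closedBall hz)
  have := hopf_boundary hd0 hK hl (fun z hz => hw z (hin z hz)) (fun z hz => hnonneg z (hin z hz))
    hpos (fun z hz => (hL z (hin' z hz)).ell) (fun z hz => (hL z (hin' z hz)).tr)
    (fun z hz => (le_abs_self _).trans (hL z (hin' z hz)).ineq) (by rw [dist_comm]) hz₂.2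
  have hcrit : IsLocalMin w z₂ := by
    filter_upwards [hO.mem_nhds (hsub hz₂.1)] with y hy
    rw [show w z₂ = 0 from hz₂.2]; exact hnonneg y hy
  rw [hcrit.fderiv_eq_zero] at this
  simp at this

/-- The interior of the zero set is relatively closed in `S`: by continuity a limit of zeros is a
zero, and `eventually_eq_zero_of_nonneg` makes it an interior one. -/
theorem eq_zero_on_of_isPreconnected (hK : 0 ≤ K) (hl : 0 < l) (hO : IsOpen O)
    (hw : ∀ z ∈ O, ContDiffAt ℝ 2 w z) (hnonneg : ∀ z ∈ O, 0 ≤ w z)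
    (hL : ∀ z ∈ O, EllipticIneq a₁₁ a₁₂ a₂₂ w l Λ K z) {S : Set ℂ} (hS : IsPreconnected S)
    (hSO : S ⊆ O) {z₀ : ℂ} (hz₀ : z₀ ∈ S) (h0 : w z₀ = 0) : ∀ z ∈ S, w z = 0 := by
  have hsub : S ⊆ interior {z | w z = 0} := by
    refine hS.subset_of_closure_inter_subset isOpen_interior ⟨z₀, hz₀, ?_⟩ ?_
    · exact mem_interior_iff_mem_nhds.2
        (eventually_eq_zero_of_nonneg hK hl hO hw hnonneg hL (hSO hz₀) h0)
    · rintro z ⟨hz, hzS⟩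
      have hz' : z ∈ closure {z | w z = 0} := closure_mono interior_subset hz
      have hwz : w z = 0 := by
        have hc := (hw z (hSO hzS)).continuousAt
        have hm : w z ∈ closure (w '' {z | w z = 0}) := mem_closure_image hc hz'
        have : w '' {z | w z = 0} ⊆ {0} := by rintro _ ⟨y, hy, rfl⟩; exact hy
        simpa using closure_mono this hm
      exact mem_interior_iff_mem_nhds.2
        (eventually_eq_zero_of_nonneg hK hl hO hw hnonneg hL (hSO hzS) hwz)
  intro z hz
  exact (interior_subset (hsub hz) : z ∈ {z | w z = 0})

end StrongMinimum

/-- Second order Taylor bound for a `C²` function. -/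
theorem exists_taylor_bound {ρ : ℂ → ℝ} {c : ℂ} (h : ContDiffAt ℝ 2 ρ c) :
    ∃ M r : ℝ, 0 ≤ M ∧ 0 < r ∧ ∀ z ∈ ball c r,
      |ρ z - ρ c - fderiv ℝ ρ c (z - c)| ≤ M * dist z c ^ 2 := by
  obtain ⟨K, t, ht, hlip⟩ :=
    (h.fderiv_right (m := 1) (by norm_num)).exists_lipschitzOnWith
  have hdiff : ∀ᶠ z in 𝓝 c, DifferentiableAt ℝ ρ z :=
    (h.eventually (by simp)).mono fun z hz => hz.differentiableAt (by norm_num)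
  obtain ⟨r, hr, hball⟩ := Metric.mem_nhds_iff.1 (Filter.inter_mem ht hdiff)
  refine ⟨K, r, K.2, hr, fun z hz => ?_⟩
  have hzr : dist z c < r := hz
  have hsub : closedBall c (dist z c) ⊆ ball c r := closedBall_subset_ball hzr
  have := (convex_closedBall c (dist z c)).norm_image_sub_le_of_norm_hasFDerivWithin_le'
    (f := ρ) (f' := fderiv ℝ ρ) (φ := fderiv ℝ ρ c) (C := K * dist z c) (x := c) (y := z)
    (fun y hy => (hball (hsub hy)).2.hasFDerivAt.hasFDerivWithinAt)
    (fun y hy => by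
      have h1 := hlip.dist_le_mul y (hball (hsub hy)).1 c (hball (mem_ball_self hr)).1
      rw [dist_eq_norm] at h1
      have h2 : dist y c ≤ dist z c := hy
      exact h1.trans (mul_le_mul_of_nonneg_left h2 K.2))
    (mem_closedBall_self dist_nonneg) (by rw [mem_closedBall])
  rw [← dist_eq_norm z c] at this
  rw [← Real.norm_eq_abs]
  calc _ ≤ _ := this
    _ = _ := by ring

/-- A nonnegative solution on the intersection of two domains with a common interior conormal at a
common boundary point `c`, that vanishes to first order at `c`, vanishes near `c`. -/
theorem eq_zero_of_boundary_contact {w a₁₁ a₁₂ a₂₂ : ℂ → ℝ} {l Λ K R₀ : ℝ} {c e : ℂ}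
    {ρ : Fin 2 → ℂ → ℝ} {b : Fin 2 → ℝ} (hK : 0 ≤ K) (hl : 0 < l) (hR₀ : 0 < R₀)
    (hw : ∀ z ∈ ball c R₀, ContDiffAt ℝ 2 w z)
    (hρ : ∀ i, ∀ z ∈ ball c R₀, ContDiffAt ℝ 2 (ρ i) z) (hρc : ∀ i, ρ i c = 0)
    (he : ‖e‖ = 1) (hb : ∀ i, 0 < b i)
    (hρd : ∀ i, ∀ ξ, fderiv ℝ (ρ i) c ξ = b i * (e.re * ξ.re + e.im * ξ.im))
    (hnonneg : ∀ z ∈ ball c R₀, (∀ i, 0 < ρ i z) → 0 ≤ w z)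
    (hL : ∀ z ∈ ball c R₀, (∀ i, 0 < ρ i z) → EllipticIneq a₁₁ a₁₂ a₂₂ w l Λ K z)
    (hwc : w c = 0) (hwd : fderiv ℝ w c = 0) :
    ∀ᶠ z in 𝓝 c, (∀ i, 0 ≤ ρ i z) → w z = 0 := by
  have hee : e.re ^ 2 + e.im ^ 2 = 1 := by
    have := Complex.sq_norm e; rw [he, Complex.normSq_apply] at this; nlinarith
  set O : Set ℂ := {z | z ∈ ball c R₀ ∧ ∀ i, 0 < ρ i z} with hOdef
  have hO : IsOpen O := by
    rw [isOpen_iff_mem_nhds]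
    rintro z ⟨hz, hzi⟩
    have h1 : ∀ᶠ y in 𝓝 z, ∀ i, 0 < ρ i y := Filter.eventually_all.2 fun i =>
      (hρ i z hz).continuousAt.eventually (lt_mem_nhds (hzi i))
    filter_upwards [isOpen_ball.mem_nhds hz, h1] with y hy1 hy2 using ⟨hy1, hy2⟩
  have hcR : c ∈ ball c R₀ := mem_ball_self hR₀
  choose M r₀ hM hr₀ htay using fun i => exists_taylor_bound (hρ i c hcR)
  have hder : ∀ i, ∀ᶠ y in 𝓝 c, 0 < fderiv ℝ (ρ i) y e := fun i => by
    have hcont : ContinuousAt (fun y => fderiv ℝ (ρ i) y e) c :=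
      (((hρ i c hcR).fderiv_right (m := 1) (by norm_num)).continuousAt).clm_apply
        continuousAt_const
    refine hcont.eventually (lt_mem_nhds ?_)
    change 0 < fderiv ℝ (ρ i) c e
    rw [hρd i e]
    have : e.re * e.re + e.im * e.im = 1 := by linarith [hee]
    rw [this, mul_one]; exact hb i
  obtain ⟨r₁, hr₁, hball₁⟩ := Metric.mem_nhds_iff.1
    (Filter.inter_mem (ball_mem_nhds c hR₀) (Filter.eventually_all.2 hder))
  -- The bound `2 r M i < b i` makes the disc of radius `r` more curved than the boundary of each
  -- domain. The other bounds keep it where the Taylor estimates and the monotonicity along `e`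
  -- hold.
  obtain ⟨r, hr, hrr₁, hrr₀, hrM⟩ : ∃ r : ℝ, 0 < r ∧ 2 * r < r₁ ∧ (∀ i, 2 * r < r₀ i) ∧
      ∀ i, 2 * r * M i < b i := by
    have h1 : ∀ᶠ r in 𝓝[>] (0 : ℝ), 2 * r < r₁ := by
      have : Filter.Tendsto (fun r : ℝ => 2 * r) (𝓝[>] 0) (𝓝 (2 * 0)) :=
        ((continuous_const.mul continuous_id).tendsto 0).mono_left nhdsWithin_le_nhds
      exact this.eventually (gt_mem_nhds (by simpa using hr₁))
    have h2 : ∀ᶠ r in 𝓝[>] (0 : ℝ), ∀ i, 2 * r < r₀ i := Filter.eventually_all.2 fun i => by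
      have : Filter.Tendsto (fun r : ℝ => 2 * r) (𝓝[>] 0) (𝓝 (2 * 0)) :=
        ((continuous_const.mul continuous_id).tendsto 0).mono_left nhdsWithin_le_nhds
      exact this.eventually (gt_mem_nhds (by simpa using hr₀ i))
    have h3 : ∀ᶠ r in 𝓝[>] (0 : ℝ), ∀ i, 2 * r * M i < b i := Filter.eventually_all.2 fun i => by
      have : Filter.Tendsto (fun r : ℝ => 2 * r * M i) (𝓝[>] 0) (𝓝 (2 * 0 * M i)) :=
        (((continuous_const.mul continuous_id).mul continuous_const).tendsto 0).mono_left
          nhdsWithin_le_nhds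
      exact this.eventually (gt_mem_nhds (by simpa using hb i))
    have h0 : ∀ᶠ r in 𝓝[>] (0 : ℝ), 0 < r := self_mem_nhdsWithin
    obtain ⟨r, h, h1, h2, h3⟩ := (h0.and (h1.and (h2.and h3))).exists
    exact ⟨r, h, h1, h2, h3⟩
  set c' : ℂ := c + r • e with hc'
  have hdc' : dist c c' = r := by
    rw [hc', dist_self_add_right, norm_smul, he, Real.norm_of_nonneg hr.le, mul_one]
  have hcl2 : ∀ z ∈ closedBall c' r, dist z c ≤ 2 * r := fun z hz => by
    have h1 : dist z c' ≤ r := hz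
    have := dist_triangle z c' c
    rw [dist_comm c' c, hdc'] at this; linarith
  -- In the disc `|z - c|² ≤ 2 r e·(z - c)`. By Taylor, `ρ i z` is then at least `(b i / (2 r) - M
  -- i) |z - c|²`, which is positive.
  have hclO : ∀ z ∈ closedBall c' r, z ≠ c → z ∈ O := by
    intro z hz hzc
    have h2 := hcl2 z hz
    have hzr₁ : z ∈ ball c r₁ := lt_of_le_of_lt h2 hrr₁
    refine ⟨(hball₁ hzr₁).1, fun i => ?_⟩
    have ht := (abs_le.1 (htay i z (lt_of_le_of_lt h2 (hrr₀ i)))).1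
    rw [hρc, hρd] at ht
    have hd : dist z c ^ 2 = (z.re - c.re) ^ 2 + (z.im - c.im) ^ 2 := by
      rw [Complex.dist_eq, Complex.sq_norm, Complex.normSq_apply]; simp; ring
    have hd' : dist z c' ^ 2 ≤ r ^ 2 := by
      have : dist z c' ≤ r := hz
      gcongr
    have hd'' : dist z c' ^ 2 = (z.re - c.re - r * e.re) ^ 2 + (z.im - c.im - r * e.im) ^ 2 := by
      rw [Complex.dist_eq, Complex.sq_norm, Complex.normSq_apply, hc']; simp; ring
    have hkey : dist z c ^ 2 ≤ 2 * r * (e.re * (z - c).re + e.im * (z - c).im) := by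
      rw [hd, Complex.sub_re, Complex.sub_im]
      have : r ^ 2 * (e.re ^ 2 + e.im ^ 2) = r ^ 2 := by rw [hee, mul_one]
      nlinarith
    have hpos : 0 < dist z c ^ 2 := by have := dist_pos.2 hzc; positivity
    have h3 : M i * dist z c ^ 2 * (2 * r) < b i * dist z c ^ 2 := by
      have := mul_lt_mul_of_pos_right (hrM i) hpos
      linarith
    have h4 := mul_le_mul_of_nonneg_left hkey (hb i).le
    have h5 : 0 < 2 * r * ρ i z := by nlinarith
    have : 0 < 2 * r := by linarith
    exact pos_of_mul_pos_right h5 this.le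
  have hnonnegO : ∀ z ∈ O, 0 ≤ w z := fun z hz => hnonneg z hz.1 hz.2
  have hLO : ∀ z ∈ O, EllipticIneq a₁₁ a₁₂ a₂₂ w l Λ K z := fun z hz => hL z hz.1 hz.2
  have hwO : ∀ z ∈ O, ContDiffAt ℝ 2 w z := fun z hz => hw z hz.1
  have hballO : ∀ z ∈ ball c' r, z ∈ O := fun z hz => hclO z (ball_subset_closedBall hz) fun h => by
    have : dist z c' < r := hz
    rw [h, hdc'] at this; exact lt_irrefl _ this
  -- Otherwise `w` is positive in the disc and Hopf's lemma contradicts `dw = 0` at `c`.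
  obtain ⟨z₁, hz₁, hwz₁⟩ : ∃ z₁ ∈ ball c' r, w z₁ = 0 := by
    by_contra hcon
    push Not at hcon
    have := hopf_boundary (z₀ := c) hr hK hl (w := w) (c := c')
      (fun z hz => hw z ((hball₁ (lt_of_le_of_lt (hcl2 z hz) hrr₁)).1))
      (fun z hz => by
        by_cases h : z = c
        · rw [h, hwc]
        · exact hnonnegO z (hclO z hz h))
      (fun z hz => lt_of_le_of_ne (hnonnegO z (hballO z hz)) (hcon z hz).symm)
      (fun z hz => (hLO z (hballO z hz)).ell) (fun z hz => (hLO z (hballO z hz)).tr)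
      (fun z hz => (le_abs_self _).trans (hLO z (hballO z hz)).ineq) hdc' hwc
    rw [hwd] at this
    simp at this
  filter_upwards [ball_mem_nhds c hr] with z hz hzi
  have hzr : dist z c < r := hz
  have hline : ∀ t ∈ Set.Icc (0 : ℝ) r, z + t • e ∈ ball c r₁ := fun t ht => by
    have h1 : dist (z + t • e) c ≤ dist (z + t • e) z + dist z c := dist_triangle _ _ _
    rw [dist_self_add_left, norm_smul, he, Real.norm_of_nonneg ht.1, mul_one] at h1
    rw [mem_ball]; linarith [ht.2]
  have hld : ∀ t, HasDerivAt (fun t : ℝ => z + t • e) e t := fun t => by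
    simpa only [one_smul] using! ((hasDerivAt_id t).smul_const e).const_add z
  have hlineO : ∀ t ∈ Set.Ioc (0 : ℝ) r, z + t • e ∈ O := by
    intro t ht
    refine ⟨(hball₁ (hline t ⟨ht.1.le, ht.2⟩)).1, fun i => lt_of_le_of_lt (hzi i) ?_⟩
    have hd : ∀ s ∈ Set.Icc (0 : ℝ) r, HasDerivAt (fun s : ℝ => ρ i (z + s • e))
        (fderiv ℝ (ρ i) (z + s • e) e) s := fun s hs =>
      ((hρ i _ (hball₁ (hline s hs)).1).differentiableAt (by norm_num)).hasFDerivAt.comp_hasDerivAt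
        s (hld s)
    have hmono : StrictMonoOn (fun s : ℝ => ρ i (z + s • e)) (Set.Icc 0 r) := by
      refine strictMonoOn_of_deriv_pos (convex_Icc 0 r)
        (fun s hs => (hd s hs).continuousAt.continuousWithinAt) fun s hs => ?_
      rw [interior_Icc] at hs
      have hs' : s ∈ Set.Icc 0 r := ⟨hs.1.le, hs.2.le⟩
      rw [(hd s hs').deriv]
      exact (hball₁ (hline s hs')).2 i
    have := hmono ⟨le_rfl, hr.le⟩ ⟨ht.1.le, ht.2⟩ ht.1
    simpa using this
  -- The half-open segment from `z` in the direction `e` lies in `O`, because both `ρ i` increase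
  -- strictly along `e`, and it ends in the disc. The point `z` itself, possibly on a boundary, is
  -- reached by continuity.
  set S : Set ℂ := ball c' r ∪ (fun t : ℝ => z + t • e) '' Set.Ioc 0 r with hS
  have hSpre : IsPreconnected S := by
    refine IsPreconnected.union (z + r • e) ?_ ⟨r, ⟨hr, le_rfl⟩, rfl⟩
      (convex_ball c' r).isPreconnected ?_
    · rw [mem_ball, hc', dist_add_right]; exact hzr
    · exact isPreconnected_Ioc.image _ (by fun_prop)
  have hSO : S ⊆ O := by
    rintro y (hy | ⟨t, ht, rfl⟩)
    · exact hballO y hy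
    · exact hlineO t ht
  have hzero := eq_zero_on_of_isPreconnected hK hl hO hwO hnonnegO hLO hSpre hSO
    (Or.inl hz₁) hwz₁
  have hzb : z ∈ ball c R₀ := by
    have := (hball₁ (hline 0 ⟨le_rfl, hr.le⟩)).1
    simpa using this
  have htend : Filter.Tendsto (fun t : ℝ => w (z + t • e)) (𝓝[>] 0) (𝓝 (w z)) := by
    have h1 : ContinuousAt (fun t : ℝ => w (z + t • e)) 0 := by
      apply ContinuousAt.comp (g := w)
      · simpa using (hw z hzb).continuousAt
      · fun_prop
    have := h1.tendsto
    simp only [zero_smul, add_zero] at this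
    exact this.mono_left nhdsWithin_le_nhds
  have hev : ∀ᶠ t in 𝓝[>] (0 : ℝ), w (z + t • e) = 0 := by
    filter_upwards [Ioc_mem_nhdsGT hr] with t ht
    exact hzero _ (Or.inr ⟨t, ht, rfl⟩)
  exact tendsto_nhds_unique (htend.congr' hev) tendsto_const_nhds

end H2R

end

/-! ### The Carleman estimate for a first order complex operator. -/

noncomputable section

namespace H2R

open Complex Metric MeasureTheory

theorem _root_.ContDiff.dx {f : ℂ → ℝ} {m n : WithTop ℕ∞} (hf : ContDiff ℝ n f)
    (hmn : m + 1 ≤ n) : ContDiff ℝ m (dx f) :=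
  (hf.fderiv_right hmn).clm_apply contDiff_const

theorem _root_.ContDiff.dy {f : ℂ → ℝ} {m n : WithTop ℕ∞} (hf : ContDiff ℝ n f)
    (hmn : m + 1 ≤ n) : ContDiff ℝ m (dy f) :=
  (hf.fderiv_right hmn).clm_apply contDiff_const

theorem _root_.HasCompactSupport.dx {f : ℂ → ℝ} (hf : HasCompactSupport f) :
    HasCompactSupport (dx f) := hf.fderiv_apply ℝ 1

theorem _root_.HasCompactSupport.dy {f : ℂ → ℝ} (hf : HasCompactSupport f) :
    HasCompactSupport (dy f) := hf.fderiv_apply ℝ I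

/-- Integration by parts against the constant `1`. It removes the divergence terms of the Carleman
identity. -/
theorem integral_fderiv_apply_eq_zero {g : ℂ → ℝ} (hg : ContDiff ℝ 1 g)
    (hc : HasCompactSupport g) (ξ : ℂ) : ∫ z, fderiv ℝ g z ξ = 0 := by
  have hd : Differentiable ℝ g := hg.differentiable (by norm_num)
  have h1 : Integrable (fun z => fderiv ℝ g z ξ) :=
    ((hg.continuous_fderiv (by norm_num)).clm_apply
      continuous_const).integrable_of_hasCompactSupport (hc.fderiv_apply ℝ ξ)
  have := integral_mul_fderiv_eq_neg_fderiv_mul_of_integrable (μ := volume) (f := fun _ => (1 : ℝ))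
    (g := g) (v := ξ) (by simp) (by simpa using h1)
    (by simpa using hg.continuous.integrable_of_hasCompactSupport hc)
    (fun x _ => differentiableAt_const _) (fun x _ => hd x)
  simpa using this

/-- The first order operator `∂/∂x - α ∂/∂y`. -/
def slant (α f : ℂ → ℝ) (z : ℂ) : ℝ := dx f z - α z * dy f z

/-- The function whose positivity on the support makes the weight admissible in the Carleman
estimate; `p` and `q` are the derivatives of the weight along `∂/∂x - α ∂/∂y` and `∂/∂y`. -/
def bracket (α β p q : ℂ → ℝ) (z : ℂ) : ℝ :=
  slant α p z - dy α z * p z + (β z ^ 2 * dy q z + 2 * β z * dy β z * q z)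
    - dx β z / β z * p z + dy β z * (-β z * q z + α z / β z * p z)

/-- The conjugated operator applied to `v + iw` is split as `(a1 + i a2) + (b1 + i b2)`. The first
summand comes from `∂x - α ∂y + iτβq`, which is skew-adjoint up to order zero, and the second from
`-τp - iβ ∂y`, which is self-adjoint up to order zero. The cross term of the square is a divergence
(the first two lines of the left side), plus `τ` times the commutator, which is `bracket`, times `v²
+ w²`, plus remainders linear in `a1, a2, b1, b2`. Completing squares absorbs the remainders at the
cost `C (v² + w²)`. -/
theorem carleman_pointwise (a b p q v w vx vy wx wy bx b_y ay px py qy vxy wxy τ C : ℝ)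
    (hb : b ≠ 0) (hC : ((-bx + a * b_y) / b) ^ 2 + b_y ^ 2 ≤ 4 * C) :
    (bx * (v * wy - w * vy) + b * (vx * wy + v * wxy - wx * vy - w * vxy)
        - τ * (px * (v ^ 2 + w ^ 2) + p * (2 * v * vx + 2 * w * wx)))
      + (-(b_y * (v * wx - w * vx) + b * (vy * wx + v * wxy - wy * vx - w * vxy))
        + τ * ((ay * p + a * py - (2 * b * b_y * q + b ^ 2 * qy)) * (v ^ 2 + w ^ 2)
          + (a * p - b ^ 2 * q) * (2 * v * vy + 2 * w * wy)))
      + (τ * (px - a * py - ay * p + (b ^ 2 * qy + 2 * b * b_y * q) - bx / b * p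
        + b_y * (-b * q + a / b * p)) - C) * (v ^ 2 + w ^ 2)
    ≤ ((vx - a * vy) - τ * p * v + b * (wy - τ * q * w)) ^ 2
      + ((wx - a * wy) - τ * p * w - b * (vy - τ * q * v)) ^ 2 := by
  set a1 := (vx - a * vy) - τ * b * q * w with ha1
  set a2 := (wx - a * wy) + τ * b * q * v with ha2
  set b1 := b * wy - τ * p * v with hb1
  set b2 := -b * vy - τ * p * w with hb2
  set m := (-bx + a * b_y) / b with hm
  have key : ((vx - a * vy) - τ * p * v + b * (wy - τ * q * w)) ^ 2
      + ((wx - a * wy) - τ * p * w - b * (vy - τ * q * v)) ^ 2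
      - ((bx * (v * wy - w * vy) + b * (vx * wy + v * wxy - wx * vy - w * vxy)
        - τ * (px * (v ^ 2 + w ^ 2) + p * (2 * v * vx + 2 * w * wx)))
      + (-(b_y * (v * wx - w * vx) + b * (vy * wx + v * wxy - wy * vx - w * vxy))
        + τ * ((ay * p + a * py - (2 * b * b_y * q + b ^ 2 * qy)) * (v ^ 2 + w ^ 2)
          + (a * p - b ^ 2 * q) * (2 * v * vy + 2 * w * wy)))
      + (τ * (px - a * py - ay * p + (b ^ 2 * qy + 2 * b * b_y * q) - bx / b * p
        + b_y * (-b * q + a / b * p))) * (v ^ 2 + w ^ 2))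
      = a1 ^ 2 + a2 ^ 2 + b1 ^ 2 + b2 ^ 2 + m * (v * b1 + w * b2) + b_y * (v * a2 - w * a1) := by
    rw [ha1, ha2, hb1, hb2, hm]
    field_simp
    ring
  have hC' : (m ^ 2 + b_y ^ 2) * (v ^ 2 + w ^ 2) ≤ 4 * C * (v ^ 2 + w ^ 2) := by gcongr
  nlinarith [sq_nonneg (b1 + m / 2 * v), sq_nonneg (b2 + m / 2 * w),
    sq_nonneg (a2 + b_y / 2 * v), sq_nonneg (a1 - b_y / 2 * w)]

/-- The Carleman estimate for the first order operator `∂/∂x - (α + iβ) ∂/∂y` applied to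
`v + iw`, with a weight whose derivatives are `p` and `q`. -/
theorem carleman_estimate {α β p q v w : ℂ → ℝ} {S : Set ℂ} {c₀ C τ : ℝ}
    (hα : ContDiff ℝ 1 α) (hβ : ContDiff ℝ 1 β) (hp : ContDiff ℝ 1 p) (hq : ContDiff ℝ 1 q)
    (hv : ContDiff ℝ 2 v) (hw : ContDiff ℝ 2 w)
    (hvc : HasCompactSupport v) (hwc : HasCompactSupport w)
    (hvS : tsupport v ⊆ S) (hwS : tsupport w ⊆ S)
    (hβS : ∀ z ∈ S, β z ≠ 0) (hc₀ : ∀ z ∈ S, c₀ ≤ bracket α β p q z)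
    (hC : ∀ z ∈ S, ((-dx β z + α z * dy β z) / β z) ^ 2 + dy β z ^ 2 ≤ 4 * C) (hτ : 0 ≤ τ) :
    (τ * c₀ - C) * ∫ z, (v z ^ 2 + w z ^ 2) ≤
      ∫ z, ((slant α v z - τ * p z * v z + β z * (dy w z - τ * q z * w z)) ^ 2
        + (slant α w z - τ * p z * w z - β z * (dy v z - τ * q z * v z)) ^ 2) := by
  set N : ℂ → ℝ := fun z => v z ^ 2 + w z ^ 2 with hN
  set F : ℂ → ℝ := fun z => (slant α v z - τ * p z * v z + β z * (dy w z - τ * q z * w z)) ^ 2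
        + (slant α w z - τ * p z * w z - β z * (dy v z - τ * q z * v z)) ^ 2 with hF
  -- `(g₁, g₂)` is the vector field whose divergence appears in `carleman_pointwise`. It has compact
  -- support, so it disappears after integration.
  set g₁ : ℂ → ℝ := fun z => β z * (v z * dy w z - w z * dy v z)
    - τ * (p z * (v z * v z + w z * w z)) with hg₁
  set g₂ : ℂ → ℝ := fun z => τ * ((α z * p z - β z * β z * q z) * (v z * v z + w z * w z))
    - β z * (v z * dx w z - w z * dx v z) with hg₂
  have cvx : ContDiff ℝ 1 (dx v) := hv.dx (by norm_num)
  have cvy : ContDiff ℝ 1 (dy v) := hv.dy (by norm_num)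
  have cwx : ContDiff ℝ 1 (dx w) := hw.dx (by norm_num)
  have cwy : ContDiff ℝ 1 (dy w) := hw.dy (by norm_num)
  have cv : ContDiff ℝ 1 v := hv.of_le (by norm_num)
  have cw : ContDiff ℝ 1 w := hw.of_le (by norm_num)
  have dα := hα.differentiable (by norm_num)
  have dβ := hβ.differentiable (by norm_num)
  have dp := hp.differentiable (by norm_num)
  have dq := hq.differentiable (by norm_num)
  have dv := cv.differentiable (by norm_num)
  have dw := cw.differentiable (by norm_num)
  have dvx := cvx.differentiable (by norm_num)
  have dvy := cvy.differentiable (by norm_num)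
  have dwx := cwx.differentiable (by norm_num)
  have dwy := cwy.differentiable (by norm_num)
  have zero_off : ∀ z, v z = 0 → w z = 0 → N z = 0 := fun z h1 h2 => by simp [hN, h1, h2]
  have hcomp : IsCompact (tsupport v ∪ tsupport w) := hvc.isCompact.union hwc.isCompact
  have off : ∀ z, z ∉ tsupport v ∪ tsupport w → v z = 0 ∧ w z = 0 ∧ dx v z = 0 ∧ dy v z = 0 ∧
      dx w z = 0 ∧ dy w z = 0 := fun z hz => by
    have h1 : z ∉ tsupport v := fun h => hz (Or.inl h)
    have h2 : z ∉ tsupport w := fun h => hz (Or.inr h)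
    have e1 : fderiv ℝ v z = 0 := by
      by_contra h; exact h1 (support_fderiv_subset ℝ h)
    have e2 : fderiv ℝ w z = 0 := by
      by_contra h; exact h2 (support_fderiv_subset ℝ h)
    exact ⟨image_eq_zero_of_notMem_tsupport h1, image_eq_zero_of_notMem_tsupport h2,
      by simp [dx, e1], by simp [dy, e1], by simp [dx, e2], by simp [dy, e2]⟩
  have hg₁C : ContDiff ℝ 1 g₁ := by fun_prop
  have hg₂C : ContDiff ℝ 1 g₂ := by fun_prop
  have hg₁c : HasCompactSupport g₁ := HasCompactSupport.intro hcomp fun z hz => by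
    obtain ⟨h1, h2, h3, h4, h5, h6⟩ := off z hz
    simp [hg₁, h1, h2]
  have hg₂c : HasCompactSupport g₂ := HasCompactSupport.intro hcomp fun z hz => by
    obtain ⟨h1, h2, h3, h4, h5, h6⟩ := off z hz
    simp [hg₂, h1, h2]
  have hNi : Integrable N := by
    refine Continuous.integrable_of_hasCompactSupport (by fun_prop)
      (HasCompactSupport.intro hcomp fun z hz => ?_)
    obtain ⟨h1, h2, -⟩ := off z hz
    exact zero_off z h1 h2
  have hFi : Integrable F := by
    refine Continuous.integrable_of_hasCompactSupport (by unfold F slant; fun_prop)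
      (HasCompactSupport.intro hcomp fun z hz => ?_)
    obtain ⟨h1, h2, h3, h4, h5, h6⟩ := off z hz
    simp [hF, slant, h1, h2, h3, h4, h5, h6]
  have hg₁i : Integrable (dx g₁) :=
    (hg₁C.dx (m := 0) (by norm_num)).continuous.integrable_of_hasCompactSupport hg₁c.dx
  have hg₂i : Integrable (dy g₂) :=
    (hg₂C.dy (m := 0) (by norm_num)).continuous.integrable_of_hasCompactSupport hg₂c.dy
  have hpt : ∀ z, dx g₁ z + dy g₂ z + (τ * c₀ - C) * N z ≤ F z := by
    intro z
    by_cases hz : z ∈ tsupport v ∪ tsupport w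
    · have hzS : z ∈ S := hz.elim (fun h => hvS h) (fun h => hwS h)
      have e1 : dx g₁ z = dx β z * (v z * dy w z - w z * dy v z)
          + β z * (dx v z * dy w z + v z * dx (dy w) z - dx w z * dy v z - w z * dx (dy v) z)
          - τ * (dx p z * (v z ^ 2 + w z ^ 2) + p z * (2 * v z * dx v z + 2 * w z * dx w z)) := by
        rw [hg₁, dx_sub (by fun_prop) (by fun_prop), dx_mul (by fun_prop) (by fun_prop),
          dx_sub (by fun_prop) (by fun_prop), dx_mul (by fun_prop) (by fun_prop),
          dx_mul (by fun_prop) (by fun_prop), dx_const_mul _ (by fun_prop),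
          dx_mul (by fun_prop) (by fun_prop), dx_add (by fun_prop) (by fun_prop),
          dx_mul (by fun_prop) (by fun_prop), dx_mul (by fun_prop) (by fun_prop)]
        ring
      have e2 : dy g₂ z = -(dy β z * (v z * dx w z - w z * dx v z)
          + β z * (dy v z * dx w z + v z * dx (dy w) z - dy w z * dx v z - w z * dx (dy v) z))
          + τ * ((dy α z * p z + α z * dy p z - (2 * β z * dy β z * q z + β z ^ 2 * dy q z))
            * (v z ^ 2 + w z ^ 2)
            + (α z * p z - β z ^ 2 * q z) * (2 * v z * dy v z + 2 * w z * dy w z)) := by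
        rw [hg₂, dy_sub (by fun_prop) (by fun_prop), dy_const_mul _ (by fun_prop),
          dy_mul (f := fun z => α z * p z - β z * β z * q z) (by fun_prop) (by fun_prop),
          dy_sub (by fun_prop) (by fun_prop), dy_mul (by fun_prop) (by fun_prop),
          dy_mul (f := fun z => β z * β z) (by fun_prop) (by fun_prop),
          dy_mul (by fun_prop) (by fun_prop), dy_add (by fun_prop) (by fun_prop),
          dy_mul (by fun_prop) (by fun_prop), dy_mul (by fun_prop) (by fun_prop),
          dy_mul (by fun_prop) (by fun_prop), dy_sub (by fun_prop) (by fun_prop),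
          dy_mul (by fun_prop) (by fun_prop), dy_mul (by fun_prop) (by fun_prop),
          dx_dy_comm hv.contDiffAt, dx_dy_comm hw.contDiffAt]
        ring
      have key := carleman_pointwise (α z) (β z) (p z) (q z) (v z) (w z) (dx v z) (dy v z) (dx w z)
        (dy w z) (dx β z) (dy β z) (dy α z) (dx p z) (dy p z) (dy q z) (dx (dy v) z) (dx (dy w) z)
        τ C (hβS z hzS) (hC z hzS)
      rw [← e1, ← e2] at key
      have hb := hc₀ z hzS
      have hNz : 0 ≤ N z := by simp only [hN]; positivity
      have h3 : (τ * c₀ - C) * N z ≤ (τ * bracket α β p q z - C) * N z := by gcongr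
      have h4 : (τ * bracket α β p q z - C) * N z = (τ * (dx p z - α z * dy p z - dy α z * p z
        + (β z ^ 2 * dy q z + 2 * β z * dy β z * q z) - dx β z / β z * p z
        + dy β z * (-β z * q z + α z / β z * p z)) - C) * (v z ^ 2 + w z ^ 2) := rfl
      change _ ≤ ((dx v z - α z * dy v z) - τ * p z * v z + β z * (dy w z - τ * q z * w z)) ^ 2
        + ((dx w z - α z * dy w z) - τ * p z * w z - β z * (dy v z - τ * q z * v z)) ^ 2
      linarith
    · obtain ⟨h1, h2, h3, h4, h5, h6⟩ := off z hz
      have e1 : dx g₁ z = 0 := by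
        have : z ∉ tsupport g₁ := fun h => hz (by
          refine closure_minimal (fun y hy => ?_) hcomp.isClosed h
          by_contra hy'
          obtain ⟨h1, h2, -⟩ := off y hy'
          exact hy (by simp [hg₁, h1, h2]))
        have e : fderiv ℝ g₁ z = 0 := by
          by_contra h; exact this (support_fderiv_subset ℝ h)
        simp [dx, e]
      have e2 : dy g₂ z = 0 := by
        have : z ∉ tsupport g₂ := fun h => hz (by
          refine closure_minimal (fun y hy => ?_) hcomp.isClosed h
          by_contra hy'
          obtain ⟨h1, h2, -⟩ := off y hy'
          exact hy (by simp [hg₂, h1, h2]))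
        have e : fderiv ℝ g₂ z = 0 := by
          by_contra h; exact this (support_fderiv_subset ℝ h)
        simp [dy, e]
      rw [e1, e2, zero_off z h1 h2]
      simp only [hF]
      have : 0 ≤ F z := by simp only [hF]; positivity
      simpa using this
  have hint := integral_mono ((hg₁i.add hg₂i).add (hNi.const_mul (τ * c₀ - C))) hFi hpt
  have h1 : ∫ z, (dx g₁ z + dy g₂ z + (τ * c₀ - C) * N z) = (τ * c₀ - C) * ∫ z, N z := by
    rw [integral_add (f := fun z => dx g₁ z + dy g₂ z) (hg₁i.add hg₂i) (hNi.const_mul _),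
      integral_add hg₁i hg₂i, integral_const_mul]
    have z1 : ∫ z, dx g₁ z = 0 := integral_fderiv_apply_eq_zero hg₁C hg₁c 1
    have z2 : ∫ z, dy g₂ z = 0 := integral_fderiv_apply_eq_zero hg₂C hg₂c I
    rw [z1, z2]; ring
  rw [← h1]
  exact hint

end H2R

end

/-! ### Admissible weights. -/

noncomputable section

namespace H2R

open Complex Metric MeasureTheory

theorem _root_.ContDiff.slant {α f : ℂ → ℝ} {m n : WithTop ℕ∞} (hα : ContDiff ℝ m α)
    (hf : ContDiff ℝ n f) (hmn : m + 1 ≤ n) : ContDiff ℝ m (slant α f) :=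
  (hf.dx hmn).sub (hα.mul (hf.dy hmn))

theorem slant_mul {α f g : ℂ → ℝ} {z : ℂ} (hf : DifferentiableAt ℝ f z)
    (hg : DifferentiableAt ℝ g z) :
    slant α (fun z => f z * g z) z = f z * slant α g z + g z * slant α f z := by
  unfold slant
  rw [dx_mul hf hg, dy_mul hf hg]
  ring

theorem dx_exp_const_mul {s : ℂ → ℝ} {z : ℂ} (k : ℝ) (hs : DifferentiableAt ℝ s z) :
    dx (fun z => Real.exp (k * s z)) z = k * (Real.exp (k * s z) * dx s z) := by
  refine (HasFDerivAt.dx_eq (hs.hasFDerivAt.const_mul k).exp).trans ?_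
  simp [dx]; ring

theorem dy_exp_const_mul {s : ℂ → ℝ} {z : ℂ} (k : ℝ) (hs : DifferentiableAt ℝ s z) :
    dy (fun z => Real.exp (k * s z)) z = k * (Real.exp (k * s z) * dy s z) := by
  refine (HasFDerivAt.dy_eq (hs.hasFDerivAt.const_mul k).exp).trans ?_
  simp [dy]; ring

theorem slant_exp_const_mul {α s : ℂ → ℝ} {z : ℂ} (k : ℝ) (hs : DifferentiableAt ℝ s z) :
    slant α (fun z => Real.exp (k * s z)) z = k * (Real.exp (k * s z) * slant α s z) := by
  unfold slant
  rw [dx_exp_const_mul k hs, dy_exp_const_mul k hs]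
  ring

/-- Convexification. The exponential adds `k |∇s|²`, in the norm adapted to the operator, to the
bracket of `s`. With `-k` in place of `k` the prefactor is negative as well, so a large `k` makes
the bracket positive whatever the bracket of `s` is. -/
theorem bracket_exp_const_mul {α β s : ℂ → ℝ} (k : ℝ) (hα : ContDiff ℝ ∞ α)
    (hs : ContDiff ℝ ∞ s) (z : ℂ) :
    bracket α β (slant α fun z => Real.exp (k * s z)) (dy fun z => Real.exp (k * s z)) z =
      k * Real.exp (k * s z) * (bracket α β (slant α s) (dy s) z
        + k * (slant α s z ^ 2 + β z ^ 2 * dy s z ^ 2)) := by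
  have ds : Differentiable ℝ s := hs.differentiable (by simp)
  have dσ : Differentiable ℝ (slant α s) :=
    (hα.slant (m := ∞) hs le_rfl).differentiable (by simp)
  have dsy : Differentiable ℝ (dy s) := (hs.dy (m := ∞) le_rfl).differentiable (by simp)
  have e1 : slant α (fun z => Real.exp (k * s z)) = fun z => k * (Real.exp (k * s z) * slant α s z) :=
    funext fun z => slant_exp_const_mul k (ds z)
  have e2 : dy (fun z => Real.exp (k * s z)) = fun z => k * (Real.exp (k * s z) * dy s z) :=
    funext fun z => dy_exp_const_mul k (ds z)
  have e3 : slant α (fun z => k * (Real.exp (k * s z) * slant α s z)) z =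
      k * (Real.exp (k * s z) * slant α (slant α s) z
        + slant α s z * (k * (Real.exp (k * s z) * slant α s z))) := by
    rw [slant_mul (f := fun _ => k) (by fun_prop) (by fun_prop),
      slant_mul (by fun_prop) (by fun_prop), slant_exp_const_mul k (ds z)]
    simp [slant, dx, dy]
  have e4 : dy (fun z => k * (Real.exp (k * s z) * dy s z)) z =
      k * (Real.exp (k * s z) * dy (dy s) z + dy s z * (k * (Real.exp (k * s z) * dy s z))) := by
    rw [dy_const_mul _ (by fun_prop), dy_mul (by fun_prop) (by fun_prop),
      dy_exp_const_mul k (ds z)]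
  unfold bracket
  rw [e1, e2, e3, e4]
  ring

/-- The same weight serves the operator and its conjugate, obtained by changing `β` into `-β`. -/
theorem bracket_neg (α β p q : ℂ → ℝ) (z : ℂ) :
    bracket α (fun z => -β z) p q z = bracket α β p q z := by
  have h1 : dx (fun z => -β z) z = -dx β z := by simp [dx, fderiv_fun_neg]
  have h2 : dy (fun z => -β z) z = -dy β z := by simp [dy, fderiv_fun_neg]
  simp only [bracket, h1, h2, div_neg]
  ring

theorem continuousOn_bracket {α β s : ℂ → ℝ} {S : Set ℂ} (hα : ContDiff ℝ ∞ α)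
    (hβ : ContDiff ℝ ∞ β) (hs : ContDiff ℝ ∞ s) (hβS : ∀ z ∈ S, β z ≠ 0) :
    ContinuousOn (bracket α β (slant α s) (dy s)) S := by
  have cσ : ContDiff ℝ ∞ (slant α s) := hα.slant hs le_rfl
  have cσσ : ContDiff ℝ ∞ (slant α (slant α s)) := hα.slant cσ le_rfl
  have csy : ContDiff ℝ ∞ (dy s) := hs.dy le_rfl
  have c1 := (csy.dy (m := ∞) le_rfl).continuous
  have c2 := (hα.dy (m := ∞) le_rfl).continuous
  have c3 := (hβ.dy (m := ∞) le_rfl).continuous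
  have c4 := (hβ.dx (m := ∞) le_rfl).continuous
  have c5 := hα.continuous
  have c6 := hβ.continuous
  have c7 := cσ.continuous
  have c8 := cσσ.continuous
  have c9 := csy.continuous
  unfold bracket
  have d1 : ContinuousOn (fun z => dx β z / β z) S := c4.continuousOn.div c6.continuousOn hβS
  have d2 : ContinuousOn (fun z => α z / β z) S := c5.continuousOn.div c6.continuousOn hβS
  fun_prop

/-- On a compact set where `s` has no critical point, `exp (-k s)` is an admissible weight for `k`
large. -/
theorem exists_weight {α β s : ℂ → ℝ} {S : Set ℂ} (hS : IsCompact S) (hα : ContDiff ℝ ∞ α)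
    (hβ : ContDiff ℝ ∞ β) (hs : ContDiff ℝ ∞ s) (hβS : ∀ z ∈ S, β z ≠ 0)
    (hcrit : ∀ z ∈ S, 0 < slant α s z ^ 2 + β z ^ 2 * dy s z ^ 2) :
    ∃ k c₀ : ℝ, 0 < k ∧ 0 < c₀ ∧ ∀ z ∈ S,
      c₀ ≤ bracket α β (slant α fun z => Real.exp (-k * s z)) (dy fun z => Real.exp (-k * s z)) z := by
  rcases S.eq_empty_or_nonempty with rfl | hne
  · exact ⟨1, 1, one_pos, one_pos, by simp⟩
  obtain ⟨G, hG⟩ := hS.exists_bound_of_continuousOn (continuousOn_bracket hα hβ hs hβS)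
  have hG0 : 0 ≤ G := by obtain ⟨z, hz⟩ := hne; exact (norm_nonneg _).trans (hG z hz)
  have csy := (hs.dy (m := ∞) le_rfl).continuous
  have cσ := (hα.slant (m := ∞) hs le_rfl).continuous
  have cβ := hβ.continuous
  have cs := hs.continuous
  have hQ : Continuous fun z => slant α s z ^ 2 + β z ^ 2 * dy s z ^ 2 := by fun_prop
  obtain ⟨z₁, hz₁, hmin₁⟩ := hS.exists_isMinOn hne hQ.continuousOn
  set g := slant α s z₁ ^ 2 + β z₁ ^ 2 * dy s z₁ ^ 2 with hg
  have hg0 : 0 < g := hcrit z₁ hz₁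
  -- `G` bounds the bracket of `s` and `g` is the minimum of the squared gradient on `S`. So `k g -
  -- G = 1`, and the bracket of the weight is at least its prefactor.
  set k := (G + 1) / g with hk
  have hk0 : 0 < k := by positivity
  have hkg : k * g = G + 1 := by rw [hk]; field_simp
  have hE : Continuous fun z => k * Real.exp (-k * s z) := by fun_prop
  obtain ⟨z₂, hz₂, hmin₂⟩ := hS.exists_isMinOn hne hE.continuousOn
  refine ⟨k, k * Real.exp (-k * s z₂), hk0, by positivity, fun z hz => ?_⟩
  rw [bracket_exp_const_mul (-k) hα hs]
  have h1 : k * Real.exp (-k * s z₂) ≤ k * Real.exp (-k * s z) := hmin₂ hz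
  have h2 : g ≤ slant α s z ^ 2 + β z ^ 2 * dy s z ^ 2 := hmin₁ hz
  have h3 := (abs_le.1 (hG z hz)).2
  have h4 : k * g ≤ k * (slant α s z ^ 2 + β z ^ 2 * dy s z ^ 2) := by gcongr
  have h5 : 0 < k * Real.exp (-k * s z) := by positivity
  have h6 : 1 ≤ k * (slant α s z ^ 2 + β z ^ 2 * dy s z ^ 2)
    - bracket α β (slant α s) (dy s) z := by linarith
  nlinarith

/-- The square of the distance to `c`. -/
def sqDist (c z : ℂ) : ℝ := (z.re - c.re) ^ 2 + (z.im - c.im) ^ 2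

theorem sqDist_eq (c z : ℂ) : sqDist c z = dist z c ^ 2 := by
  rw [sqDist, Complex.dist_eq, Complex.sq_norm, Complex.normSq_apply]; simp; ring

theorem contDiff_sqDist (c : ℂ) {n : WithTop ℕ∞} : ContDiff ℝ n (sqDist c) := by
  have h1 : ContDiff ℝ n (fun z : ℂ => z.re) := reCLM.contDiff
  have h2 : ContDiff ℝ n (fun z : ℂ => z.im) := imCLM.contDiff
  unfold sqDist
  fun_prop

/-- The distance to `c` is critical only at `c`, a point that the support of the function to be
estimated avoids. -/
theorem sqDist_noncritical {α β : ℂ → ℝ} {c z : ℂ} (hβ : β z ≠ 0) (hz : z ≠ c) :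
    0 < slant α (sqDist c) z ^ 2 + β z ^ 2 * dy (sqDist c) z ^ 2 := by
  have hF : HasFDerivAt (sqDist c) _ z :=
    ((hasFDerivAt_re_sub c z).pow 2).add ((hasFDerivAt_im_sub c z).pow 2)
  have e1 : dx (sqDist c) z = 2 * (z.re - c.re) := by rw [hF.dx_eq]; simp
  have e2 : dy (sqDist c) z = 2 * (z.im - c.im) := by rw [hF.dy_eq]; simp
  by_cases h : z.im - c.im = 0
  · have h' : z.re - c.re ≠ 0 := fun h' => hz (Complex.ext (sub_eq_zero.1 h') (sub_eq_zero.1 h))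
    have : slant α (sqDist c) z ≠ 0 := by simp [slant, e1, e2, h, h']
    positivity
  · have : dy (sqDist c) z ≠ 0 := by simp [e2, h]
    positivity

/-- The real part of `(∂/∂x - (α + iβ) ∂/∂y) (f + i g)`. -/
def dbarRe (α β f g : ℂ → ℝ) (z : ℂ) : ℝ := slant α f z + β z * dy g z

/-- The imaginary part of `(∂/∂x - (α + iβ) ∂/∂y) (f + i g)`. -/
def dbarIm (α β f g : ℂ → ℝ) (z : ℂ) : ℝ := slant α g z - β z * dy f z

/-- The Carleman estimate with the weight `exp (τ φ)`. -/
theorem carleman_weighted {α β φ f g : ℂ → ℝ} {S : Set ℂ} {c₀ C τ : ℝ}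
    (hα : ContDiff ℝ ∞ α) (hβ : ContDiff ℝ ∞ β) (hφ : ContDiff ℝ ∞ φ)
    (hf : ContDiff ℝ ∞ f) (hg : ContDiff ℝ ∞ g)
    (hfc : HasCompactSupport f) (hgc : HasCompactSupport g)
    (hfS : tsupport f ⊆ S) (hgS : tsupport g ⊆ S)
    (hβS : ∀ z ∈ S, β z ≠ 0) (hc₀ : ∀ z ∈ S, c₀ ≤ bracket α β (slant α φ) (dy φ) z)
    (hC : ∀ z ∈ S, ((-dx β z + α z * dy β z) / β z) ^ 2 + dy β z ^ 2 ≤ 4 * C) (hτ : 0 ≤ τ) :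
    (τ * c₀ - C) * ∫ z, Real.exp (τ * φ z) ^ 2 * (f z ^ 2 + g z ^ 2) ≤
      ∫ z, Real.exp (τ * φ z) ^ 2 * (dbarRe α β f g z ^ 2 + dbarIm α β f g z ^ 2) := by
  have cE : ContDiff ℝ ∞ fun z => Real.exp (τ * φ z) := by fun_prop
  have dE := cE.differentiable (by simp)
  have df := hf.differentiable (by simp)
  have dg := hg.differentiable (by simp)
  have dφ := hφ.differentiable (by simp)
  have h2 : (2 : WithTop ℕ∞) ≤ ∞ := WithTop.coe_le_coe.2 (le_top : (2 : ℕ∞) ≤ ⊤)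
  have h1 : (1 : WithTop ℕ∞) ≤ ∞ := WithTop.coe_le_coe.2 (le_top : (1 : ℕ∞) ≤ ⊤)
  -- Conjugation by the weight: the unweighted estimate is applied to `exp (τ φ) f` and `exp (τ φ)
  -- g`.
  have := carleman_estimate (v := fun z => Real.exp (τ * φ z) * f z)
    (w := fun z => Real.exp (τ * φ z) * g z) (hα.of_le h1) (hβ.of_le h1)
    ((hα.slant hφ le_rfl).of_le h1) ((hφ.dy (m := ∞) le_rfl).of_le h1)
    ((cE.mul hf).of_le h2) ((cE.mul hg).of_le h2) hfc.mul_left hgc.mul_left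
    ((closure_mono (Function.support_mul_subset_right _ _)).trans hfS)
    ((closure_mono (Function.support_mul_subset_right _ _)).trans hgS) hβS hc₀ hC hτ
  convert this using 3
  · ext z; ring
  · rename_i z
    rw [slant_mul (dE z) (df z), slant_mul (dE z) (dg z), dy_mul (dE z) (df z),
      dy_mul (dE z) (dg z), slant_exp_const_mul τ (dφ z), dy_exp_const_mul τ (dφ z)]
    unfold dbarRe dbarIm
    ring

end H2R

end

/-! ### Unique continuation for globally defined coefficients. -/

noncomputable section

namespace H2R

open Complex Metric MeasureTheory

theorem slant_congr {α f g : ℂ → ℝ} {z : ℂ} (h : f =ᶠ[𝓝 z] g) : slant α f z = slant α g z := by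
  rw [slant, slant, dx_congr h, dy_congr h]

theorem support_slant_subset (α f : ℂ → ℝ) : Function.support (slant α f) ⊆ tsupport f := by
  intro z hz
  by_contra h
  have e : fderiv ℝ f z = 0 := by
    by_contra h'; exact h (support_fderiv_subset ℝ h')
  exact hz (by simp [slant, dx, dy, e])

theorem support_dy_subset (f : ℂ → ℝ) : Function.support (dy f) ⊆ tsupport f := by
  intro z hz
  by_contra h
  have e : fderiv ℝ f z = 0 := by
    by_contra h'; exact h (support_fderiv_subset ℝ h')
  exact hz (by simp [dy, e])

/-- A function with compact support for which the Carleman estimates hold vanishes where the weight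
is larger than outside of the domain of the differential inequality. -/
theorem eq_zero_of_weighted_bounds {φ W U H : ℂ → ℝ} {c : ℂ} {r C₁ c₀ C φ₁ : ℝ} (hc₀ : 0 < c₀)
    (hφ : Continuous φ) (hW : Continuous W) (hU : Continuous U) (hH : Continuous H)
    (hWc : HasCompactSupport W) (hUc : HasCompactSupport U) (hHc : HasCompactSupport H)
    (hU0 : ∀ z, 0 ≤ U z) (hH0 : ∀ z, 0 ≤ H z) (hC₁ : 0 ≤ C₁)
    (h1 : ∀ τ, 0 ≤ τ → (τ * c₀ - C) * ∫ z, Real.exp (τ * φ z) ^ 2 * U z ≤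
      ∫ z, Real.exp (τ * φ z) ^ 2 * H z)
    (h2 : ∀ τ, 0 ≤ τ → (τ * c₀ - C) * ∫ z, Real.exp (τ * φ z) ^ 2 * W z ^ 2 ≤
      ∫ z, Real.exp (τ * φ z) ^ 2 * U z)
    (hin : ∀ z ∈ ball c r, H z ≤ C₁ * (W z ^ 2 + U z)) (hout : ∀ z ∉ ball c r, φ z ≤ φ₁)
    {z₀ : ℂ} (hz₀ : φ₁ < φ z₀) : W z₀ = 0 := by
  by_contra hne
  have cI : ∀ τ : ℝ, ∀ f : ℂ → ℝ, Continuous f → HasCompactSupport f →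
      Integrable fun z => Real.exp (τ * φ z) ^ 2 * f z := fun τ f hf hfc =>
    Continuous.integrable_of_hasCompactSupport (by fun_prop) hfc.mul_left
  have hW2c : HasCompactSupport fun z => W z ^ 2 :=
    hWc.comp_left (g := fun x : ℝ => x ^ 2) (by norm_num)
  have hW2 : Continuous fun z => W z ^ 2 := by fun_prop
  obtain ⟨δ, φ', hδ, hφ', hev⟩ : ∃ δ φ' : ℝ, 0 < δ ∧ φ₁ < φ' ∧
      ∀ᶠ z in 𝓝 z₀, δ ≤ W z ^ 2 ∧ φ' ≤ φ z := by
    have hpos : 0 < W z₀ ^ 2 := by positivity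
    refine ⟨W z₀ ^ 2 / 2, (φ₁ + φ z₀) / 2, by positivity, by linarith, ?_⟩
    have e1 := (hW2.tendsto z₀).eventually (lt_mem_nhds (show W z₀ ^ 2 / 2 < W z₀ ^ 2 by linarith))
    have e2 := (hφ.tendsto z₀).eventually
      (lt_mem_nhds (show (φ₁ + φ z₀) / 2 < φ z₀ by linarith))
    filter_upwards [e1, e2] with z a b using ⟨a.le, b.le⟩
  obtain ⟨ε, hε, hball⟩ := Metric.eventually_nhds_iff_ball.1 hev
  set V : ℝ := volume.real (ball z₀ ε) with hV
  have hV0 : 0 < V := by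
    rw [hV, Measure.real, ENNReal.toReal_pos_iff]
    exact ⟨measure_ball_pos _ _ hε, measure_ball_lt_top⟩
  set C₃ := ∫ z, H z with hC₃
  have hC₃0 : 0 ≤ C₃ := integral_nonneg hH0
  have key : ∀ τ : ℝ, 0 ≤ τ → C₁ + 1 ≤ τ * c₀ - C →
      -- Near `z₀` the weight is at least `φ' > φ₁` and `W² ≥ δ`, while the errors outside the disc
      -- carry at most the weight `φ₁`. The resulting bound fails as `τ` tends to infinity.
      δ * V * Real.exp (2 * τ * (φ' - φ₁)) ≤ C₃ := by
    intro τ hτ hT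
    set T := τ * c₀ - C with hTd
    set IU := ∫ z, Real.exp (τ * φ z) ^ 2 * U z with hIU
    set IW := ∫ z, Real.exp (τ * φ z) ^ 2 * W z ^ 2 with hIW
    have hIU0 : 0 ≤ IU := integral_nonneg fun z => mul_nonneg (sq_nonneg _) (hU0 z)
    have hIW0 : 0 ≤ IW := integral_nonneg fun z => mul_nonneg (sq_nonneg _) (sq_nonneg _)
    have hEH : ∫ z, Real.exp (τ * φ z) ^ 2 * H z ≤
        C₁ * (IW + IU) + Real.exp (τ * φ₁) ^ 2 * C₃ := by
      have hi1 := ((cI τ _ hW2 hW2c).add (cI τ _ hU hUc)).const_mul C₁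
      have hi2 := (hH.integrable_of_hasCompactSupport (μ := volume) hHc).const_mul (Real.exp (τ * φ₁) ^ 2)
      have := integral_mono (cI τ _ hH hHc) (hi1.add hi2) (fun z => by
        change Real.exp (τ * φ z) ^ 2 * H z ≤ C₁ * (Real.exp (τ * φ z) ^ 2 * W z ^ 2 +
          Real.exp (τ * φ z) ^ 2 * U z) + Real.exp (τ * φ₁) ^ 2 * H z
        by_cases hz : z ∈ ball c r
        · have h3 := mul_le_mul_of_nonneg_left (hin z hz) (sq_nonneg (Real.exp (τ * φ z)))
          have h4 := mul_nonneg (sq_nonneg (Real.exp (τ * φ₁))) (hH0 z)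
          linarith
        · have h3 : Real.exp (τ * φ z) ≤ Real.exp (τ * φ₁) :=
            Real.exp_le_exp.2 (mul_le_mul_of_nonneg_left (hout z hz) hτ)
          have h4 : Real.exp (τ * φ z) ^ 2 * H z ≤ Real.exp (τ * φ₁) ^ 2 * H z :=
            mul_le_mul_of_nonneg_right (pow_le_pow_left₀ (Real.exp_pos _).le h3 2) (hH0 z)
          have h5 : 0 ≤ C₁ * (Real.exp (τ * φ z) ^ 2 * W z ^ 2 + Real.exp (τ * φ z) ^ 2 * U z) :=
            mul_nonneg hC₁ (add_nonneg (by positivity) (mul_nonneg (by positivity) (hU0 z)))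
          linarith)
      refine this.trans (le_of_eq ?_)
      have e : ∫ z, (C₁ * (Real.exp (τ * φ z) ^ 2 * W z ^ 2 + Real.exp (τ * φ z) ^ 2 * U z)
          + Real.exp (τ * φ₁) ^ 2 * H z) = C₁ * (IW + IU) + Real.exp (τ * φ₁) ^ 2 * C₃ := by
        rw [integral_add (f := fun z => C₁ * (Real.exp (τ * φ z) ^ 2 * W z ^ 2
            + Real.exp (τ * φ z) ^ 2 * U z)) hi1 hi2, integral_const_mul, integral_const_mul,
          integral_add (cI τ _ hW2 hW2c) (cI τ _ hU hUc)]
      exact e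
    have hU' := (h1 τ hτ).trans hEH
    have hW' := h2 τ hτ
    -- With `T = τ c₀ - C ≥ C₁ + 1`, the two estimates chain to `(T - C₁) T IW ≤ C₁ IW + exp (2 τ
    -- φ₁) C₃`. The left side is at least `(C₁ + 1) IW`, which absorbs `C₁ IW`.
    have hIWb : IW ≤ Real.exp (τ * φ₁) ^ 2 * C₃ := by
      have a1 : (T - C₁) * IU ≤ C₁ * IW + Real.exp (τ * φ₁) ^ 2 * C₃ := by linarith
      have a2 : (T - C₁) * (T * IW) ≤ (T - C₁) * IU :=
        mul_le_mul_of_nonneg_left hW' (by linarith)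
      have a3 : 1 * ((C₁ + 1) * IW) ≤ (T - C₁) * (T * IW) :=
        mul_le_mul (by linarith) (mul_le_mul_of_nonneg_right hT hIW0)
          (mul_nonneg (by linarith) hIW0) (by linarith)
      linarith
    have hlow : δ * V * Real.exp (τ * φ') ^ 2 ≤ IW := by
      have hi := cI τ _ hW2 hW2c
      have b1 : ∫ z in ball z₀ ε, Real.exp (τ * φ z) ^ 2 * W z ^ 2 ≤ IW :=
        setIntegral_le_integral hi (Filter.Eventually.of_forall fun z => by positivity)
      have b2 : ∫ z in ball z₀ ε, Real.exp (τ * φ') ^ 2 * δ ≤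
          ∫ z in ball z₀ ε, Real.exp (τ * φ z) ^ 2 * W z ^ 2 := by
        refine setIntegral_mono_on (integrableOn_const measure_ball_lt_top.ne) hi.integrableOn
          measurableSet_ball fun z hz => ?_
        have h3 : Real.exp (τ * φ') ≤ Real.exp (τ * φ z) :=
            Real.exp_le_exp.2 (mul_le_mul_of_nonneg_left (hball z hz).2 hτ)
        exact mul_le_mul (pow_le_pow_left₀ (Real.exp_pos _).le h3 2) (hball z hz).1 hδ.le
          (by positivity)
      rw [setIntegral_const, smul_eq_mul] at b2
      calc δ * V * Real.exp (τ * φ') ^ 2 = volume.real (ball z₀ ε) * (Real.exp (τ * φ') ^ 2 * δ) := by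
            rw [hV]; ring
        _ ≤ _ := b2.trans b1
    have hfin := hlow.trans hIWb
    have e : Real.exp (τ * φ') ^ 2 = Real.exp (2 * τ * (φ' - φ₁)) * Real.exp (τ * φ₁) ^ 2 := by
      rw [← Real.exp_nat_mul, ← Real.exp_nat_mul, ← Real.exp_add]; congr 1; push_cast; ring
    rw [e] at hfin
    have hp : 0 < Real.exp (τ * φ₁) ^ 2 := by positivity
    refine le_of_mul_le_mul_right ?_ hp
    linarith
  have htend : Filter.Tendsto (fun τ : ℝ => δ * V * Real.exp (2 * τ * (φ' - φ₁)))
      Filter.atTop Filter.atTop := by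
    refine Filter.Tendsto.const_mul_atTop (by positivity) (Real.tendsto_exp_atTop.comp ?_)
    exact (Filter.tendsto_id.const_mul_atTop two_pos).atTop_mul_const (by linarith)
  have hT : ∀ᶠ τ : ℝ in Filter.atTop, C₁ + 1 ≤ τ * c₀ - C := by
    filter_upwards [Filter.eventually_ge_atTop ((C₁ + 1 + C) / c₀)] with τ hτ
    rw [div_le_iff₀ hc₀] at hτ; linarith
  obtain ⟨τ, t1, t2, t3⟩ := ((htend.eventually_gt_atTop C₃).and
    (hT.and (Filter.eventually_ge_atTop 0))).exists
  exact absurd (key τ t3 t2) (not_le.2 t1)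

/-- Unique continuation from the centre of a disk, for global coefficients. -/
theorem unique_continuation_aux {α β w : ℂ → ℝ} {c : ℂ} {r₁ r₂ C₁ : ℝ} (hr₁ : 0 < r₁) (hr₂ : r₁ < r₂)
    (hα : ContDiff ℝ ∞ α) (hβ : ContDiff ℝ ∞ β) (hw : ContDiff ℝ ∞ w)
    (hβ0 : ∀ z ∈ closedBall c r₂, β z ≠ 0) (h0 : ∀ᶠ z in 𝓝 c, w z = 0) (hC₁ : 0 ≤ C₁)
    (hin : ∀ z ∈ ball c r₁,
      dbarRe α β (slant α w) (fun z => β z * dy w z) z ^ 2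
        + dbarIm α β (slant α w) (fun z => β z * dy w z) z ^ 2
      ≤ C₁ * (w z ^ 2 + (slant α w z ^ 2 + (β z * dy w z) ^ 2))) :
    ∀ z ∈ ball c r₁, w z = 0 := by
  intro z₀ hz₀
  obtain ⟨r₀, hr₀, hball₀⟩ := Metric.eventually_nhds_iff_ball.1 h0
  let χ : ContDiffBump c := ⟨r₁, r₂, hr₁, hr₂⟩
  set W : ℂ → ℝ := fun z => χ z * w z with hW
  have cW : ContDiff ℝ ∞ W := χ.contDiff.mul hw
  have hWc : HasCompactSupport W := χ.hasCompactSupport.mul_right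
  have hWin : ∀ z ∈ ball c r₁, W =ᶠ[𝓝 z] w := fun z hz => by
    filter_upwards [isOpen_ball.mem_nhds hz] with y hy
    simp [hW, χ.one_of_mem_closedBall (ball_subset_closedBall hy)]
  -- The cut-off function `W` vanishes near `c`, so its support avoids the only critical point of
  -- the weight.
  set S : Set ℂ := closedBall c r₂ \ ball c r₀ with hS
  have hSc : IsCompact S := (isCompact_closedBall c r₂).diff isOpen_ball
  have hSβ : ∀ z ∈ S, β z ≠ 0 := fun z hz => hβ0 z hz.1
  have hWS : tsupport W ⊆ S := by
    refine closure_minimal (fun z hz => ⟨?_, fun hz' => hz ?_⟩) hSc.isClosed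
    · have hz' : χ z ≠ 0 := fun h => hz (by simp [hW, h])
      have : z ∈ Function.support χ := hz'
      rw [χ.support_eq] at this
      exact ball_subset_closedBall this
    · simp [hW, hball₀ z hz']
  set f : ℂ → ℝ := slant α W with hf
  set g : ℂ → ℝ := fun z => β z * dy W z with hg
  have cf : ContDiff ℝ ∞ f := hα.slant cW le_rfl
  have cg : ContDiff ℝ ∞ g := hβ.mul (cW.dy le_rfl)
  have hft : tsupport f ⊆ tsupport W :=
    closure_minimal (support_slant_subset α W) (isClosed_tsupport W)
  have hgt : tsupport g ⊆ tsupport W :=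
    closure_minimal ((Function.support_mul_subset_right _ _).trans (support_dy_subset W))
      (isClosed_tsupport W)
  have hfc : HasCompactSupport f := hWc.isCompact.of_isClosed_subset (isClosed_tsupport f) hft
  have hgc : HasCompactSupport g := hWc.isCompact.of_isClosed_subset (isClosed_tsupport g) hgt
  -- The weight `exp (-k |z - c|²)` decreases away from `c`. Beyond radius `r₁`, where the cut-off
  -- destroys the differential inequality, it is smaller than at every point inside.
  obtain ⟨k, c₀, hk, hc₀, hweight⟩ := exists_weight hSc hα hβ (contDiff_sqDist c) hSβ
    (fun z hz => sqDist_noncritical (hSβ z hz) fun h => hz.2 (by rw [h]; exact mem_ball_self hr₀))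
  set φ : ℂ → ℝ := fun z => Real.exp (-k * sqDist c z) with hφ
  have cs : ContDiff ℝ ∞ (sqDist c) := contDiff_sqDist c
  have cφ : ContDiff ℝ ∞ φ := by fun_prop
  obtain ⟨C, hC⟩ : ∃ C : ℝ, ∀ z ∈ S,
      ((-dx β z + α z * dy β z) / β z) ^ 2 + dy β z ^ 2 ≤ 4 * C := by
    have c3 := (hβ.dy (m := ∞) le_rfl).continuous
    have c4 := (hβ.dx (m := ∞) le_rfl).continuous
    have c5 := hα.continuous
    have c6 := hβ.continuous
    have hcont : ContinuousOn
        (fun z => ((-dx β z + α z * dy β z) / β z) ^ 2 + dy β z ^ 2) S := by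
      have : ContinuousOn (fun z => (-dx β z + α z * dy β z) / β z) S :=
        ContinuousOn.div (by fun_prop) c6.continuousOn hSβ
      fun_prop
    obtain ⟨C, hC⟩ := hSc.exists_bound_of_continuousOn hcont
    refine ⟨C / 4, fun z hz => ?_⟩
    have := (abs_le.1 (hC z hz)).2
    linarith
  have E1 : ∀ τ, 0 ≤ τ → (τ * c₀ - C) * ∫ z, Real.exp (τ * φ z) ^ 2 * (f z ^ 2 + g z ^ 2) ≤
      ∫ z, Real.exp (τ * φ z) ^ 2 * (dbarRe α β f g z ^ 2 + dbarIm α β f g z ^ 2) := fun τ hτ =>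
    carleman_weighted hα hβ cφ cf cg hfc hgc (hft.trans hWS) (hgt.trans hWS) hSβ hweight hC hτ
  -- `f + ig` is the conjugate operator `∂x - (α - iβ) ∂y` applied to the real function `W`. So this
  -- is the Carleman estimate with `-β`, while `E1` is the one with `β` applied to `f + ig`.
  have E2 : ∀ τ, 0 ≤ τ → (τ * c₀ - C) * ∫ z, Real.exp (τ * φ z) ^ 2 * W z ^ 2 ≤
      ∫ z, Real.exp (τ * φ z) ^ 2 * (f z ^ 2 + g z ^ 2) := fun τ hτ => by
    have hβn : ContDiff ℝ ∞ fun z => -β z := hβ.neg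
    have n1 : ∀ z, dx (fun z => -β z) z = -dx β z := fun z => by simp [dx, fderiv_fun_neg]
    have n2 : ∀ z, dy (fun z => -β z) z = -dy β z := fun z => by simp [dy, fderiv_fun_neg]
    have := carleman_weighted (f := W) (g := fun _ => 0) (c₀ := c₀) (C := C) (τ := τ) hα hβn cφ cW
      contDiff_const hWc HasCompactSupport.zero hWS (by simp [tsupport])
      (fun z hz => neg_ne_zero.2 (hSβ z hz))
      (fun z hz => by rw [bracket_neg]; exact hweight z hz)
      (fun z hz => by
        rw [n1, n2]
        have := hC z hz
        rw [div_neg, neg_sq (dy β z), neg_sq]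
        have e : (- -dx β z + α z * -dy β z) / β z = -((-dx β z + α z * dy β z) / β z) := by
          rw [← neg_div]; congr 1; ring
        rw [e, neg_sq]; exact this) hτ
    have s0 : ∀ z, slant α (fun _ => (0 : ℝ)) z = 0 := fun z => by simp [slant, dx, dy]
    have d0 : ∀ z, dy (fun _ => (0 : ℝ)) z = 0 := fun z => by simp [dy]
    simpa [dbarRe, dbarIm, s0, d0, hf, hg] using this
  have cU : ContDiff ℝ ∞ fun z => f z ^ 2 + g z ^ 2 := (cf.pow 2).add (cg.pow 2)
  have cRe : ContDiff ℝ ∞ (dbarRe α β f g) := (hα.slant cf le_rfl).add (hβ.mul (cg.dy le_rfl))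
  have cIm : ContDiff ℝ ∞ (dbarIm α β f g) := (hα.slant cg le_rfl).sub (hβ.mul (cf.dy le_rfl))
  have cH : ContDiff ℝ ∞ fun z => dbarRe α β f g z ^ 2 + dbarIm α β f g z ^ 2 :=
    (cRe.pow 2).add (cIm.pow 2)
  have offW : ∀ z ∉ tsupport W, f z = 0 ∧ g z = 0 := fun z hz =>
    ⟨image_eq_zero_of_notMem_tsupport fun h => hz (hft h),
      image_eq_zero_of_notMem_tsupport fun h => hz (hgt h)⟩
  have hUc : HasCompactSupport fun z => f z ^ 2 + g z ^ 2 :=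
    HasCompactSupport.intro hWc.isCompact fun z hz => by simp [offW z hz]
  have hHc : HasCompactSupport fun z => dbarRe α β f g z ^ 2 + dbarIm α β f g z ^ 2 :=
    HasCompactSupport.intro hWc.isCompact fun z hz => by
      have a1 : slant α f z = 0 := by
        by_contra h; exact hz (hft (support_slant_subset α f h))
      have a2 : slant α g z = 0 := by
        by_contra h; exact hz (hgt (support_slant_subset α g h))
      have a3 : dy f z = 0 := by
        by_contra h; exact hz (hft (support_dy_subset f h))
      have a4 : dy g z = 0 := by
        by_contra h; exact hz (hgt (support_dy_subset g h))
      simp [dbarRe, dbarIm, a1, a2, a3, a4]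
  have hres := eq_zero_of_weighted_bounds (c := c) (r := r₁) (C₁ := C₁)
    (φ₁ := Real.exp (-k * r₁ ^ 2)) (z₀ := z₀) hc₀ cφ.continuous cW.continuous cU.continuous
    cH.continuous hWc hUc hHc (fun z => by positivity) (fun z => by positivity) hC₁ E1 E2
    (fun z hz => by
      have hev := hWin z hz
      have f1 : f =ᶠ[𝓝 z] slant α w := by
        filter_upwards [hev.eventuallyEq_nhds] with y hy using slant_congr hy
      have g1 : g =ᶠ[𝓝 z] fun z => β z * dy w z := by
        filter_upwards [hev.eventuallyEq_nhds] with y hy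
        simp only [hg]; rw [dy_congr hy]
      have := hin z hz
      unfold dbarRe dbarIm at this ⊢
      rw [slant_congr f1, slant_congr g1, dy_congr f1, dy_congr g1, f1.self_of_nhds,
        g1.self_of_nhds, hev.self_of_nhds]
      exact this)
    (fun z hz => by
      refine Real.exp_le_exp.2 ?_
      rw [sqDist_eq]
      have h1 : r₁ ≤ dist z c := not_lt.1 hz
      have h2 : r₁ ^ 2 ≤ dist z c ^ 2 := by gcongr
      nlinarith)
    (by
      refine Real.exp_lt_exp.2 ?_
      rw [sqDist_eq]
      have h1 : dist z₀ c < r₁ := hz₀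
      have h2 : dist z₀ c ^ 2 < r₁ ^ 2 := by gcongr
      nlinarith)
  rw [← (hWin z₀ hz₀).self_of_nhds]
  exact hres

end H2R

end

/-! ### Factorization of second order operators and local unique continuation. -/

noncomputable section

namespace H2R

open Complex Metric MeasureTheory

/-- Multiplication by a cut-off. The Carleman estimates need functions that are smooth on the whole
plane. -/
theorem exists_global_extension {f : ℂ → ℝ} {c : ℂ} {r R : ℝ} (hr : 0 < r) (hrR : r < R)
    (hf : ∀ z ∈ ball c R, ContDiffAt ℝ ∞ f z) :
    ∃ g : ℂ → ℝ, ContDiff ℝ ∞ g ∧ ∀ z ∈ closedBall c r, g z = f z := by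
  let χ : ContDiffBump c := ⟨r, (r + R) / 2, hr, by linarith⟩
  refine ⟨fun z => χ z * f z, contDiff_iff_contDiffAt.2 fun z => ?_, fun z hz => ?_⟩
  · by_cases hz : z ∈ ball c R
    · exact χ.contDiff.contDiffAt.mul (hf z hz)
    · have hz' : z ∈ (closedBall c ((r + R) / 2))ᶜ := fun h => hz
        (closedBall_subset_ball (by linarith) h)
      have : (fun z => χ z * f z) =ᶠ[𝓝 z] fun _ => 0 := by
        filter_upwards [isClosed_closedBall.isOpen_compl.mem_nhds hz'] with y hy
        have : χ y = 0 := χ.zero_of_le_dist (not_le.1 (show ¬dist y c ≤ (r + R) / 2 from hy)).le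
        simp [this]
      exact contDiffAt_const.congr_of_eventuallyEq this
  · simp [χ.one_of_mem_closedBall hz]

/-- The product `(∂x - (α + iβ) ∂y)(∂x - (α - iβ) ∂y)` has the real principal part `∂x² - 2α ∂x∂y +
(α² + β²) ∂y²`. The derivatives of `α` and `β` contribute only first order terms. -/
theorem dbarRe_eq {α β w : ℂ → ℝ} (hα : ContDiff ℝ ∞ α) (hβ : ContDiff ℝ ∞ β)
    (hw : ContDiff ℝ ∞ w) (z : ℂ) :
    dbarRe α β (slant α w) (fun z => β z * dy w z) z =
      (dx (dx w) z - 2 * α z * dx (dy w) z + (α z ^ 2 + β z ^ 2) * dy (dy w) z)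
        + (β z * dy β z - slant α α z) * dy w z := by
  have dα := hα.differentiable (by simp)
  have dβ := hβ.differentiable (by simp)
  have dwx := (hw.dx (m := ∞) le_rfl).differentiable (by simp)
  have dwy := (hw.dy (m := ∞) le_rfl).differentiable (by simp)
  have e : slant α w = fun z => dx w z - α z * dy w z := rfl
  have hw2 : ContDiffAt ℝ 2 w z :=
    hw.contDiffAt.of_le (WithTop.coe_le_coe.2 (le_top : (2 : ℕ∞) ≤ ⊤))
  unfold dbarRe
  rw [dy_mul (dβ z) (dwy z), slant, e, dx_sub (dwx z) ((dα z).fun_mul (dwy z)),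
    dy_sub (dwx z) ((dα z).fun_mul (dwy z)), dx_mul (dα z) (dwy z), dy_mul (dα z) (dwy z), slant,
    ← dx_dy_comm hw2]
  ring

/-- The second order terms cancel because the principal part of the product is real. -/
theorem dbarIm_eq {α β w : ℂ → ℝ} (hα : ContDiff ℝ ∞ α) (hβ : ContDiff ℝ ∞ β)
    (hw : ContDiff ℝ ∞ w) (z : ℂ) :
    dbarIm α β (slant α w) (fun z => β z * dy w z) z =
      (slant α β z + β z * dy α z) * dy w z := by
  have dα := hα.differentiable (by simp)
  have dβ := hβ.differentiable (by simp)
  have dwx := (hw.dx (m := ∞) le_rfl).differentiable (by simp)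
  have dwy := (hw.dy (m := ∞) le_rfl).differentiable (by simp)
  have e : slant α w = fun z => dx w z - α z * dy w z := rfl
  have hw2 : ContDiffAt ℝ 2 w z :=
    hw.contDiffAt.of_le (WithTop.coe_le_coe.2 (le_top : (2 : ℕ∞) ≤ ⊤))
  unfold dbarIm
  rw [slant_mul (dβ z) (dwy z), e, dy_sub (dwx z) ((dα z).fun_mul (dwy z)), dy_mul (dα z) (dwy z), slant,
    slant, ← dx_dy_comm hw2]
  ring

/-- Arithmetic for `unique_continuation`: `σ` and `t` stand for `slant α v` and `β v_y`, `x` and `y`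
for the partial derivatives, which are recovered from them with the bounds `A` of `α` and `B` of
`1/β`. -/
theorem sq_add_sq_le_of_abs_le {k A B M₁ M₂ σ t v x y S m₁ m₂ : ℝ} (hk : 0 ≤ k) (hA : 0 ≤ A)
    (hB : 0 ≤ B) (hM₁ : 0 ≤ M₁) (hM₂ : 0 ≤ M₂) (hy : |y| ≤ B * |t|)
    (hx : |x| ≤ |σ| + A * (B * |t|)) (hS : |S| ≤ k * (|x| + |y| + |v|)) (h₁ : |m₁| ≤ M₁)
    (h₂ : |m₂| ≤ M₂) :
    (S + m₁ * y) ^ 2 + (m₂ * y) ^ 2 ≤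
      4 * (k * (1 + A * B + B) + M₁ * B + M₂ * B) ^ 2 * (v ^ 2 + (σ ^ 2 + t ^ 2)) := by
  have ht0 := abs_nonneg t
  have hσ0 := abs_nonneg σ
  have hv0 := abs_nonneg v
  set Q := k * (1 + A * B + B) + M₁ * B + M₂ * B with hQ
  have hRe : |S + m₁ * y| ≤ Q * (|σ| + |t| + |v|) := by
    refine (abs_add_le _ _).trans ?_
    rw [abs_mul m₁]
    have h1 := mul_le_mul h₁ hy (abs_nonneg _) hM₁
    have h2 : k * (|x| + |y| + |v|) ≤ k * ((|σ| + A * (B * |t|)) + B * |t| + |v|) := by gcongr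
    have p1 : 0 ≤ k * ((A * B + B) * (|σ| + |v|) + |t|) := by positivity
    have p2 : 0 ≤ M₁ * B * (|σ| + |v|) := by positivity
    have p3 : 0 ≤ M₂ * B * (|σ| + |t| + |v|) := by positivity
    rw [hQ]
    linarith only [hS, h1, h2, p1, p2, p3]
  have hIm : |m₂ * y| ≤ Q * |t| := by
    rw [abs_mul]
    have h1 := mul_le_mul h₂ hy (abs_nonneg _) hM₂
    have p1 : 0 ≤ k * (1 + A * B + B) * |t| := by positivity
    have p2 : 0 ≤ M₁ * B * |t| := by positivity
    rw [hQ]; linarith only [h1, p1, p2]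
  have hRe2 := pow_le_pow_left₀ (abs_nonneg _) hRe 2
  have hIm2 := pow_le_pow_left₀ (abs_nonneg _) hIm 2
  rw [sq_abs] at hRe2 hIm2
  refine (add_le_add hRe2 hIm2).trans ?_
  rw [← sq_abs σ, ← sq_abs t, ← sq_abs v]
  have : (|σ| + |t| + |v|) ^ 2 + |t| ^ 2 ≤ 4 * (|v| ^ 2 + (|σ| ^ 2 + |t| ^ 2)) := by
    nlinarith only [sq_nonneg (|σ| - |t|), sq_nonneg (|σ| - |v|), sq_nonneg (|t| - |v|),
      sq_nonneg |v|, sq_nonneg |σ|]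
  calc (Q * (|σ| + |t| + |v|)) ^ 2 + (Q * |t|) ^ 2
      = Q ^ 2 * ((|σ| + |t| + |v|) ^ 2 + |t| ^ 2) := by ring
    _ ≤ Q ^ 2 * (4 * (|v| ^ 2 + (|σ| ^ 2 + |t| ^ 2))) := by gcongr
    _ = _ := by ring

/-- Unique continuation: a solution of an elliptic differential inequality on a disk that vanishes
near the centre vanishes on the disk. -/
theorem unique_continuation {a₁₁ a₁₂ a₂₂ w : ℂ → ℝ} {c : ℂ} {R l Λ K : ℝ} (hl : 0 < l) (hK : 0 ≤ K)
    (h₁₁ : ∀ z ∈ ball c R, ContDiffAt ℝ ∞ a₁₁ z) (h₁₂ : ∀ z ∈ ball c R, ContDiffAt ℝ ∞ a₁₂ z)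
    (h₂₂ : ∀ z ∈ ball c R, ContDiffAt ℝ ∞ a₂₂ z) (hw : ∀ z ∈ ball c R, ContDiffAt ℝ ∞ w z)
    (hL : ∀ z ∈ ball c R, EllipticIneq a₁₁ a₁₂ a₂₂ w l Λ K z) (h0 : ∀ᶠ z in 𝓝 c, w z = 0) :
    ∀ z ∈ ball c R, w z = 0 := by
  intro z₀ hz₀
  have hd : dist z₀ c < R := hz₀
  obtain ⟨r₁, hr₁, hr₁R⟩ := exists_between hd
  obtain ⟨r₂, hr₂, hr₂R⟩ := exists_between hr₁R
  have hr₁0 : 0 < r₁ := lt_of_le_of_lt dist_nonneg hr₁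
  have hr₂0 : 0 < r₂ := hr₁0.trans hr₂
  have hsub : closedBall c r₂ ⊆ ball c R := closedBall_subset_ball hr₂R
  have ha : ∀ z ∈ ball c R, l ≤ a₁₁ z := fun z hz => by
    have := (hL z hz).ell 1 0; simpa using this
  have hdet : ∀ z ∈ ball c R, 0 < a₁₁ z * a₂₂ z - a₁₂ z ^ 2 := fun z hz => by
    have h1 := (hL z hz).ell (a₁₂ z) (-a₁₁ z)
    have ha' : 0 < a₁₁ z := lt_of_lt_of_le hl (ha z hz)
    have h2 : 0 < l * (a₁₂ z ^ 2 + (-a₁₁ z) ^ 2) := by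
      have : 0 < (-a₁₁ z) ^ 2 := by rw [neg_sq]; positivity
      positivity
    have h3 : 0 < a₁₁ z * (a₁₁ z * a₂₂ z - a₁₂ z ^ 2) := by
      have : a₁₁ z * (a₁₁ z * a₂₂ z - a₁₂ z ^ 2) = a₁₁ z * a₁₂ z ^ 2
        + 2 * a₁₂ z * (a₁₂ z * -a₁₁ z) + a₂₂ z * (-a₁₁ z) ^ 2 := by ring
      linarith
    exact pos_of_mul_pos_right h3 ha'.le
  -- `α ± iβ` are the complex roots of the symbol `a₁₁ ξ² + 2 a₁₂ ξ + a₂₂`. Ellipticity makes the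
  -- discriminant negative, so that `β` is smooth and nonzero.
  obtain ⟨α, cα, hα⟩ := exists_global_extension (f := fun z => -a₁₂ z / a₁₁ z) hr₂0 hr₂R
    (fun z hz => (h₁₂ z hz).neg.div (h₁₁ z hz) (lt_of_lt_of_le hl (ha z hz)).ne')
  obtain ⟨β, cβ, hβ⟩ := exists_global_extension
    (f := fun z => √(a₁₁ z * a₂₂ z - a₁₂ z ^ 2) / a₁₁ z) hr₂0 hr₂R
    (fun z hz => ((((h₁₁ z hz).mul (h₂₂ z hz)).sub ((h₁₂ z hz).pow 2)).sqrt
      (hdet z hz).ne').div (h₁₁ z hz) (lt_of_lt_of_le hl (ha z hz)).ne')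
  obtain ⟨v, cv, hv⟩ := exists_global_extension hr₂0 hr₂R hw
  have hβ0 : ∀ z ∈ closedBall c r₂, β z ≠ 0 := fun z hz => by
    rw [hβ z hz]
    exact div_ne_zero (Real.sqrt_pos.2 (hdet z (hsub hz))).ne'
      (lt_of_lt_of_le hl (ha z (hsub hz))).ne'
  have hcomp := isCompact_closedBall c r₂
  have cont1 := cα.continuous
  have cont2 := cβ.continuous
  have cont3 := (cβ.dy (m := ∞) le_rfl).continuous
  have cont4 := (cα.dy (m := ∞) le_rfl).continuous
  have cont5 := (cα.slant (m := ∞) cα le_rfl).continuous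
  have cont6 := (cα.slant (m := ∞) cβ le_rfl).continuous
  obtain ⟨A, hA⟩ := hcomp.exists_bound_of_continuousOn cont1.continuousOn
  obtain ⟨B, hB⟩ := hcomp.exists_bound_of_continuousOn
    ((cont2.continuousOn (s := closedBall c r₂)).inv₀ hβ0)
  obtain ⟨M₁, hM₁⟩ := hcomp.exists_bound_of_continuousOn
    (f := fun z => β z * dy β z - slant α α z) (by fun_prop)
  obtain ⟨M₂, hM₂⟩ := hcomp.exists_bound_of_continuousOn
    (f := fun z => slant α β z + β z * dy α z) (by fun_prop)
  have hcc : c ∈ closedBall c r₂ := mem_closedBall_self hr₂0.le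
  have hA0 : 0 ≤ A := (norm_nonneg _).trans (hA c hcc)
  have hB0 : 0 ≤ B := (norm_nonneg _).trans (hB c hcc)
  have hM₁0 : 0 ≤ M₁ := (norm_nonneg _).trans (hM₁ c hcc)
  have hM₂0 : 0 ≤ M₂ := (norm_nonneg _).trans (hM₂ c hcc)
  have hKl : 0 ≤ K / l := by positivity
  have hvw : ∀ z ∈ ball c r₂, v =ᶠ[𝓝 z] w := fun z hz => by
    filter_upwards [isOpen_ball.mem_nhds hz] with y hy using hv y (ball_subset_closedBall hy)
  have hv0 : ∀ᶠ z in 𝓝 c, v z = 0 := by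
    filter_upwards [h0, hvw c (mem_ball_self hr₂0)] with z h1 h2
    rw [h2, h1]
  have := unique_continuation_aux (C₁ := 4 * (K / l * (1 + A * B + B) + M₁ * B + M₂ * B) ^ 2) hr₁0 hr₂ cα cβ cv hβ0 hv0 (by positivity)
    (fun z hz => by
      have hz₂ : z ∈ ball c r₂ := ball_subset_ball hr₂.le hz
      have hzc : z ∈ closedBall c r₂ := ball_subset_closedBall hz₂
      have hzR := hsub hzc
      have ha' : 0 < a₁₁ z := lt_of_lt_of_le hl (ha z hzR)
      rw [dbarRe_eq cα cβ cv, dbarIm_eq cα cβ cv]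
      have hαβ : α z ^ 2 + β z ^ 2 = a₂₂ z / a₁₁ z := by
        rw [hα z hzc, hβ z hzc, div_pow, div_pow, Real.sq_sqrt (hdet z hzR).le]
        field_simp; ring
      have hprin : dx (dx v) z - 2 * α z * dx (dy v) z + (α z ^ 2 + β z ^ 2) * dy (dy v) z
          = secondOrder a₁₁ a₁₂ a₂₂ w z / a₁₁ z := by
        have e1 : dx v =ᶠ[𝓝 z] dx w := by
          filter_upwards [(hvw z hz₂).eventuallyEq_nhds] with y hy using dx_congr hy
        have e2 : dy v =ᶠ[𝓝 z] dy w := by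
          filter_upwards [(hvw z hz₂).eventuallyEq_nhds] with y hy using dy_congr hy
        rw [hαβ, hα z hzc, secondOrder, dx_congr e1, dx_congr e2, dy_congr e2]
        field_simp; ring
      have hineq := (hL z hzR).ineq
      rw [← dx_congr (hvw z hz₂), ← dy_congr (hvw z hz₂), ← (hvw z hz₂).self_of_nhds] at hineq
      set σ := slant α v z with hσ
      set t := β z * dy v z with ht
      have hy : |dy v z| ≤ B * |t| := by
        have h1 : dy v z = (β z)⁻¹ * t := by rw [ht]; field_simp [hβ0 z hzc]
        rw [h1, abs_mul]
        exact mul_le_mul_of_nonneg_right (hB z hzc) (abs_nonneg _)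
      have hx : |dx v z| ≤ |σ| + A * (B * |t|) := by
        have h1 : dx v z = σ + α z * dy v z := by rw [hσ, slant]; ring
        rw [h1]
        refine (abs_add_le _ _).trans ?_
        rw [abs_mul]
        have := mul_le_mul (hA z hzc) hy (abs_nonneg _) hA0
        rw [Real.norm_eq_abs] at this
        linarith
      have hS : |secondOrder a₁₁ a₁₂ a₂₂ w z / a₁₁ z| ≤
          K / l * (|dx v z| + |dy v z| + |v z|) := by
        rw [abs_div, abs_of_pos ha', div_mul_eq_mul_div]
        exact div_le_div₀ (by positivity) hineq hl (ha z hzR)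
      rw [hprin]
      exact sq_add_sq_le_of_abs_le hKl hA0 hB0 hM₁0 hM₂0 hy hx hS (hM₁ z hzc) (hM₂ z hzc)) z₀ hr₁
  rw [← hv z₀ (hr₁.le.trans hr₂.le)]
  exact this

end H2R

end

/-! ### `C²` extension across a hyperplane by Hestenes' reflection. -/

noncomputable section

namespace H2R

section Glue

variable {E F : Type*} [NormedAddCommGroup E] [NormedSpace ℝ E] [NormedAddCommGroup F]
  [NormedSpace ℝ F]

open Classical in
/-- Two functions with Taylor series on the two sides of a hyperplane that agree on the hyperplane
can be glued. -/
theorem HasFTaylorSeriesUpToOn.glue {n : WithTop ℕ∞} {f g : E → F}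
    {p q : E → FormalMultilinearSeries ℝ E F} {V : Set E} {φ : E →L[ℝ] ℝ}
    (hf : HasFTaylorSeriesUpToOn n f p (V ∩ {x | 0 ≤ φ x}))
    (hg : HasFTaylorSeriesUpToOn n g q (V ∩ {x | φ x ≤ 0}))
    (hpq : ∀ x ∈ V, φ x = 0 → ∀ m : ℕ, m ≤ n → p x m = q x m) :
    HasFTaylorSeriesUpToOn n (fun x => if 0 ≤ φ x then f x else g x)
      (fun x => if 0 ≤ φ x then p x else q x) V := by
  set P : E → FormalMultilinearSeries ℝ E F := fun x => if 0 ≤ φ x then p x else q x with hP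
  have hPp : ∀ x, 0 ≤ φ x → P x = p x := fun x hx => if_pos hx
  have hPq : ∀ x ∈ V, φ x ≤ 0 → ∀ m : ℕ, m ≤ n → P x m = q x m := fun x hx hx' m hm => by
    rcases lt_or_eq_of_le hx' with h | h
    · simp only [hP, if_neg (not_le.2 h)]
    · rw [hPp x h.ge, hpq x hx h m hm]
  have hV : V = (V ∩ {x | 0 ≤ φ x}) ∪ (V ∩ {x | φ x ≤ 0}) := by
    ext x
    simp only [Set.mem_union, Set.mem_inter_iff, Set.mem_ofPred_eq, ← and_or_left]
    exact ⟨fun h => ⟨h, le_total _ _⟩, fun h => h.1⟩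
  -- Off the closure of a half space, differentiability and continuity within that half are vacuous.
  -- So both can be checked on each half separately and then united.
  have cl1 : ∀ x, φ x < 0 → x ∉ closure (V ∩ {x | 0 ≤ φ x}) := fun x hx h => by
    have : closure (V ∩ {x | 0 ≤ φ x}) ⊆ {x | 0 ≤ φ x} :=
      closure_minimal Set.inter_subset_right (isClosed_le continuous_const φ.continuous)
    exact absurd (this h) (not_le.2 hx)
  have cl2 : ∀ x, 0 < φ x → x ∉ closure (V ∩ {x | φ x ≤ 0}) := fun x hx h => by
    have : closure (V ∩ {x | φ x ≤ 0}) ⊆ {x | φ x ≤ 0} :=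
      closure_minimal Set.inter_subset_right (isClosed_le φ.continuous continuous_const)
    exact absurd (this h) (not_le.2 hx)
  refine ⟨fun x hx => ?_, fun m hm x hx => ?_, fun m hm x hx => ?_⟩
  · by_cases h : 0 ≤ φ x
    · rw [hPp x h, if_pos h, hf.zero_eq x ⟨hx, h⟩]
    · rw [hPq x hx (not_le.1 h).le 0 (by simp), if_neg h, hg.zero_eq x ⟨hx, (not_le.1 h).le⟩]
  · have hm' : ((m.succ : ℕ) : WithTop ℕ∞) ≤ n := by
      have := ENat.add_one_natCast_le_withTop_of_lt hm
      simpa using this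
    have A : HasFDerivWithinAt (P · m) (P x m.succ).curryLeft (V ∩ {x | 0 ≤ φ x}) x := by
      by_cases h : 0 ≤ φ x
      · rw [hPp x h]
        exact (hf.fderivWithin m hm x ⟨hx, h⟩).congr (fun y hy => by rw [hPp y hy.2])
          (by rw [hPp x h])
      · exact .of_notMem_closure (cl1 x (not_le.1 h))
    have B : HasFDerivWithinAt (P · m) (P x m.succ).curryLeft (V ∩ {x | φ x ≤ 0}) x := by
      by_cases h : φ x ≤ 0
      · rw [hPq x hx h _ hm']
        exact (hg.fderivWithin m hm x ⟨hx, h⟩).congr (fun y hy => hPq y hy.1 hy.2 m hm.le)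
          (hPq x hx h m hm.le)
      · exact .of_notMem_closure (cl2 x (not_le.1 h))
    rw [hV]
    exact A.union B
  · have A : ContinuousWithinAt (P · m) (V ∩ {x | 0 ≤ φ x}) x := by
      by_cases h : 0 ≤ φ x
      · exact (hf.cont m hm x ⟨hx, h⟩).congr (fun y hy => by rw [hPp y hy.2]) (by rw [hPp x h])
      · exact continuousWithinAt_of_notMem_closure (cl1 x (not_le.1 h))
    have B : ContinuousWithinAt (P · m) (V ∩ {x | φ x ≤ 0}) x := by
      by_cases h : φ x ≤ 0
      · exact (hg.cont m hm x ⟨hx, h⟩).congr (fun y hy => hPq y hy.1 hy.2 m hm) (hPq x hx h m hm)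
      · exact continuousWithinAt_of_notMem_closure (cl2 x (not_le.1 h))
    rw [hV]
    exact A.union B

/-- The linear map `x ↦ x - k φ(x) u`. -/
def reflect (φ : E →L[ℝ] ℝ) (u : E) (k : ℝ) : E →L[ℝ] E :=
  ContinuousLinearMap.id ℝ E - k • φ.smulRight u

theorem reflect_apply (φ : E →L[ℝ] ℝ) (u : E) (k : ℝ) (x : E) :
    reflect φ u k x = x - (k * φ x) • u := by
  simp [reflect, mul_smul]

/-- The moment conditions for Hestenes' reflection of order two. -/
theorem reflect_moments (φ : E →L[ℝ] ℝ) (u : E) {m : ℕ} (hm : m ≤ 2)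
    (L : ContinuousMultilinearMap ℝ (fun _ : Fin m => E) F) :
    (6 : ℝ) • L.compContinuousLinearMap (fun _ => reflect φ u 2)
      + ((-8 : ℝ) • L.compContinuousLinearMap (fun _ => reflect φ u 3)
      + (3 : ℝ) • L.compContinuousLinearMap (fun _ => reflect φ u 4)) = L := by
  ext v
  simp only [add_apply, smul_apply,
    ContinuousMultilinearMap.compContinuousLinearMap_apply]
  -- Composing `L` with the reflection of parameter `k` gives a polynomial in `k` of degree at most
  -- `m`, with constant term `L`. The weights `6, -8, 3` at `k = 2, 3, 4` have sum `1` and vanishing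
  -- first and second moments, so only `L` survives.
  interval_cases m
  · have : ∀ w : Fin 0 → E, L w = L v := fun w => by congr 1; exact Subsingleton.elim _ _
    rw [this, this fun i => reflect φ u 3 (v i), this fun i => reflect φ u 4 (v i)]
    module
  · have key : ∀ k : ℝ, L (fun i => reflect φ u k (v i))
        = L v - (k * φ (v 0)) • L.curryLeft u (Fin.tail v) := fun k => by
      have e : ∀ w : Fin 1 → E, L w = L.curryLeft (w 0) (Fin.tail v) := fun w => by
        rw [ContinuousMultilinearMap.curryLeft_apply]
        congr 1
        ext i; fin_cases i; rfl
      rw [e, e v, reflect_apply, map_sub, map_smul]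
      rfl
    rw [key, key, key]
    module
  · have e : ∀ w : Fin 2 → E, L w = (L.curryLeft (w 0)).curryLeft (w 1) (Fin.tail (Fin.tail v)) :=
      fun w => by
        rw [ContinuousMultilinearMap.curryLeft_apply, ContinuousMultilinearMap.curryLeft_apply]
        congr 1
        ext i; fin_cases i <;> rfl
    have key : ∀ k : ℝ, L (fun i => reflect φ u k (v i))
        = L v - k • (φ (v 0) • (L.curryLeft u).curryLeft (v 1) (Fin.tail (Fin.tail v))
            + φ (v 1) • (L.curryLeft (v 0)).curryLeft u (Fin.tail (Fin.tail v)))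
          + (k ^ 2) • ((φ (v 0) * φ (v 1)) •
            (L.curryLeft u).curryLeft u (Fin.tail (Fin.tail v))) := fun k => by
      have lin1 : ∀ (a b : E) (t : ℝ) (c : E) (w : Fin 0 → E),
          (L.curryLeft (a - t • b)).curryLeft c w
            = (L.curryLeft a).curryLeft c w - t • (L.curryLeft b).curryLeft c w :=
        fun a b t c w => by
          simp only [ContinuousMultilinearMap.curryLeft_apply (L.curryLeft _), map_sub, map_smul]
          rfl
      have lin2 : ∀ (a b : E) (t : ℝ) (c : E) (w : Fin 0 → E),
          (L.curryLeft c).curryLeft (a - t • b) w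
            = (L.curryLeft c).curryLeft a w - t • (L.curryLeft c).curryLeft b w :=
        fun a b t c w => by
          rw [map_sub, map_smul]; rfl
      rw [e, e v]
      simp only [reflect_apply, lin1, lin2]
      module
    rw [key, key, key]
    module

open Classical in
/-- A function that is `C²` on a half space up to the boundary has a `C²` extension. -/
theorem exists_contDiffAt_extension {G : E → F} {a u : E} {φ : E →L[ℝ] ℝ} (ha : φ a = 0)
    (hu : φ u = 1) (hG : ContDiffWithinAt ℝ 2 G {x | 0 ≤ φ x} a) :
    ∃ H : E → F, ContDiffAt ℝ 2 H a ∧ ∀ x, 0 ≤ φ x → H x = G x := by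
  obtain ⟨U, hU, p, hp⟩ := (contDiffWithinAt_nat (n := 2)).1 hG
  rw [Set.insert_eq_of_mem (show a ∈ {x | 0 ≤ φ x} from ha.ge)] at hU
  obtain ⟨r, hr, hball⟩ := Metric.mem_nhdsWithin_iff.1 hU
  set B : Set E := Metric.ball a r with hB
  have hfix : ∀ k : ℝ, ∀ x, φ x = 0 → reflect φ u k x = x := fun k x hx => by
    rw [reflect_apply, hx]; simp
  have hφr : ∀ k : ℝ, ∀ x, φ (reflect φ u k x) = (1 - k) * φ x := fun k x => by
    rw [reflect_apply, map_sub, map_smul, hu]; simp; ring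
  -- For `k = 2, 3, 4` the reflection multiplies `φ` by `-1, -2, -3`: it carries `{φ ≤ 0}` into the
  -- side where `G` is known, and it fixes the hyperplane. `V` consists of the points of `B` whose
  -- three reflections are also in `B`.
  set V : Set E := B ∩ (reflect φ u 2 ⁻¹' B ∩ (reflect φ u 3 ⁻¹' B ∩ reflect φ u 4 ⁻¹' B)) with hV
  have hVo : IsOpen V := by
    have := fun k : ℝ => (Metric.isOpen_ball (x := a) (ε := r)).preimage (reflect φ u k).continuous
    exact Metric.isOpen_ball.inter ((this 2).inter ((this 3).inter (this 4)))
  have haB : a ∈ B := Metric.mem_ball_self hr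
  have haV : a ∈ V := by
    have := fun k : ℝ => show reflect φ u k a ∈ B by rw [hfix k a ha]; exact haB
    exact ⟨haB, this 2, this 3, this 4⟩
  have term : ∀ c k : ℝ, 1 ≤ k → V ⊆ reflect φ u k ⁻¹' B →
      HasFTaylorSeriesUpToOn 2 (fun x => c • G (reflect φ u k x))
        (fun x m => c • (p (reflect φ u k x) m).compContinuousLinearMap fun _ => reflect φ u k)
        (V ∩ {x | φ x ≤ 0}) := fun c k hk hVk => by
    have h1 := ((hp.compContinuousLinearMap (reflect φ u k)).continuousLinearMap_comp
      (c • ContinuousLinearMap.id ℝ F))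
    refine h1.mono fun x hx => hball ⟨hVk hx.1, ?_⟩
    change 0 ≤ φ (reflect φ u k x)
    rw [hφr]
    exact mul_nonneg_of_nonpos_of_nonpos (by linarith) hx.2
  have h2 := term 6 2 (by norm_num) fun x hx => hx.2.1
  have h3 := term (-8) 3 (by norm_num) fun x hx => hx.2.2.1
  have h4 := term 3 4 (by norm_num) fun x hx => hx.2.2.2
  have hglue := HasFTaylorSeriesUpToOn.glue (V := V) (hp.mono (fun x hx => hball ⟨hx.1.1, hx.2⟩))
    (h2.add (h3.add h4)) (fun x _ hx m hm => by
      have hm2 : m ≤ 2 := by exact_mod_cast hm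
      have := reflect_moments φ u hm2 (p x m)
      refine this.symm.trans ?_
      change _ = (6 : ℝ) • (p (reflect φ u 2 x) m).compContinuousLinearMap (fun _ => reflect φ u 2)
        + ((-8 : ℝ) • (p (reflect φ u 3 x) m).compContinuousLinearMap (fun _ => reflect φ u 3)
        + (3 : ℝ) • (p (reflect φ u 4 x) m).compContinuousLinearMap (fun _ => reflect φ u 4))
      rw [hfix 2 x hx, hfix 3 x hx, hfix 4 x hx])
  refine ⟨_, (hglue.contDiffOn (n := 2)).contDiffAt (hVo.mem_nhds haV), fun x hx => if_pos hx⟩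

end Glue

end H2R

end

/-! ### The product metric and the coefficients of the graph equation. -/

noncomputable section

namespace H2R

open Complex Metric

section MetricAlgebra

variable (x v v' w w' : E3) (a : ℝ)

theorem metric_comm : metric x v w = metric x w v := by
  simp only [metric]; ring

theorem metric_add_left : metric x (v + v') w = metric x v w + metric x v' w := by
  simp only [metric, PiLp.add_apply]; ring

theorem metric_add_right : metric x v (w + w') = metric x v w + metric x v w' := by
  simp only [metric, PiLp.add_apply]; ring

theorem metric_smul_left : metric x (a • v) w = a * metric x v w := by
  simp only [metric, PiLp.smul_apply, smul_eq_mul]; ring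

theorem metric_smul_right : metric x v (a • w) = a * metric x v w := by
  simp only [metric, PiLp.smul_apply, smul_eq_mul]; ring

theorem metric_sub_left : metric x (v - v') w = metric x v w - metric x v' w := by
  simp only [metric, PiLp.sub_apply]; ring

theorem metric_sub_right : metric x v (w - w') = metric x v w - metric x v w' := by
  simp only [metric, PiLp.sub_apply]; ring

theorem metric_zero_right : metric x v 0 = 0 := by
  simp [metric]

theorem christoffel_add_left :
    christoffel x (v + v') w = christoffel x v w + christoffel x v' w := by
  ext i; fin_cases i <;> simp [christoffel] <;> ring

theorem christoffel_smul_left : christoffel x (a • v) w = a • christoffel x v w := by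
  ext i; fin_cases i <;> simp [christoffel] <;> ring

end MetricAlgebra

theorem conf_pos {x : E3} (hx : x ∈ space) : 0 < conf x := by
  have h : x 0 ^ 2 + x 1 ^ 2 < 1 := hx
  unfold conf
  have : 0 < 1 - x 0 ^ 2 - x 1 ^ 2 := by linarith
  positivity

theorem metric_self_pos {x v : E3} (hx : x ∈ space) (hv : v ≠ 0) : 0 < metric x v v := by
  have hc := conf_pos hx
  by_contra h
  push Not at h
  apply hv
  have e : metric x v v = conf x ^ 2 * v 0 ^ 2 + conf x ^ 2 * v 1 ^ 2 + v 2 ^ 2 := by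
    simp only [metric]; ring
  have p0 : 0 ≤ conf x ^ 2 * v 0 ^ 2 := by positivity
  have p1 : 0 ≤ conf x ^ 2 * v 1 ^ 2 := by positivity
  have p2 : 0 ≤ v 2 ^ 2 := by positivity
  have h0 : conf x ^ 2 * v 0 ^ 2 = 0 := by linarith
  have h1 : conf x ^ 2 * v 1 ^ 2 = 0 := by linarith
  have h2 : v 2 ^ 2 = 0 := by linarith
  have hcn : conf x ^ 2 ≠ 0 := by positivity
  ext i
  fin_cases i
  · simpa [hc.ne'] using h0
  · simpa [hc.ne'] using h1
  · simpa using h2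

theorem metric_self_nonneg {x : E3} (hx : x ∈ space) (v : E3) : 0 ≤ metric x v v := by
  by_cases h : v = 0
  · rw [h, metric_zero_right]
  · exact (metric_self_pos hx h).le

/-- The vector `⟨v, v⟩ w - ⟨v, w⟩ v` is nonzero, and its square norm is `⟨v, v⟩` times the Gram
determinant. -/
theorem metric_gram_pos {x v w : E3} (hx : x ∈ space)
    (hli : ∀ a b : ℝ, a • v + b • w = 0 → a = 0 ∧ b = 0) :
    0 < metric x v v * metric x w w - metric x v w ^ 2 := by
  have hv : v ≠ 0 := fun h => by
    have := (hli 1 0 (by simp [h])).1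
    exact one_ne_zero this
  have hvv := metric_self_pos hx hv
  have hy : metric x v v • w - metric x v w • v ≠ 0 := fun h => by
    have := (hli (-metric x v w) (metric x v v) (by rw [← h]; module)).2
    exact hvv.ne' this
  have h1 := metric_self_pos hx hy
  have h2 : metric x (metric x v v • w - metric x v w • v) (metric x v v • w - metric x v w • v)
      = metric x v v * (metric x v v * metric x w w - metric x v w ^ 2) := by
    simp only [metric_sub_left, metric_sub_right, metric_smul_left, metric_smul_right,
      metric_comm x w v]
    ring
  rw [h2] at h1
  exact pos_of_mul_pos_right h1 hvv.le

theorem isOpen_space : IsOpen space := by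
  have h : Continuous fun x : E3 => x 0 ^ 2 + x 1 ^ 2 := by fun_prop
  exact isOpen_lt h continuous_const

/-- The derivative of the metric product of two fields along a curve. -/
theorem hasDerivAt_metric {X N Y : ℝ → E3} {X' N' Y' : E3} {t : ℝ} (hx : X t ∈ space)
    (hX : HasDerivAt X X' t) (hN : HasDerivAt N N' t) (hY : HasDerivAt Y Y' t) :
    HasDerivAt (fun s => metric (X s) (N s) (Y s))
      (metric (X t) (N' + christoffel (X t) X' (N t)) (Y t)
        + metric (X t) (N t) (Y' + christoffel (X t) X' (Y t))) t := by
  have hne : (1 : ℝ) - X t 0 ^ 2 - X t 1 ^ 2 ≠ 0 := by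
    have h : X t 0 ^ 2 + X t 1 ^ 2 < 1 := hx
    intro h0
    linarith
  have hco : ∀ {Z : ℝ → E3} {Z' : E3}, HasDerivAt Z Z' t → ∀ i,
      HasDerivAt (fun s => Z s i) (Z' i) t := fun hZ i =>
    (EuclideanSpace.proj (𝕜 := ℝ) i).hasFDerivAt.comp_hasDerivAt t hZ
  have hd := (((hco hX 0).pow 2).const_sub 1).sub ((hco hX 1).pow 2)
  have hc := (hasDerivAt_const t (2 : ℝ)).div hd hne
  have hm := ((hc.pow 2).mul (((hco hN 0).mul (hco hY 0)).add ((hco hN 1).mul (hco hY 1)))).add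
    ((hco hN 2).mul (hco hY 2))
  refine HasDerivAt.congr_deriv (f := fun s => metric (X s) (N s) (Y s)) hm ?_
  simp [metric, christoffel, conf]
  field_simp
  ring

theorem contDiffAt_conf {x : E3} (hx : x ∈ space) {n : WithTop ℕ∞} : ContDiffAt ℝ n conf x := by
  have hne : (1 : ℝ) - x 0 ^ 2 - x 1 ^ 2 ≠ 0 := by
    have h : x 0 ^ 2 + x 1 ^ 2 < 1 := hx
    intro h0
    linarith
  have h : ∀ i, ContDiff ℝ n fun x : E3 => x i := fun i => contDiff_euclidean.1 contDiff_id i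
  unfold conf
  exact contDiffAt_const.div
    ((contDiffAt_const.sub ((h 0).contDiffAt.pow 2)).sub ((h 1).contDiffAt.pow 2)) hne

section Smoothness

variable {G : Type*} [NormedAddCommGroup G] [NormedSpace ℝ G] {g : G} {n : WithTop ℕ∞}
  {X V W : G → E3}

theorem contDiffAt_metric (hx : X g ∈ space) (hX : ContDiffAt ℝ n X g) (hV : ContDiffAt ℝ n V g)
    (hW : ContDiffAt ℝ n W g) : ContDiffAt ℝ n (fun y => metric (X y) (V y) (W y)) g := by
  have hc : ContDiffAt ℝ n (fun y => conf (X y)) g := (contDiffAt_conf hx).comp g hX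
  have hV' := contDiffAt_euclidean.1 hV
  have hW' := contDiffAt_euclidean.1 hW
  unfold metric
  exact ((hc.pow 2).mul (((hV' 0).mul (hW' 0)).add ((hV' 1).mul (hW' 1)))).add
    ((hV' 2).mul (hW' 2))

theorem contDiffAt_christoffel (hx : X g ∈ space) (hX : ContDiffAt ℝ n X g)
    (hV : ContDiffAt ℝ n V g) (hW : ContDiffAt ℝ n W g) :
    ContDiffAt ℝ n (fun y => christoffel (X y) (V y) (W y)) g := by
  have hc : ContDiffAt ℝ n (fun y => conf (X y)) g := (contDiffAt_conf hx).comp g hX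
  have hX' := contDiffAt_euclidean.1 hX
  have hV' := contDiffAt_euclidean.1 hV
  have hW' := contDiffAt_euclidean.1 hW
  have x0 := hX' 0
  have x1 := hX' 1
  have v0 := hV' 0
  have v1 := hV' 1
  have w0 := hW' 0
  have w1 := hW' 1
  refine contDiffAt_euclidean.2 fun i => ?_
  fin_cases i
  · simp only [christoffel, Fin.zero_eta, PiLp.toLp_apply, Matrix.cons_val_zero]
    fun_prop
  · simp only [christoffel, Fin.mk_one, PiLp.toLp_apply, Matrix.cons_val_one,
      Matrix.cons_val_zero]
    fun_prop
  · exact contDiffAt_const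

end Smoothness

section GraphCoefficients

variable (Φ : E3 ≃L[ℝ] ℂ × ℝ)

/-- The vector `X_x = E₁ + p V` tangent to a graph with `u_x = p`. -/
def tanX (p : ℝ) : E3 := Φ.symm (1, p)

/-- The vector `X_y = E₂ + q V` tangent to a graph with `u_y = q`. -/
def tanY (q : ℝ) : E3 := Φ.symm (I, q)

/-- The covector that vanishes on `tanX`, `tanY` and is `1` on `V`. -/
def conormal (p q : ℝ) (y : E3) : ℝ := (Φ y).2 - p * (Φ y).1.re - q * (Φ y).1.im

/-- A first order jet: a point of space, and the two first derivatives of a graph function. -/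
abbrev Jet := E3 × ℝ × ℝ

/-- The three coefficients form the adjugate of the first fundamental form in the frame `tanX`,
`tanY`. Using the adjugate instead of the inverse keeps the equation free of denominators. -/
def coef₁₁ (j : Jet) : ℝ := metric j.1 (tanY Φ j.2.2) (tanY Φ j.2.2)
def coef₁₂ (j : Jet) : ℝ := -metric j.1 (tanX Φ j.2.1) (tanY Φ j.2.2)
def coef₂₂ (j : Jet) : ℝ := metric j.1 (tanX Φ j.2.1) (tanX Φ j.2.1)

/-- The right hand side of the equation of graphs that are translating solitons. -/
def coefRhs (j : Jet) : ℝ :=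
  2 * (coef₁₁ Φ j * coef₂₂ Φ j - coef₁₂ Φ j ^ 2) * conormal Φ j.2.1 j.2.2 dz
    - (coef₁₁ Φ j * conormal Φ j.2.1 j.2.2 (christoffel j.1 (tanX Φ j.2.1) (tanX Φ j.2.1))
      + 2 * coef₁₂ Φ j * conormal Φ j.2.1 j.2.2 (christoffel j.1 (tanX Φ j.2.1) (tanY Φ j.2.2))
      + coef₂₂ Φ j * conormal Φ j.2.1 j.2.2 (christoffel j.1 (tanY Φ j.2.2) (tanY Φ j.2.2)))

/-- The graph of `u`. -/
def graphMap (u : ℂ → ℝ) (z : ℂ) : E3 := Φ.symm (z, u z)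

def jet (u : ℂ → ℝ) (z : ℂ) : Jet := (graphMap Φ u z, dx u z, dy u z)

/-- The equation at `z` of the graphs that are translating solitons. -/
def SolitonEq (u : ℂ → ℝ) (z : ℂ) : Prop :=
  secondOrder (fun z => coef₁₁ Φ (jet Φ u z)) (fun z => coef₁₂ Φ (jet Φ u z))
    (fun z => coef₂₂ Φ (jet Φ u z)) u z = coefRhs Φ (jet Φ u z)

theorem eq_tan_add_conormal (p q : ℝ) (y : E3) :
    y = (Φ y).1.re • tanX Φ p + (Φ y).1.im • tanY Φ q + conormal Φ p q y • Φ.symm (0, 1) := by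
  apply Φ.injective
  simp only [tanX, tanY, conormal, map_add, map_smul, ContinuousLinearEquiv.apply_symm_apply]
  ext <;> simp
  ring

theorem tan_independent (p q a b : ℝ) (h : a • tanX Φ p + b • tanY Φ q = 0) : a = 0 ∧ b = 0 := by
  have h1 := congrArg Φ h
  simp only [tanX, tanY, map_add, map_smul, ContinuousLinearEquiv.apply_symm_apply, map_zero] at h1
  have h2 := congrArg Prod.fst h1
  constructor
  · have := congrArg Complex.re h2; simpa using this
  · have := congrArg Complex.im h2; simpa using this

/-- Ellipticity of the graph equation: the determinant is the Gram determinant of two independent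
tangent vectors. -/
theorem coef_det_pos {j : Jet} (hj : j.1 ∈ space) :
    0 < coef₁₁ Φ j * coef₂₂ Φ j - coef₁₂ Φ j ^ 2 := by
  have := metric_gram_pos hj (tan_independent Φ j.2.1 j.2.2)
  simp only [coef₁₁, coef₂₂, coef₁₂]
  linarith

theorem coef_trace_pos {j : Jet} (hj : j.1 ∈ space) : 0 < coef₁₁ Φ j + coef₂₂ Φ j := by
  have h := coef_det_pos Φ hj
  have h1 : 0 ≤ coef₁₁ Φ j := metric_self_nonneg hj _
  have h2 : 0 ≤ coef₂₂ Φ j := metric_self_nonneg hj _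
  rcases h1.eq_or_lt with h0 | h0
  · rw [← h0] at h; nlinarith [sq_nonneg (coef₁₂ Φ j)]
  · linarith

variable {n : WithTop ℕ∞} {j : Jet}

theorem contDiff_tanX : ContDiff ℝ n fun j : Jet => tanX Φ j.2.1 :=
  Φ.symm.contDiff.comp (contDiff_const.prodMk contDiff_snd.fst)

theorem contDiff_tanY : ContDiff ℝ n fun j : Jet => tanY Φ j.2.2 :=
  Φ.symm.contDiff.comp (contDiff_const.prodMk contDiff_snd.snd)

theorem contDiffAt_conormal {Y : Jet → E3} (hY : ContDiffAt ℝ n Y j) :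
    ContDiffAt ℝ n (fun j => conormal Φ j.2.1 j.2.2 (Y j)) j := by
  have h1 : ContDiffAt ℝ n (fun j => Φ (Y j)) j := Φ.contDiff.contDiffAt.comp j hY
  have h2 : ContDiffAt ℝ n (fun j => (Φ (Y j)).1.re) j := reCLM.contDiff.contDiffAt.comp j h1.fst
  have h3 : ContDiffAt ℝ n (fun j => (Φ (Y j)).1.im) j := imCLM.contDiff.contDiffAt.comp j h1.fst
  have h4 : ContDiff ℝ n fun j : Jet => j.2.1 := contDiff_snd.fst
  have h5 : ContDiff ℝ n fun j : Jet => j.2.2 := contDiff_snd.snd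
  exact (h1.snd.sub (h4.contDiffAt.mul h2)).sub (h5.contDiffAt.mul h3)

theorem contDiffAt_coef₁₁ (hj : j.1 ∈ space) : ContDiffAt ℝ n (coef₁₁ Φ) j :=
  contDiffAt_metric hj contDiffAt_fst (contDiff_tanY Φ).contDiffAt (contDiff_tanY Φ).contDiffAt

theorem contDiffAt_coef₁₂ (hj : j.1 ∈ space) : ContDiffAt ℝ n (coef₁₂ Φ) j :=
  (contDiffAt_metric hj contDiffAt_fst (contDiff_tanX Φ).contDiffAt
    (contDiff_tanY Φ).contDiffAt).neg

theorem contDiffAt_coef₂₂ (hj : j.1 ∈ space) : ContDiffAt ℝ n (coef₂₂ Φ) j :=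
  contDiffAt_metric hj contDiffAt_fst (contDiff_tanX Φ).contDiffAt (contDiff_tanX Φ).contDiffAt

theorem contDiffAt_coefRhs (hj : j.1 ∈ space) : ContDiffAt ℝ n (coefRhs Φ) j := by
  have a1 := contDiffAt_coef₁₁ (n := n) Φ hj
  have a2 := contDiffAt_coef₁₂ (n := n) Φ hj
  have a3 := contDiffAt_coef₂₂ (n := n) Φ hj
  have tX := (contDiff_tanX (n := n) Φ).contDiffAt (x := j)
  have tY := (contDiff_tanY (n := n) Φ).contDiffAt (x := j)
  have c1 := contDiffAt_conormal Φ (contDiffAt_christoffel hj contDiffAt_fst tX tX)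
  have c2 := contDiffAt_conormal Φ (contDiffAt_christoffel hj contDiffAt_fst tX tY)
  have c3 := contDiffAt_conormal Φ (contDiffAt_christoffel hj contDiffAt_fst tY tY)
  have c4 := contDiffAt_conormal (n := n) (j := j) Φ (contDiffAt_const (c := dz))
  unfold coefRhs
  fun_prop

end GraphCoefficients

end H2R

end

/-! ### The elliptic inequality for the difference of two solutions. -/

noncomputable section

namespace H2R

open Complex Metric

section Jets

variable (Φ : E3 ≃L[ℝ] ℂ × ℝ)

theorem contDiffAt_graphMap {u : ℂ → ℝ} {z : ℂ} {n : WithTop ℕ∞} (h : ContDiffAt ℝ n u z) :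
    ContDiffAt ℝ n (graphMap Φ u) z :=
  Φ.symm.contDiff.contDiffAt.comp z (contDiffAt_id.prodMk h)

theorem contDiffAt_jet {u : ℂ → ℝ} {z : ℂ} {m n : WithTop ℕ∞} (h : ContDiffAt ℝ n u z)
    (hmn : m + 1 ≤ n) : ContDiffAt ℝ m (jet Φ u) z :=
  (contDiffAt_graphMap Φ (h.of_le (le_self_add.trans hmn))).prodMk
    ((contDiffAt_dx h hmn).prodMk (contDiffAt_dy h hmn))

/-- A `C¹` function of the jet is locally Lipschitz, and the distance between the jets of `u₁` and
`u₂` is controlled by the first jet of their difference. The factor `A + 1` accounts for the base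
point, which is the image of `(z, u z)` under `Φ.symm`. -/
theorem exists_jet_lipschitz {u₁ u₂ : ℂ → ℝ} {c : ℂ} {a : Jet → ℝ} (h₁ : ContDiffAt ℝ 2 u₁ c)
    (h₂ : ContDiffAt ℝ 2 u₂ c) (hj : jet Φ u₁ c = jet Φ u₂ c)
    (ha : ContDiffAt ℝ 1 a (jet Φ u₁ c)) :
    ∃ L : ℝ, 0 ≤ L ∧ ∀ᶠ z in 𝓝 c, |a (jet Φ u₁ z) - a (jet Φ u₂ z)| ≤
      L * (|dx (fun z => u₁ z - u₂ z) z| + |dy (fun z => u₁ z - u₂ z) z| + |u₁ z - u₂ z|) := by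
  obtain ⟨K, t, ht, hlip⟩ := ha.exists_lipschitzOnWith
  set A := ‖(Φ.symm : ℂ × ℝ →L[ℝ] E3)‖ with hA
  refine ⟨K * (A + 1), by positivity, ?_⟩
  have t₁ : ∀ᶠ z in 𝓝 c, jet Φ u₁ z ∈ t :=
    (contDiffAt_jet (m := 1) Φ h₁ (by norm_num)).continuousAt.eventually ht
  have t₂ : ∀ᶠ z in 𝓝 c, jet Φ u₂ z ∈ t := by
    rw [hj] at ht
    exact (contDiffAt_jet (m := 1) Φ h₂ (by norm_num)).continuousAt.eventually ht
  filter_upwards [t₁, t₂, h₁.eventually (by simp), h₂.eventually (by simp)] with z z₁ z₂ d₁ d₂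
  have d₁' := d₁.differentiableAt (by norm_num)
  have d₂' := d₂.differentiableAt (by norm_num)
  rw [dx_sub d₁' d₂', dy_sub d₁' d₂']
  have h := hlip.dist_le_mul _ z₁ _ z₂
  rw [Real.dist_eq] at h
  refine h.trans ?_
  rw [mul_assoc]
  refine mul_le_mul_of_nonneg_left ?_ K.2
  have hA0 : 0 ≤ A := norm_nonneg _
  have x1 := abs_nonneg (dx u₁ z - dx u₂ z)
  have x2 := abs_nonneg (dy u₁ z - dy u₂ z)
  have x3 := abs_nonneg (u₁ z - u₂ z)
  have hg : dist (graphMap Φ u₁ z) (graphMap Φ u₂ z) ≤ A * |u₁ z - u₂ z| := by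
    rw [dist_eq_norm, graphMap, graphMap, ← map_sub]
    refine ((Φ.symm : ℂ × ℝ →L[ℝ] E3).le_opNorm _).trans (le_of_eq ?_)
    simp [hA, Prod.norm_def]
  rw [Prod.dist_eq, Prod.dist_eq]
  simp only [jet, Real.dist_eq]
  have y1 := mul_nonneg hA0 x1
  have y2 := mul_nonneg hA0 x2
  have y3 := mul_nonneg hA0 x3
  refine max_le (by linarith) (max_le (by linarith) (by linarith))

theorem eventually_abs_le {g : ℂ → ℝ} {c : ℂ} (h : ContinuousAt g c) :
    ∀ᶠ z in 𝓝 c, |g z| ≤ |g c| + 1 := by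
  have : ContinuousAt (fun z => |g z|) c := h.abs
  exact (this.eventually (gt_mem_nhds (lt_add_one _))).mono fun z hz => hz.le

/-- The difference of two solutions with the same jet at `c` satisfies an elliptic differential
inequality near `c`. -/
theorem exists_ellipticIneq {u₁ u₂ : ℂ → ℝ} {c : ℂ} (h₁ : ContDiffAt ℝ 2 u₁ c)
    (h₂ : ContDiffAt ℝ 2 u₂ c) (hj : jet Φ u₁ c = jet Φ u₂ c) (hs : graphMap Φ u₁ c ∈ space) :
    ∃ l Λ K : ℝ, 0 < l ∧ 0 ≤ K ∧ ∀ᶠ z in 𝓝 c, SolitonEq Φ u₁ z → SolitonEq Φ u₂ z →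
      EllipticIneq (fun z => coef₁₁ Φ (jet Φ u₁ z)) (fun z => coef₁₂ Φ (jet Φ u₁ z))
        (fun z => coef₂₂ Φ (jet Φ u₁ z)) (fun z => u₁ z - u₂ z) l Λ K z := by
  have hs' : (jet Φ u₁ c).1 ∈ space := hs
  have cj : ContinuousAt (jet Φ u₁) c :=
    (contDiffAt_jet (m := 1) Φ h₁ (by norm_num)).continuousAt
  have k₁₁ : ContinuousAt (fun z => coef₁₁ Φ (jet Φ u₁ z)) c :=
    (contDiffAt_coef₁₁ (n := 1) Φ hs').continuousAt.comp_of_eq cj rfl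
  have k₁₂ : ContinuousAt (fun z => coef₁₂ Φ (jet Φ u₁ z)) c :=
    (contDiffAt_coef₁₂ (n := 1) Φ hs').continuousAt.comp_of_eq cj rfl
  have k₂₂ : ContinuousAt (fun z => coef₂₂ Φ (jet Φ u₁ z)) c :=
    (contDiffAt_coef₂₂ (n := 1) Φ hs').continuousAt.comp_of_eq cj rfl
  set d := coef₁₁ Φ (jet Φ u₁ c) * coef₂₂ Φ (jet Φ u₁ c) - coef₁₂ Φ (jet Φ u₁ c) ^ 2 with hd
  set s := coef₁₁ Φ (jet Φ u₁ c) + coef₂₂ Φ (jet Φ u₁ c) with hsd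
  have hd0 : 0 < d := coef_det_pos Φ hs'
  have hs0 : 0 < s := coef_trace_pos Φ hs'
  have e1 : ∀ᶠ z in 𝓝 c, d / 2 < coef₁₁ Φ (jet Φ u₁ z) * coef₂₂ Φ (jet Φ u₁ z)
      - coef₁₂ Φ (jet Φ u₁ z) ^ 2 :=
    ((k₁₁.mul k₂₂).sub (k₁₂.pow 2)).eventually (lt_mem_nhds (show d / 2 < d by linarith))
  have e2 : ∀ᶠ z in 𝓝 c, coef₁₁ Φ (jet Φ u₁ z) + coef₂₂ Φ (jet Φ u₁ z) < 2 * s :=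
    (k₁₁.add k₂₂).eventually (gt_mem_nhds (show s < 2 * s by linarith))
  have e3 : ∀ᶠ z in 𝓝 c, 0 < coef₁₁ Φ (jet Φ u₁ z) + coef₂₂ Φ (jet Φ u₁ z) :=
    (k₁₁.add k₂₂).eventually (lt_mem_nhds hs0)
  obtain ⟨L₁, hL₁, l₁⟩ := exists_jet_lipschitz Φ h₁ h₂ hj (contDiffAt_coef₁₁ Φ hs')
  obtain ⟨L₂, hL₂, l₂⟩ := exists_jet_lipschitz Φ h₁ h₂ hj (contDiffAt_coef₁₂ Φ hs')
  obtain ⟨L₃, hL₃, l₃⟩ := exists_jet_lipschitz Φ h₁ h₂ hj (contDiffAt_coef₂₂ Φ hs')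
  obtain ⟨L₄, hL₄, l₄⟩ := exists_jet_lipschitz Φ h₁ h₂ hj (contDiffAt_coefRhs Φ hs')
  have hx := contDiffAt_dx (m := 1) h₂ (by norm_num)
  have hy := contDiffAt_dy (m := 1) h₂ (by norm_num)
  have b₁ := eventually_abs_le (contDiffAt_dx (m := 0) hx (by norm_num)).continuousAt
  have b₂ := eventually_abs_le (contDiffAt_dx (m := 0) hy (by norm_num)).continuousAt
  have b₃ := eventually_abs_le (contDiffAt_dy (m := 0) hy (by norm_num)).continuousAt
  set B₁ := |dx (dx u₂) c| + 1
  set B₂ := |dx (dy u₂) c| + 1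
  set B₃ := |dy (dy u₂) c| + 1
  -- Near `c` the determinant exceeds `d / 2` and the trace is below `2 s`. The smallest eigenvalue
  -- is at least their quotient, hence at least `d / (4 s)`.
  refine ⟨d / (4 * s), 2 * s, L₄ + L₁ * B₁ + 2 * (L₂ * B₂) + L₃ * B₃, by positivity,
    by positivity, ?_⟩
  filter_upwards [e1, e2, e3, l₁, l₂, l₃, l₄, b₁, b₂, b₃, h₁.eventually (by simp),
    h₂.eventually (by simp)] with z e1 e2 e3 l₁ l₂ l₃ l₄ b₁ b₂ b₃ d₁ d₂ s₁ s₂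
  unfold SolitonEq at s₁ s₂
  set a := coef₁₁ Φ (jet Φ u₁ z) with ha
  set b := coef₁₂ Φ (jet Φ u₁ z) with hb
  set g := coef₂₂ Φ (jet Φ u₁ z) with hg
  refine ⟨fun p q => ?_, e2.le, ?_⟩
  · simp only [← ha, ← hb, ← hg]
    -- Cayley-Hamilton: for the symmetric coefficient matrix, the trace times the form minus the
    -- determinant times `p² + q²` is the square norm of the image of `(p, q)`.
    have h1 : (a * g - b ^ 2) * (p ^ 2 + q ^ 2) ≤
        (a + g) * (a * p ^ 2 + 2 * b * (p * q) + g * q ^ 2) := by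
      nlinarith [sq_nonneg (a * p + b * q), sq_nonneg (b * p + g * q)]
    have h2 : d / 2 * (p ^ 2 + q ^ 2) ≤ (a * g - b ^ 2) * (p ^ 2 + q ^ 2) := by gcongr
    have h3 : 0 ≤ a * p ^ 2 + 2 * b * (p * q) + g * q ^ 2 := by
      have : 0 ≤ d / 2 * (p ^ 2 + q ^ 2) := by positivity
      exact nonneg_of_mul_nonneg_right (this.trans (h2.trans h1)) e3
    have h4 : (a + g) * (a * p ^ 2 + 2 * b * (p * q) + g * q ^ 2)
        ≤ 2 * s * (a * p ^ 2 + 2 * b * (p * q) + g * q ^ 2) := by gcongr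
    rw [div_mul_eq_mul_div, div_le_iff₀ (by positivity)]
    linarith
  · have hw : (fun z => u₁ z - u₂ z) = fun z => u₁ z - 1 * u₂ z := by simp
    set S := |dx (fun z => u₁ z - u₂ z) z| + |dy (fun z => u₁ z - u₂ z) z| + |u₁ z - u₂ z| with hS
    have hS0 : 0 ≤ S := by positivity
    -- The operator is frozen at `u₁`. What remains are differences of coefficients at the two jets,
    -- multiplied by second derivatives of `u₂`, which are bounded near `c`.
    have hsplit : secondOrder (fun z => coef₁₁ Φ (jet Φ u₁ z)) (fun z => coef₁₂ Φ (jet Φ u₁ z))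
        (fun z => coef₂₂ Φ (jet Φ u₁ z)) (fun z => u₁ z - u₂ z) z =
        (coefRhs Φ (jet Φ u₁ z) - coefRhs Φ (jet Φ u₂ z))
        + (-((a - coef₁₁ Φ (jet Φ u₂ z)) * dx (dx u₂) z)
          + (-(2 * ((b - coef₁₂ Φ (jet Φ u₂ z)) * dx (dy u₂) z))
          + -((g - coef₂₂ Φ (jet Φ u₂ z)) * dy (dy u₂) z))) := by
      rw [hw, secondOrder_sub_const_mul 1 d₁ d₂, s₁, ← s₂]
      simp only [secondOrder, ha, hb, hg]
      ring
    rw [hsplit]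
    have m₁ := mul_le_mul l₁ b₁ (abs_nonneg _) (by positivity)
    have m₂ := mul_le_mul l₂ b₂ (abs_nonneg _) (by positivity)
    have m₃ := mul_le_mul l₃ b₃ (abs_nonneg _) (by positivity)
    rw [← abs_mul] at m₁ m₂ m₃
    refine (abs_add_le _ _).trans ?_
    have n₁ := abs_add_le (-((a - coef₁₁ Φ (jet Φ u₂ z)) * dx (dx u₂) z))
      (-(2 * ((b - coef₁₂ Φ (jet Φ u₂ z)) * dx (dy u₂) z))
          + -((g - coef₂₂ Φ (jet Φ u₂ z)) * dy (dy u₂) z))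
    have n₂ := abs_add_le (-(2 * ((b - coef₁₂ Φ (jet Φ u₂ z)) * dx (dy u₂) z)))
      (-((g - coef₂₂ Φ (jet Φ u₂ z)) * dy (dy u₂) z))
    rw [abs_neg, abs_neg, abs_mul 2, abs_two] at n₂
    rw [abs_neg] at n₁
    linarith

end Jets

end H2R

end

/-! ### The equation satisfied by graphs that are translating solitons. -/

noncomputable section

namespace H2R

open Complex Metric

/-- The mean curvature does not depend on the frame. It is defined in the chart basis and is
computed here in the frame `tanX`, `tanY`. -/
theorem trace_inv_mul_congr (J G L : Matrix (Fin 2) (Fin 2) ℝ) (hJ : J.det ≠ 0) :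
    ((J * G * J.transpose)⁻¹ * (J * L * J.transpose)).trace = (G⁻¹ * L).trace := by
  have hJu : IsUnit J.det := hJ.isUnit
  have hJt : IsUnit J.transpose.det := by rwa [Matrix.det_transpose]
  rw [Matrix.mul_inv_rev, Matrix.mul_inv_rev, Matrix.trace_mul_comm]
  have : J * L * J.transpose * (J.transpose⁻¹ * (G⁻¹ * J⁻¹))
      = J * (L * G⁻¹ * J⁻¹) := by
    calc _ = J * L * (J.transpose * J.transpose⁻¹) * (G⁻¹ * J⁻¹) := by
          simp only [Matrix.mul_assoc]
      _ = _ := by rw [Matrix.mul_nonsing_inv _ hJt]; simp only [Matrix.mul_assoc, Matrix.mul_one]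
  rw [this, Matrix.trace_mul_comm, Matrix.mul_assoc, Matrix.nonsing_inv_mul _ hJu, Matrix.mul_one,
    Matrix.trace_mul_comm]

/-- Multiplying by the determinant replaces the inverse by the adjugate. -/
theorem trace_inv_mul_fin_two (G L : Matrix (Fin 2) (Fin 2) ℝ) (hG : G.det ≠ 0) :
    G.det * (G⁻¹ * L).trace = G 1 1 * L 0 0 - G 0 1 * L 1 0 - G 1 0 * L 0 1 + G 0 0 * L 1 1 := by
  rw [Matrix.inv_def, Matrix.adjugate_fin_two, Matrix.smul_mul, Matrix.trace_smul, smul_eq_mul,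
    ← mul_assoc, Ring.inverse_eq_inv', mul_inv_cancel₀ hG, one_mul, Matrix.trace_fin_two]
  simp [Matrix.mul_apply, Fin.sum_univ_two]
  ring

/-- The equation of a graph in terms of its fundamental forms: `N` is a unit normal with derivatives
`N₀`, `N₁`. -/
theorem coef_equation_of_trace {Φ : E3 ≃L[ℝ] ℂ × ℝ} {P N : E3} {p q uxx uxy uyy : ℝ}
    {D : Fin 2 → E3} (hP : P ∈ space) (hN : metric P N N = 1)
    (hX : metric P N (tanX Φ p) = 0) (hY : metric P N (tanY Φ q) = 0)
    (hXX : metric P (D 0 + christoffel P (tanX Φ p) N) (tanX Φ p)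
      + metric P N (uxx • Φ.symm (0, 1) + christoffel P (tanX Φ p) (tanX Φ p)) = 0)
    (hXY : metric P (D 0 + christoffel P (tanX Φ p) N) (tanY Φ q)
      + metric P N (uxy • Φ.symm (0, 1) + christoffel P (tanX Φ p) (tanY Φ q)) = 0)
    (hYX : metric P (D 1 + christoffel P (tanY Φ q) N) (tanX Φ p)
      + metric P N (uxy • Φ.symm (0, 1) + christoffel P (tanY Φ q) (tanX Φ p)) = 0)
    (hYY : metric P (D 1 + christoffel P (tanY Φ q) N) (tanY Φ q)
      + metric P N (uyy • Φ.symm (0, 1) + christoffel P (tanY Φ q) (tanY Φ q)) = 0)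
    {F : Fin 2 → E3} {E : Fin 2 → E3} {J : Matrix (Fin 2) (Fin 2) ℝ} (hJ : J.det ≠ 0)
    (hF : ∀ i, F i = J i 0 • tanX Φ p + J i 1 • tanY Φ q)
    (hE : ∀ i, E i = J i 0 • D 0 + J i 1 • D 1)
    (hH : (1 / 2) * ((Matrix.of fun i j => metric P (F i) (F j))⁻¹ *
      (Matrix.of fun i j => -metric P (E i + christoffel P (F i) N) (F j))).trace
        = metric P N dz) :
    coef₁₁ Φ (P, p, q) * uxx + 2 * coef₁₂ Φ (P, p, q) * uxy + coef₂₂ Φ (P, p, q) * uyy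
      = coefRhs Φ (P, p, q) := by
  set T : Fin 2 → E3 := ![tanX Φ p, tanY Φ q] with hT
  set G : Matrix (Fin 2) (Fin 2) ℝ := Matrix.of fun i j => metric P (T i) (T j) with hG
  set L : Matrix (Fin 2) (Fin 2) ℝ :=
    Matrix.of fun i j => -metric P (D i + christoffel P (T i) N) (T j) with hL
  have hI : (Matrix.of fun i j => metric P (F i) (F j)) = J * G * J.transpose := by
    ext i j
    simp only [Matrix.of_apply, Matrix.mul_apply, Fin.sum_univ_two, Matrix.transpose_apply, hF, hG,
      hT, Matrix.cons_val_zero, Matrix.cons_val_one, metric_add_left, metric_add_right,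
      metric_smul_left, metric_smul_right]
    ring
  have hII : (Matrix.of fun i j => -metric P (E i + christoffel P (F i) N) (F j))
      = J * L * J.transpose := by
    ext i j
    simp only [Matrix.of_apply, Matrix.mul_apply, Fin.sum_univ_two, Matrix.transpose_apply, hF, hE,
      hL, hT, Matrix.cons_val_zero, Matrix.cons_val_one, metric_add_left, metric_add_right,
      metric_smul_left, metric_smul_right, christoffel_add_left, christoffel_smul_left]
    ring
  have hdet : G.det = coef₁₁ Φ (P, p, q) * coef₂₂ Φ (P, p, q) - coef₁₂ Φ (P, p, q) ^ 2 := by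
    rw [Matrix.det_fin_two]
    simp only [hG, hT, Matrix.of_apply, Matrix.cons_val_zero, Matrix.cons_val_one, coef₁₁, coef₁₂,
      coef₂₂, metric_comm P (tanY Φ q) (tanX Φ p)]
    ring
  have hdet0 : G.det ≠ 0 := by rw [hdet]; exact (coef_det_pos Φ (j := (P, p, q)) hP).ne'
  rw [hI, hII, trace_inv_mul_congr _ _ _ hJ] at hH
  have htr := trace_inv_mul_fin_two G L hdet0
  set μ := metric P N (Φ.symm (0, 1)) with hμ
  -- Pairing with the normal is `μ` times an explicit covector. Both sides of the equation carry the
  -- factor `μ ≠ 0`, which cancels, so the normalization of `N` disappears.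
  have hcov : ∀ y, metric P N y = μ * conormal Φ p q y := fun y => by
    conv_lhs => rw [eq_tan_add_conormal Φ p q y]
    rw [metric_add_right, metric_add_right, metric_smul_right, metric_smul_right,
      metric_smul_right, hX, hY]
    ring
  have hμ0 : μ ≠ 0 := fun h => by
    rw [hcov N, h] at hN; simp at hN
  have l00 : L 0 0 = μ * (uxx + conormal Φ p q (christoffel P (tanX Φ p) (tanX Φ p))) := by
    rw [metric_add_right, metric_smul_right, hcov (christoffel _ _ _)] at hXX
    simp only [hL, hT, Matrix.of_apply, Matrix.cons_val_zero]
    linarith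
  have l01 : L 0 1 = μ * (uxy + conormal Φ p q (christoffel P (tanX Φ p) (tanY Φ q))) := by
    rw [metric_add_right, metric_smul_right, hcov (christoffel _ _ _)] at hXY
    simp only [hL, hT, Matrix.of_apply, Matrix.cons_val_zero, Matrix.cons_val_one]
    linarith
  have l10 : L 1 0 = μ * (uxy + conormal Φ p q (christoffel P (tanX Φ p) (tanY Φ q))) := by
    rw [metric_add_right, metric_smul_right, hcov (christoffel _ _ _),
      christoffel_symm P (tanY Φ q) (tanX Φ p)] at hYX
    simp only [hL, hT, Matrix.of_apply, Matrix.cons_val_zero, Matrix.cons_val_one]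
    linarith
  have l11 : L 1 1 = μ * (uyy + conormal Φ p q (christoffel P (tanY Φ q) (tanY Φ q))) := by
    rw [metric_add_right, metric_smul_right, hcov (christoffel _ _ _)] at hYY
    have : L 1 1 = -metric P (D 1 + christoffel P (tanY Φ q) N) (tanY Φ q) := rfl
    linarith
  have g00 : G 0 0 = coef₂₂ Φ (P, p, q) := by simp [hG, hT, coef₂₂]
  have g01 : G 0 1 = -coef₁₂ Φ (P, p, q) := by simp [hG, hT, coef₁₂]
  have g10 : G 1 0 = -coef₁₂ Φ (P, p, q) := by
    simp [hG, hT, coef₁₂, metric_comm P (tanY Φ q) (tanX Φ p)]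
  have g11 : G 1 1 = coef₁₁ Φ (P, p, q) := by simp [hG, hT, coef₁₁]
  have htr2 : (G⁻¹ * L).trace = 2 * (μ * conormal Φ p q dz) := by
    rw [hcov dz] at hH; linarith
  rw [htr2, l00, l01, l10, l11, g00, g01, g10, g11, hdet] at htr
  have hfin : μ * (coef₁₁ Φ (P, p, q) * uxx + 2 * coef₁₂ Φ (P, p, q) * uxy
      + coef₂₂ Φ (P, p, q) * uyy) = μ * coefRhs Φ (P, p, q) := by
    unfold coefRhs
    linear_combination -htr
  exact mul_left_cancel₀ hμ0 hfin

section PDE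

variable {M : Type*} [TopologicalSpace M] [ChartedSpace (EuclideanHalfSpace 2) M]
  {Φ : E3 ≃L[ℝ] ℂ × ℝ} {f : M → E3} {u : ℂ → ℝ}

/-- The projection to the plane along the direction of the graphs. -/
def proj (Φ : E3 ≃L[ℝ] ℂ × ℝ) (y : E3) : ℂ := (Φ y).1

theorem hasFDerivAt_proj (y : E3) :
    HasFDerivAt (proj Φ) ((ContinuousLinearMap.fst ℝ ℂ ℝ).comp (Φ : E3 →L[ℝ] ℂ × ℝ)) y :=
  ((ContinuousLinearMap.fst ℝ ℂ ℝ).comp (Φ : E3 →L[ℝ] ℂ × ℝ)).hasFDerivAt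

/-- The differential of a map that factors through the projection of an immersion. -/
theorem diff_eq_of_eventuallyEq {g : M → E3} {h : ℂ → E3} {y : M} {h' : ℂ →L[ℝ] E3}
    (hf : MDifferentiableAt (𝓡∂ 2) 𝓘(ℝ, E3) f y)
    (hg : g =ᶠ[𝓝 y] fun y => h (proj Φ (f y))) (hh : HasFDerivAt h h' (proj Φ (f y)))
    (ξ : EuclideanSpace ℝ (Fin 2)) : diff g y ξ = h' (Φ (diff f y ξ)).1 := by
  have h1 : HasMFDerivAt 𝓘(ℝ, E3) 𝓘(ℝ, E3) (fun p => h (proj Φ p)) (f y)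
      (h'.comp ((ContinuousLinearMap.fst ℝ ℂ ℝ).comp (Φ : E3 →L[ℝ] ℂ × ℝ))) :=
    (hh.comp (f y) (hasFDerivAt_proj (f y))).hasMFDerivAt
  have h2 := (h1.comp y hf.hasMFDerivAt).congr_of_eventuallyEq hg
  have h3 : diff g y = _ := h2.mfderiv
  rw [h3]
  rfl

theorem fderiv_graphMap {z : ℂ} (hu : DifferentiableAt ℝ u z) :
    HasFDerivAt (graphMap Φ u) ((Φ.symm : ℂ × ℝ →L[ℝ] E3).comp
      ((ContinuousLinearMap.id ℝ ℂ).prod (fderiv ℝ u z))) z :=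
  (Φ.symm : ℂ × ℝ →L[ℝ] E3).hasFDerivAt.comp z ((hasFDerivAt_id z).prodMk hu.hasFDerivAt)

theorem symm_eq_tan (z ζ : ℂ) :
    Φ.symm (ζ, fderiv ℝ u z ζ) = ζ.re • tanX Φ (dx u z) + ζ.im • tanY Φ (dy u z) := by
  apply Φ.injective
  simp only [tanX, tanY, map_add, map_smul, ContinuousLinearEquiv.apply_symm_apply]
  rw [fderiv_apply_eq]
  ext <;> simp

theorem diff_graph {y : M} (hf : MDifferentiableAt (𝓡∂ 2) 𝓘(ℝ, E3) f y)
    (hg : f =ᶠ[𝓝 y] fun y => graphMap Φ u (proj Φ (f y)))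
    (hu : DifferentiableAt ℝ u (proj Φ (f y))) (ξ : EuclideanSpace ℝ (Fin 2)) :
    diff f y ξ = Φ.symm ((Φ (diff f y ξ)).1, fderiv ℝ u (proj Φ (f y)) (Φ (diff f y ξ)).1) :=
  diff_eq_of_eventuallyEq hf hg (fderiv_graphMap hu) ξ

/-- A tangent vector of a graph is determined by its projection, so the projected differential is
injective, hence bijective by dimension. -/
theorem surjective_proj_diff {y : M} (hf : MDifferentiableAt (𝓡∂ 2) 𝓘(ℝ, E3) f y)
    (hi : Function.Injective (diff f y)) (hg : f =ᶠ[𝓝 y] fun y => graphMap Φ u (proj Φ (f y)))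
    (hu : DifferentiableAt ℝ u (proj Φ (f y))) (ζ : ℂ) :
    ∃ ξ : EuclideanSpace ℝ (Fin 2), (Φ (diff f y ξ)).1 = ζ := by
  set Jl : EuclideanSpace ℝ (Fin 2) →ₗ[ℝ] ℂ := ((ContinuousLinearMap.fst ℝ ℂ ℝ).comp
    ((Φ : E3 →L[ℝ] ℂ × ℝ).comp (diff f y))).toLinearMap with hJl
  have hinj : Function.Injective Jl := by
    rw [← LinearMap.ker_eq_bot, LinearMap.ker_eq_bot']
    intro ξ hξ
    have h1 : (Φ (diff f y ξ)).1 = 0 := hξ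
    have h2 := diff_graph hf hg hu ξ
    rw [h1] at h2
    apply hi
    rw [h2]; simp
  have hsurj := (LinearMap.injective_iff_surjective_of_finrank_eq_finrank (f := Jl)
    (by simp)).1 hinj
  exact hsurj ζ

/-- A surface that is a graph near `x` and a translating soliton satisfies the equation of graphs;
`σ` is a local parametrization of the surface. -/
theorem solitonEq_of_graph {η : M → E3} (h : IsTranslatingSoliton f η) {x : M} {σ : ℂ → M}
    (hu : ContDiffAt ℝ 2 u (proj Φ (f x)))
    (hf : ∀ᶠ y in 𝓝 x, f y = graphMap Φ u (proj Φ (f y)))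
    (hσ : MDifferentiableAt 𝓘(ℝ, ℂ) (𝓡∂ 2) σ (proj Φ (f x)))
    (hσψ : ∀ᶠ y in 𝓝 x, σ (proj Φ (f y)) = y)
    (hmap : Filter.map (fun y => proj Φ (f y)) (𝓝 x) = 𝓝 (proj Φ (f x))) :
    SolitonEq Φ u (proj Φ (f x)) := by
  set z := proj Φ (f x) with hz
  have hfd : MDifferentiable (𝓡∂ 2) 𝓘(ℝ, E3) f := h.smooth.mdifferentiable (by simp)
  have hηd : MDifferentiable (𝓡∂ 2) 𝓘(ℝ, E3) η := h.normal_smooth.mdifferentiable (by simp)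
  set N : ℂ → E3 := fun z => η (σ z) with hN
  have hσx : σ z = x := hσψ.self_of_nhds
  have hNd : DifferentiableAt ℝ N z := by
    have : MDifferentiableAt 𝓘(ℝ, ℂ) 𝓘(ℝ, E3) N z := (hηd (σ z)).comp z hσ
    exact this.differentiableAt
  have hηN : ∀ᶠ y in 𝓝 x, η y = N (proj Φ (f y)) := by
    filter_upwards [hσψ] with y hy
    simp only [hN]; rw [hy]
  have huev : ∀ᶠ y in 𝓝 x, DifferentiableAt ℝ u (proj Φ (f y)) := by
    have h1 : ∀ᶠ w in 𝓝 z, DifferentiableAt ℝ u w :=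
      (hu.eventually (by simp)).mono fun w hw => hw.differentiableAt (by norm_num)
    rw [← hmap] at h1
    exact h1
  -- The orthogonality relations hold on the surface, and `hmap` transports them to a full
  -- neighbourhood in the plane, where they can be differentiated.
  have horth : ∀ᶠ w in 𝓝 z, metric (graphMap Φ u w) (N w) (tanX Φ (dx u w)) = 0 ∧
      metric (graphMap Φ u w) (N w) (tanY Φ (dy u w)) = 0 := by
    rw [← hmap, Filter.eventually_map]
    filter_upwards [hf, hf.eventually_nhds, huev, hηN] with y h1 h2 h3 h4
    rw [← h1, ← h4]
    have hall : ∀ ζ : ℂ, metric (f y) (η y) (Φ.symm (ζ, fderiv ℝ u (proj Φ (f y)) ζ)) = 0 := by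
      intro ζ
      obtain ⟨ξ, hξ⟩ := surjective_proj_diff (hfd y) (h.immersion y) h2 h3 ζ
      rw [← hξ, ← diff_graph (hfd y) h2 h3]
      exact h.normal_orthogonal y ξ
    exact ⟨hall 1, hall I⟩
  have hX0 : graphMap Φ u z = f x := hf.self_of_nhds.symm
  have hN0 : N z = η x := by simp only [hN]; rw [hσx]
  have hsp : graphMap Φ u z ∈ space := by rw [hX0]; exact h.mem_space x
  have hud := hu.differentiableAt (by norm_num)
  have hdx := (contDiffAt_dx (m := 1) hu (by norm_num)).differentiableAt (by norm_num)
  have hdy := (contDiffAt_dy (m := 1) hu (by norm_num)).differentiableAt (by norm_num)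
  -- differentiation of the orthogonality relations in a direction `e`
  have hline : ∀ e : ℂ, HasDerivAt (fun t : ℝ => z + t • e) e 0 := fun e => by
    simpa only [one_smul] using! ((hasDerivAt_id (0 : ℝ)).smul_const e).const_add z
  have hl0 : ∀ e : ℂ, z + (0 : ℝ) • e = z := fun e => by simp
  have hcomp : ∀ {G : Type} [NormedAddCommGroup G] [NormedSpace ℝ G] {g : ℂ → G}
      {g' : ℂ →L[ℝ] G} (e : ℂ), HasFDerivAt g g' z →
      HasDerivAt (fun t : ℝ => g (z + t • e)) (g' e) 0 := fun {G} _ _ {g} {g'} e hg => by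
    have hg' : HasFDerivAt g g' (z + (0 : ℝ) • e) := by rwa [hl0]
    exact hg'.comp_hasDerivAt (0 : ℝ) (hline e)
  have hev : ∀ (e : ℂ) {p : ℂ → Prop}, (∀ᶠ w in 𝓝 z, p w) → ∀ᶠ t in 𝓝 (0 : ℝ), p (z + t • e) :=
    fun e p hp => by
      have : Filter.Tendsto (fun t : ℝ => z + t • e) (𝓝 0) (𝓝 z) := by
        have := (hline e).continuousAt.tendsto
        rwa [hl0] at this
      exact this.eventually hp
  have htX : HasFDerivAt (fun w => tanX Φ (dx u w))
      ((Φ.symm : ℂ × ℝ →L[ℝ] E3).comp ((0 : ℂ →L[ℝ] ℂ).prod (fderiv ℝ (dx u) z))) z :=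
    (Φ.symm : ℂ × ℝ →L[ℝ] E3).hasFDerivAt.comp z
      ((hasFDerivAt_const (1 : ℂ) z).prodMk hdx.hasFDerivAt)
  have htY : HasFDerivAt (fun w => tanY Φ (dy u w))
      ((Φ.symm : ℂ × ℝ →L[ℝ] E3).comp ((0 : ℂ →L[ℝ] ℂ).prod (fderiv ℝ (dy u) z))) z :=
    (Φ.symm : ℂ × ℝ →L[ℝ] E3).hasFDerivAt.comp z
      ((hasFDerivAt_const I z).prodMk hdy.hasFDerivAt)
  have hrel : ∀ e : ℂ,
      metric (f x) (fderiv ℝ N z e + christoffel (f x) (Φ.symm (e, fderiv ℝ u z e)) (η x))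
          (tanX Φ (dx u z))
        + metric (f x) (η x) (fderiv ℝ (dx u) z e • Φ.symm (0, 1)
          + christoffel (f x) (Φ.symm (e, fderiv ℝ u z e)) (tanX Φ (dx u z))) = 0 ∧
      metric (f x) (fderiv ℝ N z e + christoffel (f x) (Φ.symm (e, fderiv ℝ u z e)) (η x))
          (tanY Φ (dy u z))
        + metric (f x) (η x) (fderiv ℝ (dy u) z e • Φ.symm (0, 1)
          + christoffel (f x) (Φ.symm (e, fderiv ℝ u z e)) (tanY Φ (dy u z))) = 0 := by
    intro e
    have hV : ∀ t : ℝ, t • Φ.symm ((0 : ℂ), (1 : ℝ)) = Φ.symm (0, t) := fun t => by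
      rw [← map_smul]; simp
    have hsp0 : graphMap Φ u (z + (0 : ℝ) • e) ∈ space := by rwa [hl0]
    have d1 := hasDerivAt_metric hsp0 (hcomp e (fderiv_graphMap hud))
      (hcomp e hNd.hasFDerivAt) (hcomp e htX)
    have d2 := hasDerivAt_metric hsp0 (hcomp e (fderiv_graphMap hud))
      (hcomp e hNd.hasFDerivAt) (hcomp e htY)
    have z1 := d1.unique ((hasDerivAt_const (0 : ℝ) (0 : ℝ)).congr_of_eventuallyEq
      ((hev e horth).mono fun t ht => ht.1))
    have z2 := d2.unique ((hasDerivAt_const (0 : ℝ) (0 : ℝ)).congr_of_eventuallyEq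
      ((hev e horth).mono fun t ht => ht.2))
    rw [hl0, hX0, hN0] at z1 z2
    rw [hV, hV]
    exact ⟨z1, z2⟩
  have ht1 : Φ.symm ((1 : ℂ), fderiv ℝ u z 1) = tanX Φ (dx u z) := rfl
  have htI : Φ.symm (I, fderiv ℝ u z I) = tanY Φ (dy u z) := rfl
  obtain ⟨r1, r2⟩ := hrel 1
  obtain ⟨r3, r4⟩ := hrel I
  rw [ht1] at r1 r2
  rw [htI] at r3 r4
  set b : Fin 2 → EuclideanSpace ℝ (Fin 2) := fun i => EuclideanSpace.single i 1 with hb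
  -- The chart basis expressed in the frame `tanX`, `tanY`. It is invertible because `f` is an
  -- immersion.
  set J : Matrix (Fin 2) (Fin 2) ℝ := Matrix.of fun i j =>
    (![(Φ (diff f x (b i))).1.re, (Φ (diff f x (b i))).1.im] : Fin 2 → ℝ) j with hJ
  have hfx : f =ᶠ[𝓝 x] fun y => graphMap Φ u (proj Φ (f y)) := hf
  have hF : ∀ i, diff f x (b i) = J i 0 • tanX Φ (dx u z) + J i 1 • tanY Φ (dy u z) := fun i => by
    conv_lhs => rw [diff_graph (hfd x) hfx hud, symm_eq_tan]
    rfl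
  have hE : ∀ i, diff η x (b i) = J i 0 • fderiv ℝ N z 1 + J i 1 • fderiv ℝ N z I := fun i => by
    have hηN' : η =ᶠ[𝓝 x] fun y => N (proj Φ (f y)) := hηN
    rw [diff_eq_of_eventuallyEq (hfd x) hηN' hNd.hasFDerivAt]
    have : ∀ ζ : ℂ, fderiv ℝ N z ζ = ζ.re • fderiv ℝ N z 1 + ζ.im • fderiv ℝ N z I := fun ζ => by
      rw [← map_smul, ← map_smul, ← map_add]
      congr 1
      simp
    rw [this]
    rfl
  have hJ0 : J.det ≠ 0 := by
    intro h0
    obtain ⟨v, hv, hv0⟩ := Matrix.exists_vecMul_eq_zero_iff.2 h0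
    have h1 : diff f x (v 0 • b 0 + v 1 • b 1) = 0 := by
      rw [map_add, map_smul, map_smul, hF, hF]
      have a0 := congrFun hv0 0
      have a1 := congrFun hv0 1
      simp only [Matrix.vecMul, dotProduct, Fin.sum_univ_two, Pi.zero_apply] at a0 a1
      calc _ = (v 0 * J 0 0 + v 1 * J 1 0) • tanX Φ (dx u z)
            + (v 0 * J 0 1 + v 1 * J 1 1) • tanY Φ (dy u z) := by module
        _ = 0 := by rw [a0, a1]; simp
    have h2 : v 0 • b 0 + v 1 • b 1 = 0 := h.immersion x (by rw [h1, map_zero])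
    apply hv
    ext i
    have := congrArg (fun w : EuclideanSpace ℝ (Fin 2) => w i) h2
    fin_cases i <;> simpa [hb] using this
  have horth0 := horth.self_of_nhds
  rw [hX0, hN0] at horth0
  have hfin := coef_equation_of_trace (Φ := Φ) (P := f x) (N := η x) (D := ![fderiv ℝ N z 1,
    fderiv ℝ N z I]) (F := fun i => diff f x (b i)) (E := fun i => diff η x (b i)) (J := J)
    (p := dx u z) (q := dy u z) (uxx := dx (dx u) z) (uxy := dx (dy u) z) (uyy := dy (dy u) z)
    (h.mem_space x) (h.normal_unit x) horth0.1 horth0.2 r1 r2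
    (by rw [dx_dy_comm hu]; exact r3) r4 hJ0 hF hE (h.soliton x)
  unfold SolitonEq secondOrder
  simp only [jet, hX0]
  exact hfin

end PDE

end H2R

end

/-! ### Surfaces with boundary as local graphs. -/

noncomputable section

namespace H2R

open Complex Metric

section LocalGraph

variable {M : Type*} [TopologicalSpace M] [ChartedSpace (EuclideanHalfSpace 2) M]

/-- Near `x`, the surface `f` is the graph of `u` over `{ρ ≥ 0}`, with boundary over `{ρ = 0}`, and
it is parametrized by `σ`. -/
structure LocalGraph (n : WithTop ℕ∞) (Φ : E3 ≃L[ℝ] ℂ × ℝ) (f : M → E3) (x : M) (u ρ : ℂ → ℝ)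
    (σ : ℂ → M) : Prop where
  contDiffAt_u : ∀ᶠ z in 𝓝 (proj Φ (f x)), ContDiffAt ℝ n u z
  contDiffAt_ρ : ∀ᶠ z in 𝓝 (proj Φ (f x)), ContDiffAt ℝ n ρ z
  graph : ∀ᶠ y in 𝓝 x, f y = graphMap Φ u (proj Φ (f y))
  boundary_iff : ∀ᶠ y in 𝓝 x, y ∈ (𝓡∂ 2).boundary M ↔ ρ (proj Φ (f y)) = 0
  map_eq : ∀ᶠ y in 𝓝 x,
    Filter.map (fun y => proj Φ (f y)) (𝓝 y) = 𝓝[{z | 0 ≤ ρ z}] proj Φ (f y)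
  fderiv_ρ : ∀ ξ, fderiv ℝ ρ (proj Φ (f x)) (Φ (diff f x ξ)).1 = ξ 0
  left_inv : ∀ᶠ y in 𝓝 x, σ (proj Φ (f y)) = y
  contMDiffAt_σ : 0 < ρ (proj Φ (f x)) → ContMDiffAt 𝓘(ℝ, ℂ) (𝓡∂ 2) 1 σ (proj Φ (f x))
  soliton : ∀ᶠ z in 𝓝 (proj Φ (f x)), 0 < ρ z → SolitonEq Φ u z

theorem LocalGraph.of_le {n m : WithTop ℕ∞} {Φ : E3 ≃L[ℝ] ℂ × ℝ} {f : M → E3} {x : M}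
    {u ρ : ℂ → ℝ} {σ : ℂ → M} (h : LocalGraph n Φ f x u ρ σ) (hm : m ≤ n) :
    LocalGraph m Φ f x u ρ σ :=
  { h with
    contDiffAt_u := h.contDiffAt_u.mono fun _ hz => hz.of_le hm
    contDiffAt_ρ := h.contDiffAt_ρ.mono fun _ hz => hz.of_le hm }

theorem mem_range_halfSpace {w : EuclideanSpace ℝ (Fin 2)} : w ∈ Set.range (𝓡∂ 2) ↔ 0 ≤ w 0 := by
  rw [range_modelWithCornersEuclideanHalfSpace]; rfl

theorem range_halfSpace_mem_nhds {w : EuclideanSpace ℝ (Fin 2)} (h : 0 < w 0) :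
    Set.range (𝓡∂ 2) ∈ 𝓝 w := by
  have hc : Continuous fun w : EuclideanSpace ℝ (Fin 2) => w 0 := by fun_prop
  filter_upwards [hc.continuousAt.eventually (lt_mem_nhds h)] with y hy
  exact mem_range_halfSpace.2 (le_of_lt hy)

/-- Interior points can be recognized in any chart of the atlas, so one chart at `x` describes the
boundary at all points of its source, and not only at `x`. -/
theorem mem_boundary_iff [IsManifold (𝓡∂ 2) ∞ M] {x y : M} (hy : y ∈ (extChartAt (𝓡∂ 2) x).source) :
    y ∈ (𝓡∂ 2).boundary M ↔ extChartAt (𝓡∂ 2) x y 0 = 0 := by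
  have hy' : y ∈ (chartAt (EuclideanHalfSpace 2) x).source := by simpa using hy
  have h := ModelWithCorners.isInteriorPoint_iff_of_mem_atlas (I := 𝓡∂ 2) (n := ∞) (by simp)
    (chart_mem_atlas (EuclideanHalfSpace 2) x) hy'
  have h1 : (chartAt (EuclideanHalfSpace 2) x).extend (𝓡∂ 2) y ∈
      interior ((chartAt (EuclideanHalfSpace 2) x).extend (𝓡∂ 2)).target ↔
      extChartAt (𝓡∂ 2) x y ∈ interior (Set.range (𝓡∂ 2)) :=
    ⟨fun h => (chartAt (EuclideanHalfSpace 2) x).interior_extend_target_subset_interior_range h,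
      fun h => (chartAt (EuclideanHalfSpace 2) x).mem_interior_extend_target
        ((chartAt (EuclideanHalfSpace 2) x).map_source hy') h⟩
  rw [h1, interior_range_modelWithCornersEuclideanHalfSpace] at h
  have h0 : 0 ≤ extChartAt (𝓡∂ 2) x y 0 := mem_range_halfSpace.1 (Set.mem_range_self _)
  have h2 : y ∈ (𝓡∂ 2).boundary M ↔ ¬ 0 < extChartAt (𝓡∂ 2) x y 0 :=
    (ModelWithCorners.isBoundaryPoint_iff_not_isInteriorPoint y).trans (not_congr h)
  rw [h2, not_lt]
  exact ⟨fun h => le_antisymm h h0, le_of_eq⟩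

variable [IsManifold (𝓡∂ 2) ∞ M] {f η : M → E3}

/-- The planar component of `G` is a local diffeomorphism at the base point: a tangent vector that
projects to `0` is a multiple of the transverse direction and orthogonal to `η`, hence zero. If `θ`
is its inverse, `u` is the last component of `G ∘ θ`, `ρ` is the first coordinate of `θ`, that is,
the chart coordinate that defines the boundary, and `σ` is the inverse chart composed with `θ`. The
extension `G` provides the full neighbourhood that the inverse function theorem needs at a boundary
point. -/
theorem exists_localGraph_of_extension (h : IsTranslatingSoliton f η) (x : M)
    (Φ : E3 ≃L[ℝ] ℂ × ℝ) (hΦ : metric (f x) (η x) (Φ.symm (0, 1)) ≠ 0) {n : WithTop ℕ∞}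
    (hn : 2 ≤ n) {G : EuclideanSpace ℝ (Fin 2) → ℂ × ℝ}
    (hGev : ∀ᶠ w in 𝓝 (extChartAt (𝓡∂ 2) x x), ContDiffAt ℝ n G w)
    (hGf : ∀ w, 0 ≤ w 0 → G w = Φ (f ((extChartAt (𝓡∂ 2) x).symm w))) :
    ∃ u ρ σ, LocalGraph n Φ f x u ρ σ := by
  set e := extChartAt (𝓡∂ 2) x with he
  set a := e x with ha
  have hG := hGev.self_of_nhds
  have hn1 : (1 : WithTop ℕ∞) ≤ n := le_trans (by norm_num) hn
  have hn0 : n ≠ 0 := fun h0 => by rw [h0] at hn1; simp at hn1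
  have ha0 : 0 ≤ a 0 := mem_range_halfSpace.1 (Set.mem_range_self _)
  have hex : e.symm a = x := extChartAt_to_inv x
  have hfd : MDifferentiable (𝓡∂ 2) 𝓘(ℝ, E3) f := h.smooth.mdifferentiable (by simp)
  -- the differential
  have hGd : HasFDerivAt G (fderiv ℝ G a) a := (hG.differentiableAt hn0).hasFDerivAt
  have hdG : fderiv ℝ G a = (Φ : E3 →L[ℝ] ℂ × ℝ).comp (diff f x) := by
    have h1 : HasFDerivWithinAt (fun w => f (e.symm w)) (diff f x) (Set.range (𝓡∂ 2)) a :=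
      (hfd x).hasMFDerivAt.2
    have h2 := (Φ : E3 →L[ℝ] ℂ × ℝ).hasFDerivAt.comp_hasFDerivWithinAt a h1
    have h3 : HasFDerivWithinAt G ((Φ : E3 →L[ℝ] ℂ × ℝ).comp (diff f x)) (Set.range (𝓡∂ 2)) a :=
      h2.congr (fun w hw => hGf w (mem_range_halfSpace.1 hw)) (hGf a ha0)
    exact ((𝓡∂ 2).uniqueDiffOn a (Set.mem_range_self _)).eq hGd.hasFDerivWithinAt h3
  set A : EuclideanSpace ℝ (Fin 2) →L[ℝ] ℂ := (ContinuousLinearMap.fst ℝ ℂ ℝ).comp (fderiv ℝ G a)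
    with hA
  have hAx : ∀ ξ, A ξ = (Φ (diff f x ξ)).1 := fun ξ => by rw [hA, hdG]; rfl
  have hAinj : Function.Injective A.toLinearMap := by
    rw [← LinearMap.ker_eq_bot, LinearMap.ker_eq_bot']
    intro ξ hξ
    have h1 : (Φ (diff f x ξ)).1 = 0 := by rw [← hAx]; exact hξ
    have h2 : diff f x ξ = (Φ (diff f x ξ)).2 • Φ.symm (0, 1) := by
      apply Φ.injective
      rw [map_smul, Φ.apply_symm_apply]
      ext <;> simp [h1]
    have h3 := h.normal_orthogonal x ξ
    rw [h2, metric_smul_right] at h3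
    have h4 := (mul_eq_zero.1 h3).resolve_right hΦ
    rw [h4, zero_smul] at h2
    exact h.immersion x (by rw [h2, map_zero])
  set A' : EuclideanSpace ℝ (Fin 2) ≃L[ℝ] ℂ :=
    (LinearEquiv.ofInjectiveOfFinrankEq A.toLinearMap hAinj (by simp)).toContinuousLinearEquiv
    with hA'
  have hA'x : ∀ ξ, A' ξ = A ξ := fun ξ => rfl
  set g : EuclideanSpace ℝ (Fin 2) → ℂ := fun w => (G w).1 with hg
  have hgc : ContDiffAt ℝ n g a := hG.fst
  have hgd : HasFDerivAt g (A' : EuclideanSpace ℝ (Fin 2) →L[ℝ] ℂ) a := by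
    have : (A' : EuclideanSpace ℝ (Fin 2) →L[ℝ] ℂ) = A := by ext ξ; rfl
    rw [this]
    exact hGd.fst
  set H := hgc.toOpenPartialHomeomorph g hgd hn0 with hH
  have haH : a ∈ H.source := hgc.mem_toOpenPartialHomeomorph_source hgd hn0
  set θ := H.symm with hθ
  have hθa : θ (g a) = a := H.left_inv haH
  have hca : proj Φ (f x) = g a := by
    simp only [hg, proj]; rw [hGf a ha0, hex]
  have hθc : ContDiffAt ℝ n θ (g a) := hgc.to_localInverse hgd hn0
  have hθd : HasFDerivAt θ (A'.symm : ℂ →L[ℝ] EuclideanSpace ℝ (Fin 2)) (g a) := by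
    refine HasFDerivAt.of_local_left_inverse (f := g) (f' := A') (by exact hθc.continuousAt) ?_ ?_
    · rw [hθa]; exact hgd
    · filter_upwards [H.open_target.mem_nhds (H.map_source haH)] with z hz
      exact H.right_inv hz
  set u : ℂ → ℝ := fun z => (G (θ z)).2 with hu
  set ρ : ℂ → ℝ := fun z => θ z 0 with hρ
  set σ : ℂ → M := fun z => e.symm (θ z) with hσ
  have hθt : Filter.Tendsto θ (𝓝 (g a)) (𝓝 a) := by
    have := hθc.continuousAt.tendsto
    rwa [hθa] at this
  -- For `n = ∞` smoothness at one point does not spread to a neighbourhood. The inverse function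
  -- theorem is applied at each nearby point, where the derivative is still invertible.
  have hθev : ∀ᶠ z in 𝓝 (g a), ContDiffAt ℝ n θ z := by
    have h1 : ContinuousAt (fderiv ℝ g) a :=
      (hgc.fderiv_right (m := 0) (by simpa using hn1)).continuousAt
    have h2 : ∀ᶠ w in 𝓝 a, fderiv ℝ g w ∈ Set.range
        ((↑) : (EuclideanSpace ℝ (Fin 2) ≃L[ℝ] ℂ) → (EuclideanSpace ℝ (Fin 2) →L[ℝ] ℂ)) := by
      have h3 := ContinuousLinearEquiv.nhds A'
      rw [← hgd.fderiv] at h3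
      exact h1.eventually h3
    filter_upwards [hθt.eventually h2, hθt.eventually hGev,
      H.open_target.mem_nhds (H.map_source haH)] with z ⟨B, hB⟩ h3 h4
    refine H.contDiffAt_symm h4 (f₀' := B) ?_ h3.fst
    rw [hB]
    exact (h3.fst.differentiableAt hn0).hasFDerivAt
  have hcu : ∀ᶠ z in 𝓝 (g a), ContDiffAt ℝ n u z := by
    filter_upwards [hθt.eventually hGev, hθev] with z h1 h2
    exact (ContDiffAt.comp z h1 h2).snd
  have hcρ : ∀ᶠ z in 𝓝 (g a), ContDiffAt ℝ n ρ z :=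
    hθev.mono fun z hz => contDiffAt_euclidean.1 hz 0
  -- the projection in the chart
  have hproj : ∀ y ∈ e.source, proj Φ (f y) = g (e y) := fun y hy => by
    simp only [hg, proj]
    rw [hGf _ (mem_range_halfSpace.1 (extChartAt_target_subset_range x (e.map_source hy))),
      e.left_inv hy]
  have hsrc : ∀ᶠ y in 𝓝 x, y ∈ e.source := extChartAt_source_mem_nhds x
  have hec : ContinuousAt e x := continuousAt_extChartAt x
  have hHs : ∀ᶠ y in 𝓝 x, e y ∈ H.source := hec.eventually (H.open_source.mem_nhds haH)
  have hθψ : ∀ᶠ y in 𝓝 x, θ (proj Φ (f y)) = e y := by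
    filter_upwards [hsrc, hHs] with y h1 h2
    rw [hproj y h1]; exact H.left_inv h2
  have hgraph : ∀ᶠ y in 𝓝 x, f y = graphMap Φ u (proj Φ (f y)) := by
    filter_upwards [hsrc, hθψ] with y h1 h2
    apply Φ.injective
    simp only [graphMap, Φ.apply_symm_apply, hu]
    rw [h2, hGf _ (mem_range_halfSpace.1 (extChartAt_target_subset_range x (e.map_source h1))),
      e.left_inv h1]
    rfl
  have hleft : ∀ᶠ y in 𝓝 x, σ (proj Φ (f y)) = y := by
    filter_upwards [hsrc, hθψ] with y h1 h2
    simp only [hσ]; rw [h2, e.left_inv h1]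
  have hσm : ∀ z, ContDiffAt ℝ n θ z → θ z ∈ e.target → 0 < θ z 0 →
      ContMDiffAt 𝓘(ℝ, ℂ) (𝓡∂ 2) 1 σ z := fun z h1 h2 h3 => by
    have h4 : ContMDiffWithinAt 𝓘(ℝ, EuclideanSpace ℝ (Fin 2)) (𝓡∂ 2) 1 e.symm (Set.range (𝓡∂ 2))
        (θ z) := contMDiffWithinAt_extChartAt_symm_range x h2
    exact (h4.contMDiffAt (range_halfSpace_mem_nhds h3)).comp z (h1.of_le hn1).contMDiffAt
  refine ⟨u, ρ, σ, ⟨by rwa [hca], by rwa [hca], hgraph, ?_, ?_, ?_, hleft, ?_, ?_⟩⟩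
  · filter_upwards [hsrc, hθψ] with y h1 h2
    rw [mem_boundary_iff h1]
    simp only [hρ]; rw [h2]
  · filter_upwards [hsrc.eventually_nhds, hHs] with y hy hyH
    have h1 : Filter.map (fun y => proj Φ (f y)) (𝓝 y) = Filter.map g (Filter.map e (𝓝 y)) := by
      rw [Filter.map_map]
      exact Filter.map_congr (hy.mono hproj)
    rw [h1, map_extChartAt_nhds' hy.self_of_nhds, hproj y hy.self_of_nhds, ← he]
    have h2 := H.map_nhdsWithin_preimage_eq hyH {z | 0 ≤ ρ z}
    have h3 : 𝓝[H ⁻¹' {z | 0 ≤ ρ z}] (e y) = 𝓝[Set.range (𝓡∂ 2)] (e y) := by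
      apply nhdsWithin_eq_iff_eventuallyEq.2
      filter_upwards [H.open_source.mem_nhds hyH] with w hw
      apply propext
      have h4 : θ (H w) = w := H.left_inv hw
      change 0 ≤ θ (H w) 0 ↔ w ∈ Set.range (𝓡∂ 2)
      rw [h4, mem_range_halfSpace]
    rw [h3] at h2
    exact h2
  · intro ξ
    have h1 : HasFDerivAt ρ ((EuclideanSpace.proj (0 : Fin 2) : EuclideanSpace ℝ (Fin 2) →L[ℝ] ℝ).comp
        (A'.symm : ℂ →L[ℝ] EuclideanSpace ℝ (Fin 2))) (g a) :=
      (EuclideanSpace.proj (0 : Fin 2) : EuclideanSpace ℝ (Fin 2) →L[ℝ] ℝ).hasFDerivAt.comp (g a) hθd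
    rw [hca, h1.fderiv, ← hAx, ← hA'x]
    simp
  · rw [hca]
    intro hpos
    exact hσm _ hθc (by rw [hθa]; exact mem_extChartAt_target x) hpos
  -- Properties of points near `x` are read in the chart, within the half plane. A planar point `z`
  -- with `ρ z > 0` comes from an interior point `y` of the surface, at which `solitonEq_of_graph`
  -- applies.
  · have ev1 := (hleft.eventually_nhds.and (hgraph.eventually_nhds.and
      (hHs.and hsrc.eventually_nhds)))
    have ev2 := ev1
    rw [← map_extChartAt_symm_nhdsWithin_range (I := 𝓡∂ 2) x] at ev2
    have ev3 := eventually_nhdsWithin_iff.1 (Filter.eventually_map.1 ev2)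
    have ev4 : ∀ᶠ w in 𝓝[Set.range (𝓡∂ 2)] a, w ∈ e.target := extChartAt_target_mem_nhdsWithin x
    have ev5 := eventually_nhdsWithin_iff.1 ev4
    rw [hca]
    filter_upwards [hθt.eventually ev3, hθt.eventually ev5,
      hcu, hθev,
      H.open_target.mem_nhds (H.map_source haH)] with z h1 h2 h3 h4 h5 hpos
    have hr : θ z ∈ Set.range (𝓡∂ 2) := mem_range_halfSpace.2 (le_of_lt hpos)
    obtain ⟨l1, l2, l3, l4⟩ := h1 hr
    have ht := h2 hr
    set y := e.symm (θ z) with hy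
    have hey : e y = θ z := e.right_inv ht
    have hyz : proj Φ (f y) = z := by
      rw [hproj y l4.self_of_nhds, hey]
      exact H.right_inv h5
    have key := solitonEq_of_graph (Φ := Φ) (u := u) (σ := σ) h (x := y)
      (by rw [hyz]; exact h3.of_le hn) l2
      (by rw [hyz]; exact (hσm z h4 ht hpos).mdifferentiableAt (by simp)) l1 ?_
    · rwa [hyz] at key
    · have m1 : Filter.map (fun y => proj Φ (f y)) (𝓝 y) = Filter.map g (Filter.map e (𝓝 y)) := by
        rw [Filter.map_map]
        exact Filter.map_congr (l4.mono hproj)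
      rw [m1, hyz, map_extChartAt_nhds' l4.self_of_nhds, ← he, hey,
        nhdsWithin_eq_nhds.2 (range_halfSpace_mem_nhds hpos)]
      have m2 := H.map_nhds_eq (H.map_target h5)
      rw [H.right_inv h5] at m2
      exact m2

/-- At an interior point the chart expression needs no extension and is smooth, as unique
continuation requires. At a boundary point it is extended by reflection, and the class `C²` obtained
there is enough for Hopf's lemma. -/
theorem exists_localGraph (h : IsTranslatingSoliton f η) (x : M)
    (Φ : E3 ≃L[ℝ] ℂ × ℝ) (hΦ : metric (f x) (η x) (Φ.symm (0, 1)) ≠ 0) :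
    ∃ u ρ σ, LocalGraph 2 Φ f x u ρ σ ∧
      (x ∈ (𝓡∂ 2).interior M → LocalGraph ∞ Φ f x u ρ σ) := by
  have h2i : (2 : WithTop ℕ∞) ≤ ∞ := WithTop.coe_le_coe.2 (le_top : (2 : ℕ∞) ≤ ⊤)
  have hrange : Set.range (𝓡∂ 2) = {w : EuclideanSpace ℝ (Fin 2) | 0 ≤ w 0} := by
    ext w; exact mem_range_halfSpace
  have hG : ContDiffWithinAt ℝ ∞ (fun w => Φ (f ((extChartAt (𝓡∂ 2) x).symm w)))
      {w : EuclideanSpace ℝ (Fin 2) | 0 ≤ w 0} (extChartAt (𝓡∂ 2) x x) := by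
    have h1 := ((contMDiffAt_iff).1 (h.smooth x)).2
    rw [hrange] at h1
    exact Φ.contDiff.contDiffAt.comp_contDiffWithinAt _ h1
  have hbd := mem_boundary_iff (mem_extChartAt_source (I := 𝓡∂ 2) x)
  have h0 : 0 ≤ extChartAt (𝓡∂ 2) x x 0 := mem_range_halfSpace.1 (Set.mem_range_self _)
  by_cases hx : x ∈ (𝓡∂ 2).interior M
  · have hpos : 0 < extChartAt (𝓡∂ 2) x x 0 := by
      refine lt_of_le_of_ne h0 fun h => ?_
      exact Set.disjoint_left.1 ModelWithCorners.disjoint_interior_boundary hx (hbd.2 h.symm)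
    have hG' : ∀ᶠ w in 𝓝 (extChartAt (𝓡∂ 2) x x),
        ContDiffAt ℝ ∞ (fun w => Φ (f ((extChartAt (𝓡∂ 2) x).symm w))) w := by
      have hc : Continuous fun w : EuclideanSpace ℝ (Fin 2) => w 0 := by fun_prop
      have ht := extChartAt_target_mem_nhdsWithin (I := 𝓡∂ 2) x
      rw [nhdsWithin_eq_nhds.2 (range_halfSpace_mem_nhds hpos)] at ht
      filter_upwards [hc.continuousAt.eventually (lt_mem_nhds hpos), ht] with w hw hw'
      have h1 : ContMDiffAt 𝓘(ℝ, EuclideanSpace ℝ (Fin 2)) (𝓡∂ 2) ∞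
          (extChartAt (𝓡∂ 2) x).symm w :=
        (contMDiffWithinAt_extChartAt_symm_range x hw').contMDiffAt (range_halfSpace_mem_nhds hw)
      have h2 : ContMDiffAt 𝓘(ℝ, EuclideanSpace ℝ (Fin 2)) 𝓘(ℝ, E3) ∞
          (fun w => f ((extChartAt (𝓡∂ 2) x).symm w)) w := (h.smooth _).comp w h1
      exact Φ.contDiff.contDiffAt.comp w h2.contDiffAt
    obtain ⟨u, ρ, σ, hl⟩ := exists_localGraph_of_extension h x Φ hΦ h2i hG'
      fun w _ => rfl
    exact ⟨u, ρ, σ, hl.of_le h2i, fun _ => hl⟩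
  · have hz : extChartAt (𝓡∂ 2) x x 0 = 0 := hbd.1 (by
      rw [← ModelWithCorners.compl_interior]; exact hx)
    obtain ⟨G, hG1, hG2⟩ := exists_contDiffAt_extension
      (φ := (EuclideanSpace.proj (0 : Fin 2) : EuclideanSpace ℝ (Fin 2) →L[ℝ] ℝ))
      (u := EuclideanSpace.single 0 1) hz (by simp) (hG.of_le h2i)
    obtain ⟨u, ρ, σ, hl⟩ := exists_localGraph_of_extension h x Φ hΦ le_rfl
      (hG1.eventually (by decide)) hG2
    exact ⟨u, ρ, σ, hl, fun h => absurd h hx⟩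

end LocalGraph

end H2R

end

/-! ### Cones at the boundary and comparison of domains. -/

noncomputable section

namespace H2R

open Complex Metric

/-- A function whose derivative is positive in the direction `e` increases in a cone around `e`. -/
theorem exists_cone {ρ : ℂ → ℝ} {R : ℂ →L[ℝ] ℝ} {c e : ℂ} (hρ : HasStrictFDerivAt ρ R c)
    (he : 0 < R e) : ∃ δ > 0, ∃ m > 0, ∀ᶠ q in 𝓝 (c, c), ∀ r : ℝ, 0 ≤ r →
      ‖q.2 - q.1 - r • e‖ ≤ δ * r → ρ q.1 + m * r ≤ ρ q.2 := by
  set k := R e with hk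
  have hR := norm_nonneg R
  -- `δ` and the `ε` below are chosen so that the deviation from `r • e` and the remainder of the
  -- strict derivative each cost at most `k r / 4` of the gain `k r`. At least `k r / 2` remains.
  set δ := k / (4 * (‖R‖ + 1)) with hδ
  have hδ0 : 0 < δ := by positivity
  have hRδ : ‖R‖ * δ ≤ k / 4 := by
    rw [hδ, ← mul_div_assoc, div_le_div_iff₀ (by positivity) (by norm_num)]
    nlinarith
  set ε := k / (4 * (‖e‖ + δ)) with hε
  have hε0 : 0 < ε := by positivity
  have hεδ : ε * (‖e‖ + δ) = k / 4 := by
    rw [hε]; field_simp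
  refine ⟨δ, hδ0, k / 2, by positivity, ?_⟩
  filter_upwards [hρ.isLittleO.bound hε0] with q hq r hr hqr
  set w := q.2 - q.1 - r • e with hw
  have e1 : q.1 - q.2 = -(w + r • e) := by rw [hw]; ring
  have n1 : ‖q.1 - q.2‖ ≤ (‖e‖ + δ) * r := by
    rw [e1, norm_neg]
    calc _ ≤ ‖w‖ + ‖r • e‖ := norm_add_le _ _
      _ = ‖w‖ + r * ‖e‖ := by rw [norm_smul, Real.norm_of_nonneg hr]
      _ ≤ _ := by linarith
  have n2 : ‖R w‖ ≤ k / 4 * r := by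
    calc ‖R w‖ ≤ ‖R‖ * ‖w‖ := R.le_opNorm w
      _ ≤ ‖R‖ * (δ * r) := by gcongr
      _ = ‖R‖ * δ * r := by ring
      _ ≤ _ := by gcongr
  have n3 : ‖ρ q.1 - ρ q.2 - R (q.1 - q.2)‖ ≤ k / 4 * r := by
    calc _ ≤ ε * ‖q.1 - q.2‖ := hq
      _ ≤ ε * ((‖e‖ + δ) * r) := by gcongr
      _ = ε * (‖e‖ + δ) * r := by ring
      _ = _ := by rw [hεδ]
  rw [e1, map_neg, map_add, map_smul, smul_eq_mul, ← hk] at n3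
  rw [Real.norm_eq_abs, abs_le] at n2 n3
  nlinarith [n2.1, n3.2]

/-- The cone condition, for a function that is either positive at the centre or increasing in the
direction `e`. -/
theorem exists_cone_nonneg {ρ : ℂ → ℝ} {R : ℂ →L[ℝ] ℝ} {c e : ℂ} (hρ : HasStrictFDerivAt ρ R c)
    (he : 0 < ρ c ∨ 0 < R e) : ∃ δ > 0, ∀ᶠ q in 𝓝 (c, c), ∀ r : ℝ, 0 ≤ r →
      ‖q.2 - q.1 - r • e‖ ≤ δ * r → 0 ≤ ρ q.1 → 0 ≤ ρ q.2 := by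
  rcases he with he | he
  · refine ⟨1, one_pos, ?_⟩
    have h : ∀ᶠ z in 𝓝 c, 0 ≤ ρ z :=
      (hρ.hasFDerivAt.continuousAt.eventually (lt_mem_nhds he)).mono fun z hz => le_of_lt hz
    have h2 : ∀ᶠ q in 𝓝 (c, c), 0 ≤ ρ q.2 := (continuous_snd.tendsto (c, c)).eventually h
    filter_upwards [h2] with q hq r _ _ _ using hq
  · obtain ⟨δ, hδ, m, hm, h⟩ := exists_cone hρ he
    refine ⟨δ, hδ, ?_⟩
    filter_upwards [h] with q hq r hr h1 h2
    have := hq r hr h1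
    have := mul_nonneg hm.le hr
    linarith

/-- Two functions with the same derivative at `c`, that agree on the common domain, are close at
different points of their domains. -/
theorem eventually_sub_le_of_agree {u₁ u₂ ρ₁ ρ₂ : ℂ → ℝ} {D R₁ R₂ : ℂ →L[ℝ] ℝ} {c e : ℂ}
    (hu₁ : HasStrictFDerivAt u₁ D c) (hu₂ : HasStrictFDerivAt u₂ D c)
    (hρ₁ : HasStrictFDerivAt ρ₁ R₁ c) (hρ₂ : HasStrictFDerivAt ρ₂ R₂ c)
    (he₁ : 0 < ρ₁ c ∨ 0 < R₁ e) (he₂ : 0 < ρ₂ c ∨ 0 < R₂ e)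
    (heq : ∀ᶠ z in 𝓝 c, 0 ≤ ρ₁ z → 0 ≤ ρ₂ z → u₁ z = u₂ z) {ε : ℝ} (hε : 0 < ε) :
    ∀ᶠ q in 𝓝 (c, c), 0 ≤ ρ₁ q.1 → 0 ≤ ρ₂ q.2 →
      |u₁ q.1 - u₂ q.2 - D (q.1 - q.2)| ≤ ε * ‖q.1 - q.2‖ := by
  obtain ⟨δ₁, hδ₁, h1⟩ := exists_cone_nonneg hρ₁ he₁
  obtain ⟨δ₂, hδ₂, h2⟩ := exists_cone_nonneg hρ₂ he₂
  set C := 1 / δ₁ with hC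
  have hC0 : 0 < C := by positivity
  set ε' := ε / (1 + 2 * C * ‖e‖) with hε'
  have hε'0 : 0 < ε' := by positivity
  -- A point of both domains, reached from `q.1` and `q.2` inside their cones: `C = 1 / δ₁` makes
  -- the displacement just long enough for `q.1`. There `u₁` and `u₂` agree, and strict
  -- differentiability carries the comparison back to `q.1` and `q.2`.
  set z₃ : ℂ × ℂ → ℂ := fun q => q.2 + (C * ‖q.1 - q.2‖) • e with hz₃
  have hz₃t : Filter.Tendsto z₃ (𝓝 (c, c)) (𝓝 c) := by
    have : Continuous z₃ := by fun_prop
    have := this.tendsto (c, c)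
    simpa [hz₃] using this
  have ht1 : Filter.Tendsto (fun q : ℂ × ℂ => (q.1, z₃ q)) (𝓝 (c, c)) (𝓝 (c, c)) :=
    (continuous_fst.tendsto (c, c)).prodMk_nhds hz₃t
  have ht2 : Filter.Tendsto (fun q : ℂ × ℂ => (q.2, z₃ q)) (𝓝 (c, c)) (𝓝 (c, c)) :=
    (continuous_snd.tendsto (c, c)).prodMk_nhds hz₃t
  filter_upwards [ht1.eventually h1, ht2.eventually h2, hz₃t.eventually heq,
    ht1.eventually (hu₁.isLittleO.bound hε'0), ht2.eventually (hu₂.isLittleO.bound hε'0)]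
    with q a1 a2 a3 a4 a5 r1 r2
  set d := ‖q.1 - q.2‖ with hd
  have hd0 : 0 ≤ d := norm_nonneg _
  have b1 : 0 ≤ ρ₁ (z₃ q) := by
    refine a1 (C * d) (by positivity) ?_ r1
    have : z₃ q - q.1 - (C * d) • e = -(q.1 - q.2) := by simp only [hz₃]; ring
    rw [this, norm_neg, ← hd, hC]
    apply le_of_eq; field_simp
  have b2 : 0 ≤ ρ₂ (z₃ q) := by
    refine a2 (C * d) (by positivity) ?_ r2
    have : z₃ q - q.2 - (C * d) • e = 0 := by simp only [hz₃]; ring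
    rw [this, norm_zero]; positivity
  have b3 := a3 b1 b2
  have n2 : ‖q.2 - z₃ q‖ = C * d * ‖e‖ := by
    have : q.2 - z₃ q = -((C * d) • e) := by simp only [hz₃]; ring
    rw [this, norm_neg, norm_smul, Real.norm_of_nonneg (by positivity)]
  have n1 : ‖q.1 - z₃ q‖ ≤ d + C * d * ‖e‖ := by
    rw [← n2]; exact norm_sub_le_norm_sub_add_norm_sub _ _ _
  have e1 : u₁ q.1 - u₂ q.2 - D (q.1 - q.2) = (u₁ q.1 - u₁ (z₃ q) - D (q.1 - z₃ q))
      - (u₂ q.2 - u₂ (z₃ q) - D (q.2 - z₃ q)) := by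
    rw [b3, map_sub, map_sub, map_sub]; ring
  rw [e1]
  calc _ ≤ ‖u₁ q.1 - u₁ (z₃ q) - D (q.1 - z₃ q)‖ + ‖u₂ q.2 - u₂ (z₃ q) - D (q.2 - z₃ q)‖ :=
        norm_sub_le _ _
    _ ≤ ε' * (d + C * d * ‖e‖) + ε' * (C * d * ‖e‖) := by
        refine add_le_add (a4.trans ?_) (a5.trans ?_)
        · gcongr
        · rw [n2]
    _ = ε' * (1 + 2 * C * ‖e‖) * d := by ring
    _ = ε * d := by rw [hε']; field_simp

/-- Two functions with the same zeros near `c`, increasing in the same direction, are nonnegative at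
the same points. -/
theorem eventually_nonneg_of_zeros {ρ₁ ρ₂ : ℂ → ℝ} {R₁ R₂ : ℂ →L[ℝ] ℝ} {c e : ℂ}
    (hρ₁ : HasStrictFDerivAt ρ₁ R₁ c) (hρ₂ : HasStrictFDerivAt ρ₂ R₂ c)
    (he₁ : 0 < R₁ e) (he₂ : 0 < R₂ e) (hc : ρ₂ c = 0)
    (hcont : ∀ᶠ z in 𝓝 c, ContinuousAt ρ₂ z) (hz : ∀ᶠ z in 𝓝 c, ρ₂ z = 0 → ρ₁ z = 0) :
    ∀ᶠ z in 𝓝 c, 0 ≤ ρ₁ z → 0 ≤ ρ₂ z := by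
  obtain ⟨δ₁, hδ₁, m₁, hm₁, h1⟩ := exists_cone hρ₁ he₁
  obtain ⟨δ₂, hδ₂, m₂, hm₂, h2⟩ := exists_cone hρ₂ he₂
  have hall := h1.and (h2.and ((continuous_snd.tendsto (c, c)).eventually (hz.and hcont)))
  obtain ⟨r, hr, hball⟩ := Metric.eventually_nhds_iff.1 hall
  have hT : Filter.Tendsto (fun z => ‖z - c‖ + |ρ₂ z| / m₂ * ‖e‖) (𝓝 c) (𝓝 0) := by
    have hco : ContinuousAt (fun z => ‖z - c‖ + |ρ₂ z| / m₂ * ‖e‖) c := by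
      have := hρ₂.hasFDerivAt.continuousAt
      fun_prop
    have := hco.tendsto
    simpa [hc] using this
  filter_upwards [hT.eventually (gt_mem_nhds hr)] with z hzr h0
  by_contra hneg
  push Not at hneg
  -- After time `T` along `e` the function `ρ₂` has become nonnegative, so it vanishes at some time
  -- `t`. Then `ρ₁` vanishes there too; as it grows from a nonnegative value, `t = 0`, against `ρ₂ z
  -- < 0`.
  set T := |ρ₂ z| / m₂ with hTd
  have hT0 : 0 ≤ T := by positivity
  have hin : ∀ t ∈ Set.Icc 0 T, dist (z + t • e) c < r := fun t ht => by
    rw [dist_eq_norm]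
    calc ‖z + t • e - c‖ = ‖(z - c) + t • e‖ := by congr 1; ring
      _ ≤ ‖z - c‖ + t * ‖e‖ := by
        refine (norm_add_le _ _).trans ?_
        rw [norm_smul, Real.norm_of_nonneg ht.1]
      _ ≤ ‖z - c‖ + T * ‖e‖ := by gcongr; exact ht.2
      _ < r := hzr
  have hin0 : dist z c < r := by simpa using hin 0 ⟨le_rfl, hT0⟩
  have hq : ∀ t ∈ Set.Icc 0 T, dist (z, z + t • e) (c, c) < r := fun t ht => by
    rw [Prod.dist_eq]; exact max_lt hin0 (hin t ht)
  have hcone : ∀ t : ℝ, z + t • e - z - t • e = 0 := fun t => by ring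
  have hend : 0 ≤ ρ₂ (z + T • e) := by
    have := (hball (hq T ⟨hT0, le_rfl⟩)).2.1 T hT0 (by
      simp only; rw [hcone, norm_zero]; positivity)
    simp only at this
    have h3 : m₂ * T = |ρ₂ z| := by rw [hTd]; field_simp
    rw [h3, abs_of_neg hneg] at this
    linarith
  have hcont' : ContinuousOn (fun t : ℝ => ρ₂ (z + t • e)) (Set.Icc 0 T) := fun t ht => by
    have h3 : ContinuousAt ρ₂ (z + t • e) := (hball (hq t ht)).2.2.2
    have h4 : ContinuousAt (fun t : ℝ => z + t • e) t := by fun_prop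
    exact (ContinuousAt.comp (f := fun t : ℝ => z + t • e) h3 h4).continuousWithinAt
  obtain ⟨t, ht, htz⟩ := intermediate_value_Icc hT0 hcont' ⟨by simpa using hneg.le, hend⟩
  have h5 := (hball (hq t ht)).2.2.1 htz
  have h6 := (hball (hq t ht)).1 t ht.1 (by
    simp only; rw [hcone, norm_zero]; have := ht.1; positivity)
  simp only at h5 h6
  have ht0 : t = 0 := by
    have := mul_nonneg hm₁.le ht.1
    have h7 : m₁ * t = 0 := by linarith
    exact (mul_eq_zero.1 h7).resolve_left hm₁.ne'
  rw [ht0] at htz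
  simp only [zero_smul, add_zero] at htz
  linarith

end H2R

end

/-! ### Local agreement at the contact point. -/

noncomputable section

namespace H2R

open Complex Metric

section Normals

variable {Φ : E3 ≃L[ℝ] ℂ × ℝ} {P N N' : E3} {D D' : ℂ →L[ℝ] ℝ}

theorem metric_of_normal (ho : ∀ ζ, metric P N (Φ.symm (ζ, D ζ)) = 0) (y : E3) :
    metric P N y = ((Φ y).2 - D (Φ y).1) * metric P N (Φ.symm (0, 1)) := by
  have h : y = Φ.symm ((Φ y).1, D (Φ y).1) + ((Φ y).2 - D (Φ y).1) • Φ.symm (0, 1) := by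
    apply Φ.injective
    simp only [map_add, map_smul, Φ.apply_symm_apply]
    ext <;> simp
  conv_lhs => rw [h]
  rw [metric_add_right, ho, metric_smul_right, zero_add]

theorem eq_of_common_normal (ho : ∀ ζ, metric P N (Φ.symm (ζ, D ζ)) = 0)
    (ho' : ∀ ζ, metric P N (Φ.symm (ζ, D' ζ)) = 0) (hN : metric P N (Φ.symm (0, 1)) ≠ 0) :
    D = D' := by
  ext1 ζ
  have h := metric_of_normal ho (Φ.symm (ζ, D' ζ))
  rw [ho', Φ.apply_symm_apply] at h
  have := (mul_eq_zero.1 h.symm).resolve_right hN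
  simp only at this
  linarith

/-- Unit normals to the same plane, on the same side of it, are equal. -/
theorem normal_unique (hP : P ∈ space) (h1 : metric P N N = 1) (h1' : metric P N' N' = 1)
    (ho : ∀ ζ, metric P N (Φ.symm (ζ, D ζ)) = 0) (ho' : ∀ ζ, metric P N' (Φ.symm (ζ, D ζ)) = 0)
    (hs : 0 < metric P N (Φ.symm (0, 1)) * metric P N' (Φ.symm (0, 1))) : N = N' := by
  have e := metric_of_normal ho
  have e' := metric_of_normal ho'
  set μ := metric P N (Φ.symm (0, 1)) with hμ
  set μ' := metric P N' (Φ.symm (0, 1)) with hμ'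
  -- By `metric_of_normal` this vector is orthogonal to every vector, in particular to itself.
  have hw : μ' • N - μ • N' = 0 := by
    by_contra hne
    have := metric_self_pos hP hne
    rw [metric_sub_left, metric_smul_left, metric_smul_left, e, e'] at this
    linarith
  have hw' : μ' • N = μ • N' := sub_eq_zero.1 hw
  have hsq : μ' ^ 2 = μ ^ 2 := by
    have h2 : metric P (μ' • N) (μ' • N) = metric P (μ • N') (μ • N') := by rw [hw']
    simp only [metric_smul_left, metric_smul_right, h1, h1'] at h2
    linarith
  have hμμ : μ' = μ := by
    rcases sq_eq_sq_iff_eq_or_eq_neg.1 hsq with h | h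
    · exact h
    · rw [h] at hs; nlinarith [sq_nonneg μ]
  have hμ0 : μ ≠ 0 := fun h => by rw [h] at hs; simp at hs
  rw [hμμ] at hw'
  exact smul_right_injective E3 hμ0 hw'

end Normals

namespace LocalGraph

variable {M : Type*} [TopologicalSpace M] [ChartedSpace (EuclideanHalfSpace 2) M]
  {n : WithTop ℕ∞} {Φ : E3 ≃L[ℝ] ℂ × ℝ} {f η : M → E3} {x : M} {u ρ : ℂ → ℝ} {σ : ℂ → M}

theorem tendsto_proj (L : LocalGraph n Φ f x u ρ σ) :
    Filter.Tendsto (fun y => proj Φ (f y)) (𝓝 x) (𝓝 (proj Φ (f x))) := by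
  have h : Filter.map (fun y => proj Φ (f y)) (𝓝 x) ≤ 𝓝 (proj Φ (f x)) := by
    rw [L.map_eq.self_of_nhds]; exact nhdsWithin_le_nhds
  exact h

theorem nonneg (L : LocalGraph n Φ f x u ρ σ) : ∀ᶠ y in 𝓝 x, 0 ≤ ρ (proj Φ (f y)) := by
  have h : ∀ᶠ z in 𝓝[{z | 0 ≤ ρ z}] proj Φ (f x), 0 ≤ ρ z := self_mem_nhdsWithin
  rw [← L.map_eq.self_of_nhds] at h
  exact h

theorem interior_iff (L : LocalGraph n Φ f x u ρ σ) :
    ∀ᶠ y in 𝓝 x, y ∈ (𝓡∂ 2).interior M ↔ 0 < ρ (proj Φ (f y)) := by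
  filter_upwards [L.nonneg, L.boundary_iff] with y h1 h2
  rw [← ModelWithCorners.compl_boundary, Set.mem_compl_iff, h2]
  exact ⟨fun h => lt_of_le_of_ne h1 (Ne.symm h), fun h => h.ne'⟩

/-- The projection is open onto `{ρ ≥ 0}`: this is the inclusion in `map_eq` that lets planar points
be lifted to the surface, with any prescribed local property. -/
theorem eventually_exists (L : LocalGraph n Φ f x u ρ σ) {p : M → Prop} (hp : ∀ᶠ y in 𝓝 x, p y) :
    ∀ᶠ z in 𝓝 (proj Φ (f x)), 0 ≤ ρ z → ∃ y, p y ∧ proj Φ (f y) = z ∧ f y = graphMap Φ u z := by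
  have h := Filter.image_mem_map (m := fun y => proj Φ (f y)) (hp.and L.graph)
  rw [L.map_eq.self_of_nhds] at h
  filter_upwards [eventually_nhdsWithin_iff.1 h] with z hz h0
  obtain ⟨y, ⟨h1, h2⟩, h3⟩ := hz h0
  have h3' : proj Φ (f y) = z := h3
  exact ⟨y, h1, h3', by rw [h2, h3']⟩

theorem map_f (L : LocalGraph n Φ f x u ρ σ) : ∀ᶠ y in 𝓝 x, Filter.map f (𝓝 y) =
    Filter.map (graphMap Φ u) (𝓝[{z | 0 ≤ ρ z}] proj Φ (f y)) := by
  filter_upwards [L.map_eq, L.graph.eventually_nhds] with y h1 h2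
  rw [← h1, Filter.map_map]
  exact Filter.map_congr h2

theorem nhdsWithin_eq (L : LocalGraph n Φ f x u ρ σ) :
    ∀ᶠ z in 𝓝 (proj Φ (f x)), 0 < ρ z → 𝓝[{z | 0 ≤ ρ z}] z = 𝓝 z := by
  filter_upwards [L.contDiffAt_ρ] with z h1 h2
  refine nhdsWithin_eq_nhds.2 ?_
  exact (h1.continuousAt.eventually (lt_mem_nhds h2)).mono fun z hz => le_of_lt hz

theorem map_proj_boundary (L : LocalGraph n Φ f x u ρ σ) :
    Filter.map (fun y => proj Φ (f y)) (𝓝[(𝓡∂ 2).boundary M] x) =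
      𝓝[{z | ρ z = 0}] proj Φ (f x) := by
  have h1 : 𝓝[(𝓡∂ 2).boundary M] x =
      𝓝 x ⊓ Filter.comap (fun y => proj Φ (f y)) (Filter.principal {z | ρ z = 0}) := by
    rw [Filter.comap_principal]
    exact nhdsWithin_eq_iff_eventuallyEq.2 (L.boundary_iff.mono fun y hy => propext hy)
  rw [h1, Filter.push_pull, L.map_eq.self_of_nhds, nhdsWithin, nhdsWithin, inf_assoc,
    Filter.inf_principal]
  congr 2
  ext z
  simp only [Set.mem_inter_iff, Set.mem_ofPred_eq]
  exact ⟨fun h => h.2, fun h => ⟨h.ge, h⟩⟩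

theorem u_eq (L : LocalGraph n Φ f x u ρ σ) : u (proj Φ (f x)) = (Φ (f x)).2 := by
  conv_rhs => rw [L.graph.self_of_nhds]
  simp [graphMap]

theorem eventually_normal (L : LocalGraph n Φ f x u ρ σ) (hn : 2 ≤ n)
    (h : IsTranslatingSoliton f η) :
    ∀ᶠ y in 𝓝 x, ∀ ζ, metric (f y) (η y) (Φ.symm (ζ, fderiv ℝ u (proj Φ (f y)) ζ)) = 0 := by
  have hfd : MDifferentiable (𝓡∂ 2) 𝓘(ℝ, E3) f := h.smooth.mdifferentiable (by simp)
  have hn0 : n ≠ 0 := fun h0 => by rw [h0] at hn; simp at hn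
  filter_upwards [L.graph.eventually_nhds, L.tendsto_proj.eventually L.contDiffAt_u] with y h2 h3 ζ
  have h3' := h3.differentiableAt hn0
  obtain ⟨ξ, hξ⟩ := surjective_proj_diff (hfd y) (h.immersion y) h2 h3' ζ
  rw [← hξ, ← diff_graph (hfd y) h2 h3']
  exact h.normal_orthogonal y ξ

end LocalGraph

section Contact

variable {M₁ : Type*} [TopologicalSpace M₁] [ChartedSpace (EuclideanHalfSpace 2) M₁]
  {M₂ : Type*} [TopologicalSpace M₂] [ChartedSpace (EuclideanHalfSpace 2) M₂]
  {Φ : E3 ≃L[ℝ] ℂ × ℝ} {f₁ η₁ : M₁ → E3} {f₂ η₂ : M₂ → E3} {p₁ : M₁} {p₂ : M₂}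
  {u₁ ρ₁ u₂ ρ₂ : ℂ → ℝ} {σ₁ : ℂ → M₁} {σ₂ : ℂ → M₂}

/-- The derivative of `ρ` in terms of the interior conormal. -/
theorem LocalGraph.fderiv_eq_of_conormal (L : LocalGraph 2 Φ f₁ p₁ u₁ ρ₁ σ₁)
    (h : IsTranslatingSoliton f₁ η₁) {ξ : E3} (hξ : IsInteriorConormal f₁ p₁ ξ) :
    0 < fderiv ℝ ρ₁ (proj Φ (f₁ p₁)) (Φ ξ).1 ∧
    ∀ ζ, fderiv ℝ ρ₁ (proj Φ (f₁ p₁)) ζ = fderiv ℝ ρ₁ (proj Φ (f₁ p₁)) (Φ ξ).1 *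
      metric (f₁ p₁) ξ (Φ.symm (ζ, fderiv ℝ u₁ (proj Φ (f₁ p₁)) ζ)) := by
  obtain ⟨⟨ν, hν, rfl⟩, h1, h2⟩ := hξ
  have hfd : MDifferentiable (𝓡∂ 2) 𝓘(ℝ, E3) f₁ := h.smooth.mdifferentiable (by simp)
  have hu := L.contDiffAt_u.self_of_nhds.differentiableAt (by norm_num)
  rw [L.fderiv_ρ]
  refine ⟨hν, fun ζ => ?_⟩
  obtain ⟨ξ, rfl⟩ := surjective_proj_diff (hfd p₁) (h.immersion p₁) L.graph hu ζ
  rw [← diff_graph (hfd p₁) L.graph hu, L.fderiv_ρ]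
  -- Splitting into a vector tangent to the boundary, which is orthogonal to the conormal, and a
  -- multiple of the conormal direction.
  have h3 : ξ = (ξ - (ξ 0 / ν 0) • ν) + (ξ 0 / ν 0) • ν := by abel
  have h4 : (ξ - (ξ 0 / ν 0) • ν) 0 = 0 := by
    simp [hν.ne']
  have h5 : metric (f₁ p₁) (diff f₁ p₁ ν) (diff f₁ p₁ ξ) = ξ 0 / ν 0 := by
    conv_lhs => rw [h3, map_add, metric_add_right, h2 _ h4, map_smul, metric_smul_right, h1]
    ring
  rw [h5]
  field_simp

/-- The common normal determines the tangent plane, and the tangent plane of a graph determines the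
derivative of its function. -/
theorem jet_eq_of_contact (L₁ : LocalGraph 2 Φ f₁ p₁ u₁ ρ₁ σ₁) (L₂ : LocalGraph 2 Φ f₂ p₂ u₂ ρ₂ σ₂)
    (h₁ : IsTranslatingSoliton f₁ η₁) (h₂ : IsTranslatingSoliton f₂ η₂)
    (hΦ : metric (f₁ p₁) (η₁ p₁) (Φ.symm (0, 1)) ≠ 0) (hpoint : f₁ p₁ = f₂ p₂)
    (hnormal : η₁ p₁ = η₂ p₂) :
    u₁ (proj Φ (f₁ p₁)) = u₂ (proj Φ (f₁ p₁)) ∧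
      fderiv ℝ u₁ (proj Φ (f₁ p₁)) = fderiv ℝ u₂ (proj Φ (f₁ p₁)) := by
  have e1 := L₁.u_eq
  have e2 := L₂.u_eq
  have o1 := (L₁.eventually_normal le_rfl h₁).self_of_nhds
  have o2 := (L₂.eventually_normal le_rfl h₂).self_of_nhds
  rw [← hpoint] at e2 o2
  rw [← hnormal] at o2
  exact ⟨e1.trans e2.symm, eq_of_common_normal o1 o2 hΦ⟩

theorem jet_congr {c : ℂ} (h0 : u₁ c = u₂ c) (h1 : fderiv ℝ u₁ c = fderiv ℝ u₂ c) :
    jet Φ u₁ c = jet Φ u₂ c := by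
  simp only [jet, graphMap, dx, dy, h0, h1]

/-- The contact of two translating solitons, written as graphs. -/
theorem eventually_eq_of_contact (L₁ : LocalGraph 2 Φ f₁ p₁ u₁ ρ₁ σ₁)
    (L₂ : LocalGraph 2 Φ f₂ p₂ u₂ ρ₂ σ₂)
    (h₁ : IsTranslatingSoliton f₁ η₁) (h₂ : IsTranslatingSoliton f₂ η₂)
    (hΦ : metric (f₁ p₁) (η₁ p₁) (Φ.symm (0, 1)) ≠ 0) (hpoint : f₁ p₁ = f₂ p₂)
    (hnormal : η₁ p₁ = η₂ p₂)
    (hcontact :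
      (p₁ ∈ (𝓡∂ 2).interior M₁ ∧ p₂ ∈ (𝓡∂ 2).interior M₂) ∨
      (p₁ ∈ (𝓡∂ 2).boundary M₁ ∧ p₂ ∈ (𝓡∂ 2).boundary M₂ ∧
        ∃ ξ : E3, IsInteriorConormal f₁ p₁ ξ ∧ IsInteriorConormal f₂ p₂ ξ))
    (hside : ∀ᶠ z in 𝓝 (proj Φ (f₁ p₁)), 0 ≤ ρ₁ z → 0 ≤ ρ₂ z → u₂ z ≤ u₁ z) :
    ∀ᶠ z in 𝓝 (proj Φ (f₁ p₁)), 0 ≤ ρ₁ z → 0 ≤ ρ₂ z → u₁ z = u₂ z := by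
  obtain ⟨j0, j1⟩ := jet_eq_of_contact L₁ L₂ h₁ h₂ hΦ hpoint hnormal
  have cu₁ := L₁.contDiffAt_u
  have cu₂ := L₂.contDiffAt_u
  have cρ₁ := L₁.contDiffAt_ρ
  have cρ₂ := L₂.contDiffAt_ρ
  have s₁ := L₁.soliton
  have s₂ := L₂.soliton
  rw [← hpoint] at cu₂ cρ₂ s₂
  have hsp : graphMap Φ u₁ (proj Φ (f₁ p₁)) ∈ space := by
    rw [← L₁.graph.self_of_nhds]; exact h₁.mem_space p₁
  obtain ⟨l, Λ, K, hl, hK, hell⟩ := exists_ellipticIneq Φ cu₁.self_of_nhds cu₂.self_of_nhds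
    (jet_congr (Φ := Φ) j0 j1) hsp
  set c := proj Φ (f₁ p₁) with hc
  have hw0 : u₁ c - u₂ c = 0 := sub_eq_zero.2 j0
  rcases hcontact with ⟨i₁, i₂⟩ | ⟨b₁, b₂, ξ, hξ₁, hξ₂⟩
  · have r₁ : 0 < ρ₁ c := L₁.interior_iff.self_of_nhds.1 i₁
    have r₂ : 0 < ρ₂ c := by
      have := L₂.interior_iff.self_of_nhds.1 i₂
      rwa [← hpoint] at this
    have hall := hside.and (cu₁.and (cu₂.and (s₁.and (s₂.and (hell.and
      ((cρ₁.self_of_nhds.continuousAt.eventually (lt_mem_nhds r₁)).and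
      (cρ₂.self_of_nhds.continuousAt.eventually (lt_mem_nhds r₂))))))))
    obtain ⟨r, hr, hball⟩ := Metric.eventually_nhds_iff_ball.1 hall
    have := eventually_eq_zero_of_nonneg (w := fun z => u₁ z - u₂ z) hK hl isOpen_ball
      (fun z hz => (hball z hz).2.1.sub (hball z hz).2.2.1)
      (fun z hz => by
        obtain ⟨a1, a2, a3, a4, a5, a6, a7, a8⟩ := hball z hz
        exact sub_nonneg.2 (a1 a7.le a8.le))
      (fun z hz => by
        obtain ⟨a1, a2, a3, a4, a5, a6, a7, a8⟩ := hball z hz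
        exact a6 (a4 a7) (a5 a8)) (mem_ball_self hr) hw0
    filter_upwards [this] with z hz _ _
    exact sub_eq_zero.1 hz
  · have r₁ : ρ₁ c = 0 := L₁.boundary_iff.self_of_nhds.1 b₁
    have r₂ : ρ₂ c = 0 := by
      have := L₂.boundary_iff.self_of_nhds.1 b₂
      rwa [← hpoint] at this
    obtain ⟨d₁, g₁⟩ := L₁.fderiv_eq_of_conormal h₁ hξ₁
    obtain ⟨d₂, g₂⟩ := L₂.fderiv_eq_of_conormal h₂ hξ₂
    rw [← hpoint, ← hc] at d₂ g₂
    rw [← j1] at g₂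
    rw [← hc] at d₁ g₁
    -- Both surfaces have the same tangent plane and the same conormal `ξ`, so `dρ₁` and `dρ₂` are
    -- positive multiples of this one covector. `E` is its gradient and `e` is the unit vector along
    -- it.
    set ℓ : ℂ → ℝ := fun ζ => metric (f₁ p₁) ξ (Φ.symm (ζ, fderiv ℝ u₁ c ζ)) with hℓ
    set E : ℂ := ⟨ℓ 1, ℓ I⟩ with hE
    have hℓE : ∀ ζ : ℂ, ℓ ζ = E.re * ζ.re + E.im * ζ.im := fun ζ => by
      simp only [hℓ, hE]
      rw [symm_eq_tan c ζ, symm_eq_tan c 1, symm_eq_tan c I]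
      simp only [metric_add_right, metric_smul_right, one_re, one_im, I_re, I_im]
      ring
    have hE0 : E ≠ 0 := fun h0 => by
      have := g₁ (Φ ξ).1
      rw [show metric (f₁ p₁) ξ (Φ.symm ((Φ ξ).1, fderiv ℝ u₁ c (Φ ξ).1)) = ℓ (Φ ξ).1 from rfl,
        hℓE, h0] at this
      simp at this
      linarith
    have hE' : 0 < ‖E‖ := norm_pos_iff.2 hE0
    set b : Fin 2 → ℝ := ![fderiv ℝ ρ₁ c (Φ ξ).1 * ‖E‖, fderiv ℝ ρ₂ c (Φ ξ).1 * ‖E‖] with hb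
    set e : ℂ := (‖E‖⁻¹ : ℝ) • E with he
    have hre : ‖E‖ * e.re = E.re := by rw [he]; simp [hE'.ne']
    have him : ‖E‖ * e.im = E.im := by rw [he]; simp [hE'.ne']
    have hall := hside.and (cu₁.and (cu₂.and (s₁.and (s₂.and (hell.and (cρ₁.and cρ₂))))))
    obtain ⟨r, hr, hball⟩ := Metric.eventually_nhds_iff_ball.1 hall
    have key := eq_zero_of_boundary_contact (w := fun z => u₁ z - u₂ z) (ρ := ![ρ₁, ρ₂]) (b := b)
      (e := e) hK hl hr
      (fun z hz => (hball z hz).2.1.sub (hball z hz).2.2.1)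
      (fun i z hz => by
        obtain ⟨a1, a2, a3, a4, a5, a6, a7, a8⟩ := hball z hz
        fin_cases i
        · exact a7
        · exact a8)
      (fun i => by
        fin_cases i
        · exact r₁
        · exact r₂)
      (by rw [he, norm_smul, norm_inv, norm_norm]; field_simp)
      (fun i => by
        fin_cases i
        · exact mul_pos d₁ hE'
        · exact mul_pos d₂ hE')
      (fun i ζ => by
        have hζ : ‖E‖ * (e.re * ζ.re + e.im * ζ.im) = ℓ ζ := by
          rw [hℓE, ← hre, ← him]; ring
        fin_cases i
        · refine (g₁ ζ).trans ?_
          change _ * ℓ ζ = fderiv ℝ ρ₁ c (Φ ξ).1 * ‖E‖ * _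
          rw [mul_assoc, hζ]
        · refine (g₂ ζ).trans ?_
          change _ * ℓ ζ = fderiv ℝ ρ₂ c (Φ ξ).1 * ‖E‖ * _
          rw [mul_assoc, hζ])
      (fun z hz hpos => by
        obtain ⟨a1, a2, a3, a4, a5, a6, a7, a8⟩ := hball z hz
        exact sub_nonneg.2 (a1 (le_of_lt (hpos 0)) (le_of_lt (hpos 1))))
      (fun z hz hpos => by
        obtain ⟨a1, a2, a3, a4, a5, a6, a7, a8⟩ := hball z hz
        exact a6 (a4 (hpos 0)) (a5 (hpos 1)))
      hw0
      (by
        rw [fderiv_fun_sub (cu₁.self_of_nhds.differentiableAt (by norm_num))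
          (cu₂.self_of_nhds.differentiableAt (by norm_num)), j1, sub_self])
    filter_upwards [key] with z hz k1 k2
    refine sub_eq_zero.1 (hz fun i => ?_)
    fin_cases i
    · exact k1
    · exact k2

end Contact

end H2R

end

/-! ### Germs of images and agreement in every direction. -/

noncomputable section

namespace H2R

open Complex Metric

theorem exists_coordinates {v : E3} (hv : v ≠ 0) :
    ∃ Φ : E3 ≃L[ℝ] ℂ × ℝ, Φ.symm (0, 1) = v := by
  let Φ₀ : E3 ≃L[ℝ] ℂ × ℝ := ContinuousLinearEquiv.ofFinrankEq (by simp)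
  have h0 : Φ₀.symm (0, 1) ≠ 0 := fun h => by
    have := congrArg Φ₀ h
    rw [Φ₀.apply_symm_apply, map_zero] at this
    exact one_ne_zero (congrArg Prod.snd this)
  obtain ⟨A, hA⟩ := SeparatingDual.exists_continuousLinearEquiv_apply_eq (R := ℝ) h0 hv
  exact ⟨A.symm.trans Φ₀, hA⟩

section Germs

variable {M₁ M₂ : Type*} [TopologicalSpace M₁] [TopologicalSpace M₂] {f₁ : M₁ → E3}
  {f₂ : M₂ → E3} {A₁ : Set M₁} {A₂ : Set M₂} {p₁ : M₁} {p₂ : M₂}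

theorem SameGerm.symm (h : SameGerm f₁ A₁ p₁ f₂ A₂ p₂) : SameGerm f₂ A₂ p₂ f₁ A₁ p₁ := by
  intro W₂ hW₂ W₁ hW₁
  obtain ⟨V₁, a, V₂, b, c, d, e⟩ := h W₁ hW₁ W₂ hW₂
  exact ⟨V₂, b, V₁, a, d, c, e.symm⟩

theorem SameGerm.map_le (h : SameGerm f₁ A₁ p₁ f₂ A₂ p₂) :
    Filter.map f₂ (𝓝[A₂] p₂) ≤ Filter.map f₁ (𝓝[A₁] p₁) := by
  intro S hS
  obtain ⟨W, hW, hWS⟩ := mem_nhdsWithin_iff_exists_mem_nhds_inter.1 (Filter.mem_map.1 hS)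
  obtain ⟨V₁, -, V₂, hV₂, hV₁W, -, hV⟩ := h W hW Set.univ Filter.univ_mem
  refine Filter.mem_map.2 (mem_nhdsWithin_iff_exists_mem_nhds_inter.2 ⟨V₂, hV₂, fun y hy => ?_⟩)
  obtain ⟨x, hx, hxy⟩ := hV.ge ⟨y, hy, rfl⟩
  rw [Set.mem_preimage, ← hxy]
  exact hWS ⟨hV₁W hx.1, hx.2⟩

theorem exists_nhds_image_eq {W : Set M₁} {S : Set E3} (hW : W ∈ 𝓝 p₁)
    (hS : S ∈ Filter.map f₁ (𝓝[A₁] p₁)) (hSW : S ⊆ f₁ '' (W ∩ A₁)) :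
    ∃ V ∈ 𝓝 p₁, V ⊆ W ∧ f₁ '' (V ∩ A₁) = S := by
  obtain ⟨U, hU, hUS⟩ := mem_nhdsWithin_iff_exists_mem_nhds_inter.1 (Filter.mem_map.1 hS)
  refine ⟨W ∩ (f₁ ⁻¹' S ∪ A₁ᶜ), Filter.inter_mem hW ?_, Set.inter_subset_left, ?_⟩
  · refine Filter.mem_of_superset hU fun x hx => ?_
    by_cases hA : x ∈ A₁
    · exact Or.inl (hUS ⟨hx, hA⟩)
    · exact Or.inr hA
  · ext s
    constructor
    · rintro ⟨x, ⟨⟨-, hx⟩, hA⟩, rfl⟩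
      exact hx.resolve_right fun h => h hA
    · intro hs
      obtain ⟨x, ⟨hx, hA⟩, rfl⟩ := hSW hs
      exact ⟨x, ⟨⟨hx, Or.inl hs⟩, hA⟩, rfl⟩

theorem image_inter_mem_map {W : Set M₁} (hW : W ∈ 𝓝 p₁) :
    f₁ '' (W ∩ A₁) ∈ Filter.map f₁ (𝓝[A₁] p₁) :=
  Filter.image_mem_map (by rw [Set.inter_comm]; exact inter_mem_nhdsWithin A₁ hW)

/-- Having equal images of arbitrarily small neighbourhoods is an equality of push-forward filters.
In this form it composes with projections and graph maps. -/
theorem sameGerm_iff :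
    SameGerm f₁ A₁ p₁ f₂ A₂ p₂ ↔ Filter.map f₁ (𝓝[A₁] p₁) = Filter.map f₂ (𝓝[A₂] p₂) := by
  refine ⟨fun h => le_antisymm h.symm.map_le h.map_le, fun h W₁ hW₁ W₂ hW₂ => ?_⟩
  have m1 : f₁ '' (W₁ ∩ A₁) ∈ Filter.map f₁ (𝓝[A₁] p₁) := image_inter_mem_map hW₁
  have m2 : f₂ '' (W₂ ∩ A₂) ∈ Filter.map f₂ (𝓝[A₂] p₂) := image_inter_mem_map hW₂
  obtain ⟨V₁, a1, a2, a3⟩ := exists_nhds_image_eq hW₁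
    (Filter.inter_mem m1 (by rw [h]; exact m2)) Set.inter_subset_left
  obtain ⟨V₂, b1, b2, b3⟩ := exists_nhds_image_eq hW₂
    (Filter.inter_mem (by rw [← h]; exact m1) m2) Set.inter_subset_right
  exact ⟨V₁, a1, V₂, b1, a2, b2, a3.trans b3.symm⟩

end Germs

section Contact

variable {M₁ : Type*} [TopologicalSpace M₁] [ChartedSpace (EuclideanHalfSpace 2) M₁]
  {M₂ : Type*} [TopologicalSpace M₂] [ChartedSpace (EuclideanHalfSpace 2) M₂]
  {Φ : E3 ≃L[ℝ] ℂ × ℝ} {f₁ η₁ : M₁ → E3} {f₂ η₂ : M₂ → E3} {p₁ : M₁} {p₂ : M₂}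
  {u₁ ρ₁ u₂ ρ₂ : ℂ → ℝ} {σ₁ : ℂ → M₁} {σ₂ : ℂ → M₂}

theorem LocalGraph.strict (L : LocalGraph 2 Φ f₁ p₁ u₁ ρ₁ σ₁) :
    HasStrictFDerivAt u₁ (fderiv ℝ u₁ (proj Φ (f₁ p₁))) (proj Φ (f₁ p₁)) ∧
    HasStrictFDerivAt ρ₁ (fderiv ℝ ρ₁ (proj Φ (f₁ p₁))) (proj Φ (f₁ p₁)) :=
  ⟨L.contDiffAt_u.self_of_nhds.hasStrictFDerivAt (by norm_num),
    L.contDiffAt_ρ.self_of_nhds.hasStrictFDerivAt (by norm_num)⟩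

theorem eventually_le_of_side (L₁ : LocalGraph 2 Φ f₁ p₁ u₁ ρ₁ σ₁)
    (L₂ : LocalGraph 2 Φ f₂ p₂ u₂ ρ₂ σ₂) (hpoint : f₁ p₁ = f₂ p₂)
    (hside : ∀ᶠ q : M₁ × M₂ in 𝓝 (p₁, p₂), ∀ s : ℝ,
      f₁ q.1 = f₂ q.2 + s • Φ.symm (0, 1) → 0 ≤ s) :
    ∀ᶠ z in 𝓝 (proj Φ (f₁ p₁)), 0 ≤ ρ₁ z → 0 ≤ ρ₂ z → u₂ z ≤ u₁ z := by
  rw [nhds_prod_eq, Filter.eventually_prod_iff] at hside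
  obtain ⟨a, ha, b, hb, hab⟩ := hside
  have e₂ := L₂.eventually_exists hb
  rw [← hpoint] at e₂
  filter_upwards [L₁.eventually_exists ha, e₂] with z h1 h2 r1 r2
  obtain ⟨y₁, hy₁, -, g₁⟩ := h1 r1
  obtain ⟨y₂, hy₂, -, g₂⟩ := h2 r2
  refine sub_nonneg.1 (hab hy₁ hy₂ (u₁ z - u₂ z) ?_)
  simp only
  rw [g₁, g₂]
  apply Φ.injective
  simp only [graphMap, map_add, map_smul, Φ.apply_symm_apply]
  ext <;> simp

/-- At a boundary contact the direction is the projection of the common conormal. At an interior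
contact no direction is needed and `0` is a dummy. -/
theorem exists_direction (L₁ : LocalGraph 2 Φ f₁ p₁ u₁ ρ₁ σ₁)
    (L₂ : LocalGraph 2 Φ f₂ p₂ u₂ ρ₂ σ₂)
    (h₁ : IsTranslatingSoliton f₁ η₁) (h₂ : IsTranslatingSoliton f₂ η₂) (hpoint : f₁ p₁ = f₂ p₂)
    (hcontact :
      (p₁ ∈ (𝓡∂ 2).interior M₁ ∧ p₂ ∈ (𝓡∂ 2).interior M₂) ∨
      (p₁ ∈ (𝓡∂ 2).boundary M₁ ∧ p₂ ∈ (𝓡∂ 2).boundary M₂ ∧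
        ∃ ξ : E3, IsInteriorConormal f₁ p₁ ξ ∧ IsInteriorConormal f₂ p₂ ξ)) :
    ∃ e : ℂ, ((0 < ρ₁ (proj Φ (f₁ p₁)) ∧ 0 < ρ₂ (proj Φ (f₁ p₁))) ∨
      (ρ₁ (proj Φ (f₁ p₁)) = 0 ∧ ρ₂ (proj Φ (f₁ p₁)) = 0 ∧
        0 < fderiv ℝ ρ₁ (proj Φ (f₁ p₁)) e ∧ 0 < fderiv ℝ ρ₂ (proj Φ (f₁ p₁)) e)) := by
  rcases hcontact with ⟨i₁, i₂⟩ | ⟨b₁, b₂, ξ, hξ₁, hξ₂⟩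
  · have r₁ := L₁.interior_iff.self_of_nhds.1 i₁
    have r₂ := L₂.interior_iff.self_of_nhds.1 i₂
    rw [← hpoint] at r₂
    exact ⟨0, Or.inl ⟨r₁, r₂⟩⟩
  · have r₁ := L₁.boundary_iff.self_of_nhds.1 b₁
    have r₂ := L₂.boundary_iff.self_of_nhds.1 b₂
    have d₁ := (L₁.fderiv_eq_of_conormal h₁ hξ₁).1
    have d₂ := (L₂.fderiv_eq_of_conormal h₂ hξ₂).1
    rw [← hpoint] at r₂ d₂
    exact ⟨(Φ ξ).1, Or.inr ⟨r₁, r₂, d₁, d₂⟩⟩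

/-- Two points that differ by `s • v` have projections that differ by `s • (Φ v).1`. Comparing
heights, `eventually_sub_le_of_agree` gives `|s| k ≤ ε |s| ‖(Φ v).1‖`, where `k = |(Φ v).2 - D (Φ
v).1|` is positive because `v` is transverse. For small `ε` this forces `s = 0`. -/
theorem agreeAsGraphs_of_eq (L₁ : LocalGraph 2 Φ f₁ p₁ u₁ ρ₁ σ₁)
    (L₂ : LocalGraph 2 Φ f₂ p₂ u₂ ρ₂ σ₂)
    (h₁ : IsTranslatingSoliton f₁ η₁) (h₂ : IsTranslatingSoliton f₂ η₂)
    (hΦ : metric (f₁ p₁) (η₁ p₁) (Φ.symm (0, 1)) ≠ 0) (hpoint : f₁ p₁ = f₂ p₂)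
    (hnormal : η₁ p₁ = η₂ p₂) {e : ℂ}
    (he₁ : 0 < ρ₁ (proj Φ (f₁ p₁)) ∨ 0 < fderiv ℝ ρ₁ (proj Φ (f₁ p₁)) e)
    (he₂ : 0 < ρ₂ (proj Φ (f₁ p₁)) ∨ 0 < fderiv ℝ ρ₂ (proj Φ (f₁ p₁)) e)
    (heq : ∀ᶠ z in 𝓝 (proj Φ (f₁ p₁)), 0 ≤ ρ₁ z → 0 ≤ ρ₂ z → u₁ z = u₂ z) :
    AgreeAsGraphs f₁ f₂ p₁ p₂ (η₁ p₁) := by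
  intro v hv
  obtain ⟨j0, j1⟩ := jet_eq_of_contact L₁ L₂ h₁ h₂ hΦ hpoint hnormal
  have o₁ := (L₁.eventually_normal le_rfl h₁).self_of_nhds
  obtain ⟨su₁, sρ₁⟩ := L₁.strict
  obtain ⟨su₂, sρ₂⟩ := L₂.strict
  have t₁ := L₁.tendsto_proj
  have t₂ := L₂.tendsto_proj
  rw [← hpoint] at su₂ sρ₂ t₂
  rw [← j1] at su₂
  set c := proj Φ (f₁ p₁) with hc
  set D := fderiv ℝ u₁ c with hD
  have hτ : (Φ v).2 - D (Φ v).1 ≠ 0 := fun h0 => by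
    rw [metric_comm, metric_of_normal o₁] at hv
    rw [h0, zero_mul] at hv
    exact hv rfl
  set k := |(Φ v).2 - D (Φ v).1| with hk
  have hk0 : 0 < k := abs_pos.2 hτ
  have hε : 0 < k / (‖(Φ v).1‖ + 1) := by positivity
  have hmain := eventually_sub_le_of_agree su₁ su₂ sρ₁ sρ₂ he₁ he₂ heq hε
  have ht : Filter.Tendsto (fun q : M₁ × M₂ => (proj Φ (f₁ q.1), proj Φ (f₂ q.2))) (𝓝 (p₁, p₂))
      (𝓝 (c, c)) :=
    (t₁.comp (continuous_fst.tendsto (p₁, p₂))).prodMk_nhds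
      (t₂.comp (continuous_snd.tendsto (p₁, p₂)))
  have c₁ := (continuous_fst.tendsto (p₁, p₂)).eventually (L₁.nonneg.and L₁.graph)
  have c₂ := (continuous_snd.tendsto (p₁, p₂)).eventually (L₂.nonneg.and L₂.graph)
  filter_upwards [ht.eventually hmain, c₁, c₂] with q a1 ⟨a2, a3⟩ ⟨a4, a5⟩ s hs
  have b1 := a1 a2 a4
  have hs' := congrArg Φ hs
  rw [map_add, map_smul] at hs'
  have g1 : proj Φ (f₁ q.1) - proj Φ (f₂ q.2) = s • (Φ v).1 := by
    have := congrArg Prod.fst hs'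
    simp only [Prod.fst_add, Prod.smul_fst] at this
    simp only [proj]; rw [this]; ring
  have g2 : u₁ (proj Φ (f₁ q.1)) - u₂ (proj Φ (f₂ q.2)) = s * (Φ v).2 := by
    have := congrArg Prod.snd hs'
    rw [a3, a5] at this
    simp only [graphMap, Φ.apply_symm_apply, Prod.snd_add, Prod.smul_snd, smul_eq_mul] at this
    linarith
  rw [g1, g2, map_smul, smul_eq_mul, ← mul_sub, abs_mul, norm_smul, Real.norm_eq_abs, ← hk] at b1
  by_contra hs0
  have hs1 : 0 < |s| := abs_pos.2 hs0
  have hlt : k / (‖(Φ v).1‖ + 1) * ‖(Φ v).1‖ < k := by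
    rw [div_mul_eq_mul_div, div_lt_iff₀ (by positivity)]
    nlinarith
  nlinarith

theorem map_eq_of_graph (L₁ : LocalGraph 2 Φ f₁ p₁ u₁ ρ₁ σ₁)
    (L₂ : LocalGraph 2 Φ f₂ p₂ u₂ ρ₂ σ₂) (hpoint : f₁ p₁ = f₂ p₂)
    (hρ : ∀ᶠ z in 𝓝 (proj Φ (f₁ p₁)), 0 ≤ ρ₁ z ↔ 0 ≤ ρ₂ z)
    (heq : ∀ᶠ z in 𝓝 (proj Φ (f₁ p₁)), 0 ≤ ρ₁ z → 0 ≤ ρ₂ z → u₁ z = u₂ z) :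
    Filter.map f₁ (𝓝 p₁) = Filter.map f₂ (𝓝 p₂) := by
  rw [L₁.map_f.self_of_nhds, L₂.map_f.self_of_nhds, ← hpoint]
  have h1 : 𝓝[{z | 0 ≤ ρ₁ z}] proj Φ (f₁ p₁) = 𝓝[{z | 0 ≤ ρ₂ z}] proj Φ (f₁ p₁) :=
    nhdsWithin_eq_iff_eventuallyEq.2 (hρ.mono fun z hz => propext hz)
  rw [← h1]
  refine Filter.map_congr (eventually_nhdsWithin_iff.2 ?_)
  filter_upwards [hρ, heq] with z a1 a2 a3
  simp only [graphMap]
  rw [a2 a3 (a1.1 a3)]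

/-- Projecting the equal boundary germs shows that `ρ₁` and `ρ₂` have the same zeros. As both
increase along `e`, they are nonnegative at the same points. -/
theorem eventually_nonneg_iff_of_boundary (L₁ : LocalGraph 2 Φ f₁ p₁ u₁ ρ₁ σ₁)
    (L₂ : LocalGraph 2 Φ f₂ p₂ u₂ ρ₂ σ₂) (hpoint : f₁ p₁ = f₂ p₂) {e : ℂ}
    (r₁ : ρ₁ (proj Φ (f₁ p₁)) = 0) (r₂ : ρ₂ (proj Φ (f₁ p₁)) = 0)
    (he₁ : 0 < fderiv ℝ ρ₁ (proj Φ (f₁ p₁)) e) (he₂ : 0 < fderiv ℝ ρ₂ (proj Φ (f₁ p₁)) e)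
    (hgerm : SameGerm f₁ ((𝓡∂ 2).boundary M₁) p₁ f₂ ((𝓡∂ 2).boundary M₂) p₂) :
    ∀ᶠ z in 𝓝 (proj Φ (f₁ p₁)), 0 ≤ ρ₁ z ↔ 0 ≤ ρ₂ z := by
  have hz : 𝓝[{z | ρ₁ z = 0}] proj Φ (f₁ p₁) = 𝓝[{z | ρ₂ z = 0}] proj Φ (f₁ p₁) := by
    have h1 := congrArg (Filter.map (proj Φ)) (sameGerm_iff.1 hgerm)
    rw [Filter.map_map, Filter.map_map] at h1
    have h2 := L₂.map_proj_boundary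
    rw [← hpoint] at h2
    rw [← L₁.map_proj_boundary, ← h2]
    exact h1
  have hz' := nhdsWithin_eq_iff_eventuallyEq.1 hz
  have hz'' : ∀ᶠ z in 𝓝 (proj Φ (f₁ p₁)), ρ₁ z = 0 ↔ ρ₂ z = 0 := hz'.mono fun z hz => by
    exact hz.to_iff
  have s₁ := L₁.strict.2
  have s₂ := L₂.strict.2
  have c₁ := L₁.contDiffAt_ρ.mono fun z hz => hz.continuousAt
  have c₂ := L₂.contDiffAt_ρ.mono fun z hz => hz.continuousAt
  rw [← hpoint] at s₂ c₂
  filter_upwards [eventually_nonneg_of_zeros s₁ s₂ he₁ he₂ r₂ c₂ (hz''.mono fun z h => h.2),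
    eventually_nonneg_of_zeros s₂ s₁ he₂ he₁ r₁ c₁ (hz''.mono fun z h => h.1)] with z a b
  exact ⟨a, b⟩

end Contact

end H2R

end

/-! ### Matching pairs of points. -/

noncomputable section

namespace H2R

open Complex Metric

variable {M₁ : Type*} [TopologicalSpace M₁] [ChartedSpace (EuclideanHalfSpace 2) M₁]
  {M₂ : Type*} [TopologicalSpace M₂] [ChartedSpace (EuclideanHalfSpace 2) M₂]
  {Φ : E3 ≃L[ℝ] ℂ × ℝ} {f₁ η₁ : M₁ → E3} {f₂ η₂ : M₂ → E3} {p₁ : M₁} {p₂ : M₂}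
  {u₁ ρ₁ u₂ ρ₂ : ℂ → ℝ} {σ₁ : ℂ → M₁} {σ₂ : ℂ → M₂}

/-- The surfaces `f₁` near the interior point `x` and `f₂` near the interior point `y` have the same
image, and their normals are the same. -/
structure IsMatch (f₁ η₁ : M₁ → E3) (f₂ η₂ : M₂ → E3) (x : M₁) (y : M₂) : Prop where
  left : x ∈ (𝓡∂ 2).interior M₁
  right : y ∈ (𝓡∂ 2).interior M₂
  map_eq : Filter.map f₁ (𝓝 x) = Filter.map f₂ (𝓝 y)
  normal : η₁ x = η₂ y

theorem IsMatch.point {x : M₁} {y : M₂} (h : IsMatch f₁ η₁ f₂ η₂ x y) (h₁ : Continuous f₁)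
    (h₂ : Continuous f₂) : f₁ x = f₂ y := by
  have t₂ : Filter.Tendsto id (Filter.map f₁ (𝓝 x)) (𝓝 (f₂ y)) := by
    rw [h.map_eq]; exact h₂.continuousAt
  have t₁ : Filter.Tendsto id (Filter.map f₁ (𝓝 x)) (𝓝 (f₁ x)) := h₁.continuousAt
  exact tendsto_nhds_unique t₁ t₂

/-- The points satisfying the equation of the first graph form a neighbourhood in the germ of its
image, hence also in that of the second. -/
theorem eventuallyEq_of_map_graphMap {c : ℂ}
    (h : Filter.map (graphMap Φ u₁) (𝓝 c) = Filter.map (graphMap Φ u₂) (𝓝 c)) :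
    u₁ =ᶠ[𝓝 c] u₂ := by
  have h1 : {p : E3 | u₁ (Φ p).1 = (Φ p).2} ∈ Filter.map (graphMap Φ u₁) (𝓝 c) :=
    Filter.mem_map.2 (Filter.univ_mem' fun z => by simp [graphMap])
  rw [h] at h1
  filter_upwards [Filter.mem_map.1 h1] with z hz
  simpa [graphMap] using hz

theorem IsTranslatingSoliton.continuousAt_metric {f η : M₁ → E3} (h : IsTranslatingSoliton f η)
    (x : M₁) (v : E3) : ContinuousAt (fun y => metric (f y) (η y) v) x := by
  have h1 : ContinuousAt (fun q : E3 × E3 => metric q.1 q.2 v) (f x, η x) :=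
    (contDiffAt_metric (n := 0) (g := (f x, η x)) (h.mem_space x) contDiffAt_fst contDiffAt_snd
      contDiffAt_const).continuousAt
  exact ContinuousAt.comp (f := fun y => (f y, η y)) h1
    (h.smooth.continuous.prodMk h.normal_smooth.continuous).continuousAt

theorem LocalGraph.eventually_map_f (L : LocalGraph 2 Φ f₁ p₁ u₁ ρ₁ σ₁) :
    ∀ᶠ x in 𝓝 p₁, 0 < ρ₁ (proj Φ (f₁ x)) →
      Filter.map f₁ (𝓝 x) = Filter.map (graphMap Φ u₁) (𝓝 (proj Φ (f₁ x))) := by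
  filter_upwards [L.map_f, L.tendsto_proj.eventually L.nhdsWithin_eq] with x h1 h2 h3
  rw [h1, h2 h3]

/-- Equality of the functions gives the image germs and the tangent planes. The normals, equal at
`(p₁, p₂)`, stay by continuity on the same side of these planes, which leaves only one choice of
unit normal. -/
theorem eventually_isMatch (L₁ : LocalGraph 2 Φ f₁ p₁ u₁ ρ₁ σ₁)
    (L₂ : LocalGraph 2 Φ f₂ p₂ u₂ ρ₂ σ₂)
    (h₁ : IsTranslatingSoliton f₁ η₁) (h₂ : IsTranslatingSoliton f₂ η₂)
    (hΦ : metric (f₁ p₁) (η₁ p₁) (Φ.symm (0, 1)) ≠ 0) (hpoint : f₁ p₁ = f₂ p₂)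
    (hnormal : η₁ p₁ = η₂ p₂) :
    ∀ᶠ q in 𝓝 (p₁, p₂), proj Φ (f₁ q.1) = proj Φ (f₂ q.2) → 0 < ρ₁ (proj Φ (f₁ q.1)) →
      0 < ρ₂ (proj Φ (f₁ q.1)) → u₁ =ᶠ[𝓝 (proj Φ (f₁ q.1))] u₂ →
      IsMatch f₁ η₁ f₂ η₂ q.1 q.2 := by
  have hsign : ContinuousAt (fun q : M₁ × M₂ => metric (f₁ q.1) (η₁ q.1) (Φ.symm (0, 1)) *
      metric (f₂ q.2) (η₂ q.2) (Φ.symm (0, 1))) (p₁, p₂) := by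
    refine ContinuousAt.mul ?_ ?_
    · exact (h₁.continuousAt_metric p₁ _).comp (x := (p₁, p₂)) continuousAt_fst
    · exact (h₂.continuousAt_metric p₂ _).comp (x := (p₁, p₂)) continuousAt_snd
  have hpos : 0 < metric (f₁ p₁) (η₁ p₁) (Φ.symm (0, 1)) *
      metric (f₂ p₂) (η₂ p₂) (Φ.symm (0, 1)) := by
    rw [← hpoint, ← hnormal]; exact mul_self_pos.2 hΦ
  have c₁ := (continuous_fst.tendsto (p₁, p₂)).eventually (L₁.interior_iff.and
    (L₁.eventually_map_f.and ((L₁.eventually_normal le_rfl h₁).and L₁.graph)))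
  have c₂ := (continuous_snd.tendsto (p₁, p₂)).eventually (L₂.interior_iff.and
    (L₂.eventually_map_f.and ((L₂.eventually_normal le_rfl h₂).and L₂.graph)))
  filter_upwards [hsign.eventually (lt_mem_nhds hpos), c₁, c₂] with q hs ⟨a1, a2, a3, a4⟩
    ⟨b1, b2, b3, b4⟩ hz r₁ r₂ hu
  have hpt : f₁ q.1 = f₂ q.2 := by
    rw [a4, b4, ← hz]
    simp only [graphMap]; rw [hu.self_of_nhds]
  rw [← hz] at b1 b2 b3
  refine ⟨a1.2 r₁, b1.2 r₂, ?_, ?_⟩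
  · rw [a2 r₁, b2 r₂]
    exact Filter.map_congr (hu.mono fun z hz => by simp only [graphMap]; rw [hz])
  · rw [← hu.fderiv_eq] at b3
    rw [← hpt] at b3 hs
    exact normal_unique (h₁.mem_space _) (h₁.normal_unit _) (by rw [hpt]; exact h₂.normal_unit _)
      a3 b3 hs

/-- Surfaces that agree at the contact point match at some points. -/
theorem exists_isMatch (L₁ : LocalGraph 2 Φ f₁ p₁ u₁ ρ₁ σ₁)
    (L₂ : LocalGraph 2 Φ f₂ p₂ u₂ ρ₂ σ₂)
    (h₁ : IsTranslatingSoliton f₁ η₁) (h₂ : IsTranslatingSoliton f₂ η₂)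
    (hΦ : metric (f₁ p₁) (η₁ p₁) (Φ.symm (0, 1)) ≠ 0) (hpoint : f₁ p₁ = f₂ p₂)
    (hnormal : η₁ p₁ = η₂ p₂)
    (hfreq : ∃ᶠ z in 𝓝 (proj Φ (f₁ p₁)), 0 < ρ₁ z ∧ 0 < ρ₂ z)
    (heq : ∀ᶠ z in 𝓝 (proj Φ (f₁ p₁)), 0 ≤ ρ₁ z → 0 ≤ ρ₂ z → u₁ z = u₂ z) :
    ∃ x y, IsMatch f₁ η₁ f₂ η₂ x y := by
  have hm := eventually_isMatch L₁ L₂ h₁ h₂ hΦ hpoint hnormal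
  rw [nhds_prod_eq, Filter.eventually_prod_iff] at hm
  obtain ⟨a, ha, b, hb, hab⟩ := hm
  have e₁ := L₁.eventually_exists ha
  have e₂ := L₂.eventually_exists hb
  have c₁ := L₁.contDiffAt_ρ
  have c₂ := L₂.contDiffAt_ρ
  rw [← hpoint] at e₂ c₂
  obtain ⟨z, ⟨r₁, r₂⟩, d1, d2, d3, d4, d5⟩ :=
    (hfreq.and_eventually (e₁.and (e₂.and (c₁.and (c₂.and heq.eventually_nhds))))).exists
  obtain ⟨x, hx, hxz, -⟩ := d1 r₁.le
  obtain ⟨y, hy, hyz, -⟩ := d2 r₂.le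
  refine ⟨x, y, hab hx hy (hxz.trans hyz.symm) ?_ ?_ ?_⟩
  · simp only; rwa [hxz]
  · simp only; rwa [hxz]
  · simp only
    rw [hxz]
    filter_upwards [d5, d3.continuousAt.eventually (lt_mem_nhds r₁),
      d4.continuousAt.eventually (lt_mem_nhds r₂)] with w w1 w2 w3
    exact w1 w2.le w3.le

theorem exists_transverse_coordinates (h₁ : IsTranslatingSoliton f₁ η₁) (x : M₁) :
    ∃ Φ : E3 ≃L[ℝ] ℂ × ℝ, metric (f₁ x) (η₁ x) (Φ.symm (0, 1)) ≠ 0 := by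
  have h := h₁.normal_unit x
  have h0 : η₁ x ≠ 0 := fun h0 => by rw [h0, metric_zero_right] at h; exact zero_ne_one h
  obtain ⟨Φ, hΦ⟩ := exists_coordinates h0
  exact ⟨Φ, by rw [hΦ, h]; exact one_ne_zero⟩

section Manifold

variable [IsManifold (𝓡∂ 2) ∞ M₁] [IsManifold (𝓡∂ 2) ∞ M₂]

/-- Near matching points, the points of the first surface match points of the second one. -/
theorem IsMatch.exists_lift {x : M₁} {y : M₂} (hm : IsMatch f₁ η₁ f₂ η₂ x y)
    (h₁ : IsTranslatingSoliton f₁ η₁) (h₂ : IsTranslatingSoliton f₂ η₂) :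
    ∃ ℓ : M₁ → M₂, (∀ᶠ x' in 𝓝 x, ContMDiffAt (𝓡∂ 2) (𝓡∂ 2) 1 ℓ x' ∧
        IsMatch f₁ η₁ f₂ η₂ x' (ℓ x')) ∧
      ∀ᶠ q in 𝓝 (x, y), f₁ q.1 = f₂ q.2 → ℓ q.1 = q.2 := by
  obtain ⟨Φ, hΦ⟩ := exists_transverse_coordinates h₁ x
  have hpt := hm.point h₁.smooth.continuous h₂.smooth.continuous
  obtain ⟨u₁, ρ₁, σ₁, L₁, -⟩ := exists_localGraph h₁ x Φ hΦ
  obtain ⟨u₂, ρ₂, σ₂, L₂, -⟩ := exists_localGraph h₂ y Φ (by rwa [← hpt, ← hm.normal])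
  have r₁ := L₁.interior_iff.self_of_nhds.1 hm.left
  have r₂ := L₂.interior_iff.self_of_nhds.1 hm.right
  have hu : u₁ =ᶠ[𝓝 (proj Φ (f₁ x))] u₂ := by
    apply eventuallyEq_of_map_graphMap (Φ := Φ)
    rw [← L₁.eventually_map_f.self_of_nhds r₁, hm.map_eq, L₂.eventually_map_f.self_of_nhds r₂, hpt]
  have hσ := L₂.contMDiffAt_σ r₂
  have hex := L₂.eventually_exists L₂.left_inv
  have hσy : σ₂ (proj Φ (f₂ y)) = y := L₂.left_inv.self_of_nhds
  have c₂ := L₂.contDiffAt_ρ.self_of_nhds.continuousAt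
  rw [← hpt] at hσ hex r₂ hσy c₂
  -- Project the first surface to the plane and go back up to the second one.
  set ℓ : M₁ → M₂ := fun x' => σ₂ (proj Φ (f₁ x')) with hℓ
  have hproj : ContMDiff (𝓡∂ 2) 𝓘(ℝ, ℂ) 1 fun x' => proj Φ (f₁ x') := by
    have : ContDiff ℝ 1 (proj Φ) := Φ.contDiff.fst
    exact this.contMDiff.comp (h₁.smooth.of_le (by simp))
  have hσev := (contMDiffAt_iff_contMDiffAt_nhds (by decide)).1 hσ
  have hℓc : ContinuousAt ℓ x := ContinuousAt.comp (f := fun x' => proj Φ (f₁ x'))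
    hσ.continuousAt hproj.continuous.continuousAt
  have hpair : Filter.Tendsto (fun x' => (x', ℓ x')) (𝓝 x) (𝓝 (x, y)) := by
    have := hℓc.tendsto
    rw [show ℓ x = y from hσy] at this
    exact Filter.tendsto_id.prodMk_nhds this
  refine ⟨ℓ, ?_, ?_⟩
  · have c₁ := L₁.contDiffAt_ρ.self_of_nhds.continuousAt
    filter_upwards [L₁.tendsto_proj.eventually (hσev.and (hex.and (hu.eventually_nhds.and
      ((c₁.eventually (lt_mem_nhds r₁)).and (c₂.eventually (lt_mem_nhds r₂)))))),
      hpair.eventually (eventually_isMatch L₁ L₂ h₁ h₂ hΦ hpt hm.normal)]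
      with x' ⟨a1, a2, a3, a4, a5⟩ a6
    refine ⟨a1.comp x' hproj.contMDiffAt, a6 ?_ a4 a5 a3⟩
    obtain ⟨y', hy', hyz, -⟩ := a2 a5.le
    have : ℓ x' = y' := by simp only [hℓ]; rw [← hyz]; exact hy'
    rw [this, hyz]
  · filter_upwards [(continuous_snd.tendsto (x, y)).eventually L₂.left_inv] with q hq hqf
    simp only [hℓ]; rw [hqf]; exact hq

/-- A limit of matching pairs is a matching pair. -/
theorem isMatch_of_frequently {x : M₁} {y : M₂} (hx : x ∈ (𝓡∂ 2).interior M₁)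
    (hy : y ∈ (𝓡∂ 2).interior M₂) (hpt : f₁ x = f₂ y) (hnormal : η₁ x = η₂ y)
    (h₁ : IsTranslatingSoliton f₁ η₁) (h₂ : IsTranslatingSoliton f₂ η₂)
    (hfreq : ∃ᶠ q in 𝓝 (x, y), IsMatch f₁ η₁ f₂ η₂ q.1 q.2) : IsMatch f₁ η₁ f₂ η₂ x y := by
  obtain ⟨Φ, hΦ⟩ := exists_transverse_coordinates h₁ x
  obtain ⟨u₁, ρ₁, σ₁, L₁, L₁'⟩ := exists_localGraph h₁ x Φ hΦ
  obtain ⟨u₂, ρ₂, σ₂, L₂, L₂'⟩ := exists_localGraph h₂ y Φ (by rwa [← hpt, ← hnormal])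
  have r₁ := L₁.interior_iff.self_of_nhds.1 hx
  have r₂ := L₂.interior_iff.self_of_nhds.1 hy
  obtain ⟨j0, j1⟩ := jet_eq_of_contact L₁ L₂ h₁ h₂ hΦ hpt hnormal
  have hmatch := (eventually_isMatch L₁ L₂ h₁ h₂ hΦ hpt hnormal).self_of_nhds
  have cu₁ := (L₁' hx).contDiffAt_u
  have cu₂ := (L₂' hy).contDiffAt_u
  have c₁ := L₁.contDiffAt_ρ.self_of_nhds.continuousAt.eventually (lt_mem_nhds r₁)
  have c₂ := L₂.contDiffAt_ρ.self_of_nhds.continuousAt.eventually (lt_mem_nhds r₂)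
  have s₁ := L₁.soliton
  have s₂ := L₂.soliton
  have t₂ := L₂.tendsto_proj
  rw [← hpt] at cu₂ c₂ s₂ r₂ t₂
  have h2i : (2 : WithTop ℕ∞) ≤ ∞ := WithTop.coe_le_coe.2 (le_top : (2 : ℕ∞) ≤ ⊤)
  have hsp : graphMap Φ u₁ (proj Φ (f₁ x)) ∈ space := by
    rw [← L₁.graph.self_of_nhds]; exact h₁.mem_space x
  obtain ⟨l, Λ, K, hl, hK, hell⟩ := exists_ellipticIneq Φ (cu₁.self_of_nhds.of_le h2i)
    (cu₂.self_of_nhds.of_le h2i) (jet_congr (Φ := Φ) j0 j1) hsp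
  have hspev : ∀ᶠ z in 𝓝 (proj Φ (f₁ x)), graphMap Φ u₁ z ∈ space :=
    (contDiffAt_graphMap Φ cu₁.self_of_nhds).continuousAt.eventually (isOpen_space.mem_nhds hsp)
  refine hmatch (by rw [hpt]) r₁ r₂ ?_
  simp only
  set c := proj Φ (f₁ x) with hc
  obtain ⟨r, hr, hball⟩ := Metric.eventually_nhds_iff_ball.1
    (cu₁.and (cu₂.and (c₁.and (c₂.and (s₁.and (s₂.and (hell.and hspev)))))))
  have hbr : ∀ᶠ z in 𝓝 c, z ∈ ball c (r / 2) := ball_mem_nhds c (by positivity)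
  have ev₁ := (continuous_fst.tendsto (x, y)).eventually
    ((L₁.tendsto_proj.eventually hbr).and L₁.eventually_map_f)
  have ev₂ := (continuous_snd.tendsto (x, y)).eventually L₂.eventually_map_f
  -- At a matching pair close to `(x, y)` the functions agree near `z = proj Φ (f₁ q.1)`. The disc
  -- of radius `r / 2` about `z` lies in the disc of radius `r` about `c` and contains `c`, so
  -- unique continuation from its centre reaches `c`.
  obtain ⟨q, hq, ⟨q1, q2⟩, q3⟩ := (hfreq.and_eventually (ev₁.and ev₂)).exists
  have hqpt := hq.point h₁.smooth.continuous h₂.smooth.continuous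
  set z := proj Φ (f₁ q.1) with hz
  have hzr : z ∈ ball c r := ball_subset_ball (by linarith) q1
  have hu : u₁ =ᶠ[𝓝 z] u₂ := by
    apply eventuallyEq_of_map_graphMap (Φ := Φ)
    rw [← hqpt] at q3
    rw [← q2 (hball z hzr).2.2.1, hq.map_eq, q3 (hball z hzr).2.2.2.1]
  have hsub : ball z (r / 2) ⊆ ball c r := fun w hw => by
    rw [mem_ball] at hw q1 ⊢
    calc dist w c ≤ dist w z + dist z c := dist_triangle _ _ _
      _ < r := by linarith
  have hjet : ∀ w ∈ ball z (r / 2), ContDiffAt ℝ ∞ (jet Φ u₁) w := fun w hw =>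
    contDiffAt_jet Φ (hball w (hsub hw)).1 (by simp)
  have hjs : ∀ w ∈ ball z (r / 2), (jet Φ u₁ w).1 ∈ space := fun w hw =>
    (hball w (hsub hw)).2.2.2.2.2.2.2
  have key := unique_continuation (c := z) (R := r / 2) (w := fun z => u₁ z - u₂ z) hl hK
    (fun w hw => (contDiffAt_coef₁₁ Φ (hjs w hw)).comp w (hjet w hw))
    (fun w hw => (contDiffAt_coef₁₂ Φ (hjs w hw)).comp w (hjet w hw))
    (fun w hw => (contDiffAt_coef₂₂ Φ (hjs w hw)).comp w (hjet w hw))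
    (fun w hw => (hball w (hsub hw)).1.sub (hball w (hsub hw)).2.1)
    (fun w hw => by
      obtain ⟨a1, a2, a3, a4, a5, a6, a7, a8⟩ := hball w (hsub hw)
      exact a7 (a5 a3) (a6 a4))
    (hu.mono fun w hw => sub_eq_zero.2 hw)
  have hcz : c ∈ ball z (r / 2) := by rw [mem_ball, dist_comm]; exact q1
  filter_upwards [isOpen_ball.mem_nhds hcz] with w hw
  exact sub_eq_zero.1 (key w hw)

end Manifold

end H2R

end

/-! ### Lifting curves from one surface to the other. -/

noncomputable section

namespace H2R

variable {M₁ : Type*} [TopologicalSpace M₁] [ChartedSpace (EuclideanHalfSpace 2) M₁]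
  {M₂ : Type*} [TopologicalSpace M₂] [ChartedSpace (EuclideanHalfSpace 2) M₂]
  {f₁ η₁ : M₁ → E3} {f₂ η₂ : M₂ → E3}

/-- A lift to the second surface of the curve `γ` of the first one, on `[0, T]`. -/
structure IsLift (f₁ η₁ : M₁ → E3) (f₂ η₂ : M₂ → E3) (γ : ℝ → M₁) (y₀ : M₂) (T : ℝ) (y : ℝ → M₂) :
    Prop where
  cont : ContinuousOn y (Set.Icc 0 T)
  start : y 0 = y₀
  isMatch : ∀ s ∈ Set.Icc 0 T, IsMatch f₁ η₁ f₂ η₂ (γ s) (y s)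

variable {γ : ℝ → M₁} {y₀ : M₂} {T T' : ℝ} {y y' : ℝ → M₂}

theorem IsLift.restrict (h : IsLift f₁ η₁ f₂ η₂ γ y₀ T y) (hT : T' ≤ T) :
    IsLift f₁ η₁ f₂ η₂ γ y₀ T' y :=
  ⟨h.cont.mono (Set.Icc_subset_Icc_right hT), h.start,
    fun s hs => h.isMatch s ⟨hs.1, hs.2.trans hT⟩⟩

theorem IsLift.extend {ℓ : M₁ → M₂} {a b : ℝ} (h : IsLift f₁ η₁ f₂ η₂ γ y₀ a y) (ha : 0 ≤ a)
    (hab : a ≤ b) (hb : b ≤ 1) (hγ : ContinuousOn γ (Set.Icc 0 1))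
    (hℓ : ∀ s ∈ Set.Icc a b, ContinuousAt ℓ (γ s) ∧ IsMatch f₁ η₁ f₂ η₂ (γ s) (ℓ (γ s)))
    (hag : ℓ (γ a) = y a) : ∃ y', IsLift f₁ η₁ f₂ η₂ γ y₀ b y' := by
  classical
  set Y : ℝ → M₂ := fun s => if s ≤ a then y s else ℓ (γ s) with hY
  have e1 : ∀ s ∈ Set.Icc 0 a, Y s = y s := fun s hs => if_pos hs.2
  have e2 : ∀ s ∈ Set.Icc a b, Y s = ℓ (γ s) := fun s hs => by
    rcases hs.1.eq_or_lt with h | h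
    · rw [← h, hag]; exact if_pos le_rfl
    · exact if_neg (not_le.2 h)
  have hun : Set.Icc 0 b = Set.Icc 0 a ∪ Set.Icc a b := (Set.Icc_union_Icc_eq_Icc ha hab).symm
  refine ⟨Y, ?_, (e1 0 ⟨le_rfl, ha⟩).trans h.start, fun s hs => ?_⟩
  · rw [hun]
    refine ContinuousOn.union_of_isClosed (h.cont.congr e1) (ContinuousOn.congr ?_ e2)
      isClosed_Icc isClosed_Icc
    intro s hs
    exact (hℓ s hs).1.comp_continuousWithinAt
      ((hγ s ⟨ha.trans hs.1, hs.2.trans hb⟩).mono (Set.Icc_subset_Icc ha hb))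
  · rw [hun] at hs
    rcases hs with hs | hs
    · rw [e1 s hs]; exact h.isMatch s hs
    · rw [e2 s hs]; exact (hℓ s hs).2

section Length

/-- The pieces of a `C¹` curve have lengths bounded by a multiple of the lengths of their parameter
intervals. -/
theorem exists_speed_bound {g : ℝ → E3} (hg : ContDiffOn ℝ 1 g (Set.Icc 0 1))
    (hs : ∀ s ∈ Set.Icc (0 : ℝ) 1, g s ∈ space) :
    ∃ L : ℝ, 0 ≤ L ∧ ∀ s ∈ Set.Icc (0 : ℝ) 1, ∀ t ∈ Set.Icc (0 : ℝ) 1, ∀ c : ℝ → E3,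
      (∀ r ∈ Set.Icc (0 : ℝ) 1, c r = g (s + r * (t - s))) →
      length c ≤ ENNReal.ofReal (L * |t - s|) := by
  set d := derivWithin g (Set.Icc 0 1) with hd
  have hdc : ContinuousOn d (Set.Icc 0 1) :=
    hg.continuousOn_derivWithin (uniqueDiffOn_Icc zero_lt_one) le_rfl
  have hS : ContinuousOn (fun r => Real.sqrt (metric (g r) (d r) (d r))) (Set.Icc 0 1) := by
    refine Continuous.comp_continuousOn Real.continuous_sqrt fun r hr => ?_
    have h1 : ContinuousAt (fun q : E3 × E3 => metric q.1 q.2 q.2) (g r, d r) :=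
      (contDiffAt_metric (n := 0) (g := (g r, d r)) (hs r hr) contDiffAt_fst contDiffAt_snd
        contDiffAt_snd).continuousAt
    exact h1.comp_continuousWithinAt (f := fun r => (g r, d r))
      ((hg.continuousOn r hr).prodMk (hdc r hr))
  obtain ⟨L, hL⟩ := isCompact_Icc.exists_bound_of_continuousOn hS
  have hL' : ∀ r ∈ Set.Icc (0 : ℝ) 1, Real.sqrt (metric (g r) (d r) (d r)) ≤ L := fun r hr =>
    (le_abs_self _).trans (hL r hr)
  refine ⟨L, (Real.sqrt_nonneg _).trans (hL' 0 ⟨le_rfl, zero_le_one⟩), fun s hs' t ht c hc => ?_⟩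
  have hmaps : Set.MapsTo (fun r : ℝ => s + r * (t - s)) (Set.Icc 0 1) (Set.Icc 0 1) :=
    fun r hr => by
      have e : s + r * (t - s) = (1 - r) * s + r * t := by ring
      have h1 : 0 ≤ 1 - r := by linarith [hr.2]
      simp only [e]
      constructor
      · have := mul_nonneg h1 hs'.1
        have := mul_nonneg hr.1 ht.1
        linarith
      · have := mul_le_mul_of_nonneg_left hs'.2 h1
        have := mul_le_mul_of_nonneg_left ht.2 hr.1
        linarith
  unfold length
  -- The curve is prescribed only on `[0, 1]`, so its derivative is not controlled at the endpoints.
  -- They have measure zero.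
  rw [MeasureTheory.setLIntegral_congr MeasureTheory.Ioo_ae_eq_Icc.symm]
  have hbound : ∀ r ∈ Set.Ioo (0 : ℝ) 1,
      ENNReal.ofReal (Real.sqrt (metric (c r) (deriv c r) (deriv c r))) ≤
        ENNReal.ofReal (L * |t - s|) := fun r hr => by
    have hrI : r ∈ Set.Icc (0 : ℝ) 1 := Set.Ioo_subset_Icc_self hr
    have h1 : HasDerivWithinAt g (d (s + r * (t - s))) (Set.Icc 0 1) (s + r * (t - s)) :=
      ((hg.differentiableOn (by norm_num)) _ (hmaps hrI)).hasDerivWithinAt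
    have h2 : HasDerivWithinAt (fun r : ℝ => s + r * (t - s)) (t - s) (Set.Icc 0 1) r := by
      have := ((hasDerivAt_id r).mul_const (t - s)).const_add s
      simpa using this.hasDerivWithinAt
    have h3 : HasDerivWithinAt c ((t - s) • d (s + r * (t - s))) (Set.Icc 0 1) r :=
      (h1.scomp r h2 hmaps).congr hc (hc r hrI)
    have h4 := (h3.hasDerivAt (Icc_mem_nhds hr.1 hr.2)).deriv
    rw [h4, hc r hrI, metric_smul_left, metric_smul_right, ← mul_assoc,
      Real.sqrt_mul (mul_self_nonneg _), Real.sqrt_mul_self_eq_abs]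
    apply ENNReal.ofReal_le_ofReal
    rw [mul_comm]
    exact mul_le_mul_of_nonneg_right (hL' _ (hmaps hrI)) (abs_nonneg _)
  calc _ ≤ ∫⁻ _ in Set.Ioo (0 : ℝ) 1, ENNReal.ofReal (L * |t - s|) :=
        MeasureTheory.setLIntegral_mono' measurableSet_Ioo hbound
    _ = _ := by simp

end Length

section Manifold

variable [IsManifold (𝓡∂ 2) ∞ M₂]

theorem isLocallyInjective (h₂ : IsTranslatingSoliton f₂ η₂) : IsLocallyInjective f₂ := by
  intro x
  obtain ⟨Φ, hΦ⟩ := exists_transverse_coordinates h₂ x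
  obtain ⟨u, ρ, σ, L, -⟩ := exists_localGraph h₂ x Φ hΦ
  obtain ⟨U, hU, hUo, hxU⟩ := eventually_nhds_iff.1 L.left_inv
  refine ⟨U, hUo, hxU, fun a ha b hb hab => ?_⟩
  rw [← hU a ha, ← hU b hb, hab]

/-- A lift is a lift of `f₁ ∘ γ` through the locally injective map `f₂` into a Hausdorff space, so
it is determined by its starting point. -/
theorem IsLift.unique [T2Space M₂] (h₁ : IsTranslatingSoliton f₁ η₁)
    (h₂ : IsTranslatingSoliton f₂ η₂) (hT : 0 ≤ T) (h : IsLift f₁ η₁ f₂ η₂ γ y₀ T y)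
    (h' : IsLift f₁ η₁ f₂ η₂ γ y₀ T y') : Set.EqOn y y' (Set.Icc 0 T) := by
  refine (T2Space.isSeparatedMap f₂).eqOn_of_comp_eqOn (isLocallyInjective h₂)
    isPreconnected_Icc h.cont h'.cont (fun s hs => ?_) ⟨le_rfl, hT⟩ (h.start.trans h'.start.symm)
  have c₁ := h₁.smooth.continuous
  have c₂ := h₂.smooth.continuous
  exact ((h.isMatch s hs).point c₁ c₂).symm.trans ((h'.isMatch s hs).point c₁ c₂)

variable [IsManifold (𝓡∂ 2) ∞ M₁]

theorem IsLift.contMDiffOn (h₁ : IsTranslatingSoliton f₁ η₁) (h₂ : IsTranslatingSoliton f₂ η₂)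
    (hT : T ≤ 1) (hγ : ContMDiffOn 𝓘(ℝ, ℝ) (𝓡∂ 2) 1 γ (Set.Icc 0 1))
    (h : IsLift f₁ η₁ f₂ η₂ γ y₀ T y) : ContMDiffOn 𝓘(ℝ, ℝ) (𝓡∂ 2) 1 y (Set.Icc 0 T) := by
  intro s hs
  obtain ⟨ℓ, hℓ1, hℓ2⟩ := (h.isMatch s hs).exists_lift h₁ h₂
  have hγs := (hγ s ⟨hs.1, hs.2.trans hT⟩).mono (Set.Icc_subset_Icc_right hT)
  have hpair : Filter.Tendsto (fun r => (γ r, y r)) (𝓝[Set.Icc 0 T] s) (𝓝 (γ s, y s)) :=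
    hγs.continuousWithinAt.tendsto.prodMk_nhds (h.cont s hs)
  have hev : ∀ᶠ r in 𝓝[Set.Icc 0 T] s, y r = ℓ (γ r) := by
    filter_upwards [hpair.eventually hℓ2, self_mem_nhdsWithin] with r hr hrT
    exact (hr ((h.isMatch r hrT).point h₁.smooth.continuous h₂.smooth.continuous)).symm
  exact (hℓ1.self_of_nhds.1.comp_contMDiffWithinAt s hγs).congr_of_eventuallyEq hev
    (hev.self_of_nhdsWithin hs)

/-- The lift and `γ` have the same image curve in space. A speed bound for `f₁ ∘ γ` therefore bounds
the intrinsic distances on the second surface, with a constant that depends neither on the lift nor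
on `T`. -/
theorem IsLift.exists_dist_le (h₁ : IsTranslatingSoliton f₁ η₁)
    (h₂ : IsTranslatingSoliton f₂ η₂)
    (hγ : ContMDiffOn 𝓘(ℝ, ℝ) (𝓡∂ 2) 1 γ (Set.Icc 0 1)) :
    ∃ L : ℝ, 0 ≤ L ∧ ∀ T y, T ≤ 1 → IsLift f₁ η₁ f₂ η₂ γ y₀ T y → ∀ s ∈ Set.Icc 0 T,
      ∀ t ∈ Set.Icc 0 T, intrinsicDist f₂ (y s) (y t) ≤ ENNReal.ofReal (L * |t - s|) := by
  have hg : ContDiffOn ℝ 1 (fun s => f₁ (γ s)) (Set.Icc 0 1) := by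
    have : ContMDiffOn 𝓘(ℝ, ℝ) 𝓘(ℝ, E3) 1 (fun s => f₁ (γ s)) (Set.Icc 0 1) :=
      (h₁.smooth.of_le (by simp)).comp_contMDiffOn hγ
    exact this.contDiffOn
  obtain ⟨L, hL, hLb⟩ := exists_speed_bound hg fun s _ => h₁.mem_space _
  refine ⟨L, hL, fun T y hT h s hs t ht => ?_⟩
  have hsub : Set.Icc (0 : ℝ) T ⊆ Set.Icc 0 1 := Set.Icc_subset_Icc_right hT
  have hmaps : Set.MapsTo (fun r : ℝ => s + r * (t - s)) (Set.Icc 0 1) (Set.Icc 0 T) :=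
    fun r hr => by
      have := (convex_Icc (0 : ℝ) T).add_smul_sub_mem hs ht hr
      simpa using this
  have haff : ContMDiff 𝓘(ℝ, ℝ) 𝓘(ℝ, ℝ) 1 fun r : ℝ => s + r * (t - s) := by
    apply ContDiff.contMDiff
    fun_prop
  have hc : ContMDiffOn 𝓘(ℝ, ℝ) (𝓡∂ 2) 1 (fun r => y (s + r * (t - s))) (Set.Icc 0 1) :=
    (h.contMDiffOn h₁ h₂ hT hγ).comp haff.contMDiffOn hmaps
  unfold intrinsicDist
  refine (iInf₂_le (fun r => y (s + r * (t - s))) ⟨by simp, by simp, hc⟩).trans ?_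
  refine hLb s (hsub hs) t (hsub ht) _ fun r hr => ?_
  exact ((h.isMatch _ (hmaps hr)).point h₁.smooth.continuous h₂.smooth.continuous).symm

end Manifold

end H2R

end

/-! ### Completeness and global continuation. -/

noncomputable section

namespace H2R

variable {M₁ : Type*} [TopologicalSpace M₁] [ChartedSpace (EuclideanHalfSpace 2) M₁]
  {M₂ : Type*} [TopologicalSpace M₂] [ChartedSpace (EuclideanHalfSpace 2) M₂]
  {f₁ η₁ : M₁ → E3} {f₂ η₂ : M₂ → E3} {γ : ℝ → M₁} {y₀ : M₂} {T : ℝ}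

theorem eq_of_limit (h₁ : IsTranslatingSoliton f₁ η₁) (h₂ : IsTranslatingSoliton f₂ η₂)
    (hγ : ContinuousOn γ (Set.Icc 0 1)) (hT0 : 0 ≤ T) (hT1 : T ≤ 1) {t : ℕ → ℝ} {y : ℕ → ℝ → M₂}
    {z : M₂} (htI : ∀ n, t n ∈ Set.Icc 0 T) (ht : Filter.Tendsto t Filter.atTop (𝓝 T))
    (hy : ∀ n, IsLift f₁ η₁ f₂ η₂ γ y₀ (t n) (y n))
    (hz : Filter.Tendsto (fun n => y n (t n)) Filter.atTop (𝓝 z)) :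
    Filter.Tendsto (fun n => (γ (t n), y n (t n))) Filter.atTop (𝓝 (γ T, z)) ∧
      f₁ (γ T) = f₂ z ∧ η₁ (γ T) = η₂ z := by
  have hγt : Filter.Tendsto (fun n => γ (t n)) Filter.atTop (𝓝 (γ T)) := by
    refine (hγ T ⟨hT0, hT1⟩).tendsto.comp (tendsto_nhdsWithin_iff.2 ⟨ht, ?_⟩)
    exact Filter.Eventually.of_forall fun n => ⟨(htI n).1, (htI n).2.trans hT1⟩
  have hm : ∀ n, IsMatch f₁ η₁ f₂ η₂ (γ (t n)) (y n (t n)) := fun n =>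
    (hy n).isMatch _ ⟨(htI n).1, le_rfl⟩
  have c₁ := h₁.smooth.continuous
  have c₂ := h₂.smooth.continuous
  refine ⟨hγt.prodMk_nhds hz, ?_, ?_⟩
  · refine tendsto_nhds_unique ((c₁.tendsto _).comp hγt) ?_
    refine ((c₂.tendsto _).comp hz).congr fun n => ?_
    exact ((hm n).point c₁ c₂).symm
  · refine tendsto_nhds_unique ((h₁.normal_smooth.continuous.tendsto _).comp hγt) ?_
    refine ((h₂.normal_smooth.continuous.tendsto _).comp hz).congr fun n => ?_
    exact (hm n).normal.symm

variable [IsManifold (𝓡∂ 2) ∞ M₁] [IsManifold (𝓡∂ 2) ∞ M₂]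

/-- Lifts on the intervals `[0, t]`, `t < T`, have a limit at `T`. -/
theorem exists_limit_of_lifts [T2Space M₂] (h₁ : IsTranslatingSoliton f₁ η₁) (h₂ : IsTranslatingSoliton f₂ η₂)
    (hc₂ : IsCompleteSurface f₂) (hγ : ContMDiffOn 𝓘(ℝ, ℝ) (𝓡∂ 2) 1 γ (Set.Icc 0 1)) (hT0 : 0 < T)
    (hT1 : T ≤ 1) (hl : ∀ t ∈ Set.Ico 0 T, ∃ y, IsLift f₁ η₁ f₂ η₂ γ y₀ t y) :
    ∃ (t : ℕ → ℝ) (y : ℕ → ℝ → M₂) (z : M₂), (∀ n, t n ∈ Set.Icc 0 T) ∧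
      Filter.Tendsto t Filter.atTop (𝓝 T) ∧ (∀ n, IsLift f₁ η₁ f₂ η₂ γ y₀ (t n) (y n)) ∧
      Filter.Tendsto (fun n => y n (t n)) Filter.atTop (𝓝 z) := by
  obtain ⟨L, hL, hdist⟩ := IsLift.exists_dist_le (y₀ := y₀) h₁ h₂ hγ
  obtain ⟨t, -, htT, ht⟩ := exists_seq_strictMono_tendsto' hT0
  have htI : ∀ n, t n ∈ Set.Ico 0 T := fun n => ⟨(htT n).1.le, (htT n).2⟩
  choose y hy using fun n => hl (t n) (htI n)
  have hone : ∀ n, t n ≤ 1 := fun n => (htI n).2.le.trans hT1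
  have hd : ∀ m n, intrinsicDist f₂ (y m (t m)) (y n (t n)) ≤
      ENNReal.ofReal (L * |t n - t m|) := fun m n => by
    rcases le_total (t m) (t n) with h | h
    · have e : y m (t m) = y n (t m) :=
        (hy m).unique h₁ h₂ (htI m).1 ((hy n).restrict h) ⟨(htI m).1, le_rfl⟩
      rw [e]
      exact hdist _ _ (hone n) (hy n) _ ⟨(htI m).1, h⟩ _ ⟨(htI n).1, le_rfl⟩
    · have e : y n (t n) = y m (t n) :=
        (hy n).unique h₁ h₂ (htI n).1 ((hy m).restrict h) ⟨(htI n).1, le_rfl⟩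
      rw [e]
      exact hdist _ _ (hone m) (hy m) _ ⟨(htI m).1, le_rfl⟩ _ ⟨(htI n).1, h⟩
  obtain ⟨z, hz⟩ := hc₂ (fun n => y n (t n)) fun ε hε => by
    obtain ⟨r, -, hr0, hr⟩ := ENNReal.lt_iff_exists_real_btwn.1 hε
    have hr0' : 0 < r := ENNReal.ofReal_pos.1 hr0
    obtain ⟨N, hN⟩ := Metric.cauchySeq_iff.1 ht.cauchySeq (r / (L + 1)) (by positivity)
    refine ⟨N, fun m hm n hn => ((hd m n).trans (ENNReal.ofReal_le_ofReal ?_)).trans_lt hr⟩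
    have h := hN n hn m hm
    rw [Real.dist_eq, lt_div_iff₀ (by positivity)] at h
    nlinarith [abs_nonneg (t n - t m)]
  exact ⟨t, y, z, fun n => ⟨(htI n).1, (htI n).2.le⟩, ht, hy, hz⟩

/-- Lifts that have an interior limit extend beyond it. -/
theorem exists_lift_beyond (h₁ : IsTranslatingSoliton f₁ η₁) (h₂ : IsTranslatingSoliton f₂ η₂)
    (hγ : ContinuousOn γ (Set.Icc 0 1)) (hT0 : 0 ≤ T) (hT1 : T < 1) {t : ℕ → ℝ} {y : ℕ → ℝ → M₂}
    {z : M₂} (htI : ∀ n, t n ∈ Set.Icc 0 T) (ht : Filter.Tendsto t Filter.atTop (𝓝 T))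
    (hy : ∀ n, IsLift f₁ η₁ f₂ η₂ γ y₀ (t n) (y n))
    (hz : Filter.Tendsto (fun n => y n (t n)) Filter.atTop (𝓝 z))
    (hi₁ : γ T ∈ (𝓡∂ 2).interior M₁) (hi₂ : z ∈ (𝓡∂ 2).interior M₂) :
    ∃ b > T, b ≤ 1 ∧ ∃ y, IsLift f₁ η₁ f₂ η₂ γ y₀ b y := by
  obtain ⟨hlim, hpt, hnormal⟩ := eq_of_limit h₁ h₂ hγ hT0 hT1.le htI ht hy hz
  have hm : ∀ n, IsMatch f₁ η₁ f₂ η₂ (γ (t n)) (y n (t n)) := fun n =>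
    (hy n).isMatch _ ⟨(htI n).1, le_rfl⟩
  have hmT : IsMatch f₁ η₁ f₂ η₂ (γ T) z :=
    isMatch_of_frequently hi₁ hi₂ hpt hnormal h₁ h₂
      (hlim.frequently (Filter.Frequently.of_forall hm))
  obtain ⟨ℓ, hℓ1, hℓ2⟩ := hmT.exists_lift h₁ h₂
  have hγT : ∀ᶠ s in 𝓝[Set.Icc 0 1] T, ContMDiffAt (𝓡∂ 2) (𝓡∂ 2) 1 ℓ (γ s) ∧
      IsMatch f₁ η₁ f₂ η₂ (γ s) (ℓ (γ s)) := (hγ T ⟨hT0, hT1.le⟩).eventually hℓ1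
  obtain ⟨δ, hδ, hδs⟩ := Metric.eventually_nhds_iff.1 (eventually_nhdsWithin_iff.1 hγT)
  -- For large `n` the local lift `ℓ` at the limit passes through the end of the `n`-th lift, and
  -- the interval from `t n` to `T + δ / 2` lies within `δ` of `T`. Following `ℓ` prolongs this lift
  -- past `T`.
  obtain ⟨n, hn1, hn2⟩ := ((hlim.eventually hℓ2).and (ht.eventually (lt_mem_nhds
    (show T - δ < T by linarith)))).exists
  have hag := hn1 ((hm n).point h₁.smooth.continuous h₂.smooth.continuous)
  refine ⟨min (T + δ / 2) 1, lt_min (by linarith) hT1, min_le_right _ _, ?_⟩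
  refine (hy n).extend (htI n).1 ((htI n).2.trans (le_min (by linarith) hT1.le)) (min_le_right _ _)
    hγ (fun s hs => ?_) hag
  have hs2 : s ≤ T + δ / 2 := hs.2.trans (min_le_left _ _)
  have := hδs (y := s) (by rw [Real.dist_eq, abs_lt]; constructor <;> linarith [hs.1])
    ⟨(htI n).1.trans hs.1, hs.2.trans (min_le_right _ _)⟩
  exact ⟨this.1.continuousAt, this.2⟩

/-- A curve of the first surface, with interior points except perhaps the last one, lifts to the
second surface if this one is complete. -/
theorem exists_match_of_curve [T2Space M₂] (h₁ : IsTranslatingSoliton f₁ η₁) (h₂ : IsTranslatingSoliton f₂ η₂)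
    (hc₂ : IsCompleteSurface f₂)
    (hdisj : Disjoint (f₂ '' (𝓡∂ 2).boundary M₂) (f₁ '' (𝓡∂ 2).interior M₁))
    (hγ : ContMDiffOn 𝓘(ℝ, ℝ) (𝓡∂ 2) 1 γ (Set.Icc 0 1))
    (hint : ∀ s ∈ Set.Ico (0 : ℝ) 1, γ s ∈ (𝓡∂ 2).interior M₁)
    (h0 : IsMatch f₁ η₁ f₂ η₂ (γ 0) y₀) :
    (∀ s ∈ Set.Ico (0 : ℝ) 1, ∃ y, IsMatch f₁ η₁ f₂ η₂ (γ s) y) ∧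
      ∃ z, f₁ (γ 1) = f₂ z ∧ η₁ (γ 1) = η₂ z := by
  have hγc := hγ.continuousOn
  set S : Set ℝ := {t | t ∈ Set.Icc (0 : ℝ) 1 ∧ ∃ y, IsLift f₁ η₁ f₂ η₂ γ y₀ t y} with hS
  have hconst : IsLift f₁ η₁ f₂ η₂ γ y₀ 0 fun _ => y₀ :=
    ⟨continuousOn_const, rfl, fun s hs => by
      rw [show s = 0 from le_antisymm hs.2 hs.1]; exact h0⟩
  have h0S : (0 : ℝ) ∈ S := ⟨⟨le_rfl, zero_le_one⟩, _, hconst⟩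
  have hbdd : BddAbove S := ⟨1, fun t ht => ht.1.2⟩
  -- If the supremum of the times reached were below `1`, the lifts would converge there by
  -- completeness and extend beyond it.
  set T := sSup S with hT
  have hT0 : 0 ≤ T := le_csSup hbdd h0S
  have hT1 : T ≤ 1 := csSup_le ⟨0, h0S⟩ fun t ht => ht.1.2
  have hlift : ∀ t ∈ Set.Ico 0 T, ∃ y, IsLift f₁ η₁ f₂ η₂ γ y₀ t y := fun t ht => by
    obtain ⟨t', ⟨-, y, hy⟩, htt'⟩ := exists_lt_of_lt_csSup ⟨0, h0S⟩ ht.2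
    exact ⟨y, hy.restrict htt'.le⟩
  have hTone : T = 1 := by
    by_contra hne
    have hT1' : T < 1 := lt_of_le_of_ne hT1 hne
    have hi₁ := hint T ⟨hT0, hT1'⟩
    have hseq : ∃ (t : ℕ → ℝ) (y : ℕ → ℝ → M₂) (z : M₂), (∀ n, t n ∈ Set.Icc 0 T) ∧
        Filter.Tendsto t Filter.atTop (𝓝 T) ∧ (∀ n, IsLift f₁ η₁ f₂ η₂ γ y₀ (t n) (y n)) ∧
        Filter.Tendsto (fun n => y n (t n)) Filter.atTop (𝓝 z) := by
      rcases hT0.eq_or_lt with h | h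
      · refine ⟨fun _ => 0, fun _ _ => y₀, y₀, fun _ => ⟨le_rfl, hT0⟩, ?_, fun _ => hconst,
          tendsto_const_nhds⟩
        rw [← h]; exact tendsto_const_nhds
      · exact exists_limit_of_lifts h₁ h₂ hc₂ hγ h hT1 hlift
    obtain ⟨t, y, z, htI, ht, hy, hz⟩ := hseq
    obtain ⟨-, hpt, -⟩ := eq_of_limit h₁ h₂ hγc hT0 hT1 htI ht hy hz
    -- A boundary limit on the second surface would lie on the image of the interior point `γ T`,
    -- which the assumption on the boundaries excludes.
    have hi₂ : z ∈ (𝓡∂ 2).interior M₂ := by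
      rw [← ModelWithCorners.compl_boundary]
      exact fun hz' => Set.disjoint_left.1 hdisj ⟨z, hz', rfl⟩ ⟨γ T, hi₁, hpt⟩
    obtain ⟨b, hbT, hb1, hb⟩ := exists_lift_beyond h₁ h₂ hγc hT0 hT1' htI ht hy hz hi₁ hi₂
    exact absurd (le_csSup hbdd ⟨⟨hT0.trans hbT.le, hb1⟩, hb⟩) (not_le.2 hbT)
  rw [hTone] at hlift
  refine ⟨fun s hs => ?_, ?_⟩
  · obtain ⟨y, hy⟩ := hlift s hs
    exact ⟨y s, hy.isMatch s ⟨hs.1, le_rfl⟩⟩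
  -- The endpoint `γ 1` may be a boundary point, where matching is not defined. Only the point and
  -- the normal pass to the limit.
  · obtain ⟨t, y, z, htI, ht, hy, hz⟩ :=
      exists_limit_of_lifts h₁ h₂ hc₂ hγ zero_lt_one le_rfl hlift
    exact ⟨z, (eq_of_limit h₁ h₂ hγc zero_le_one le_rfl htI ht hy hz).2⟩

theorem interior_iff_chart {x y : M₁}
    (hy : y ∈ (extChartAt (𝓡∂ 2) x).source) :
    y ∈ (𝓡∂ 2).interior M₁ ↔ 0 < extChartAt (𝓡∂ 2) x y 0 := by
  have h0 : 0 ≤ extChartAt (𝓡∂ 2) x y 0 := mem_range_halfSpace.1 (Set.mem_range_self _)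
  rw [← ModelWithCorners.compl_boundary, Set.mem_compl_iff, mem_boundary_iff hy]
  exact ⟨fun h => lt_of_le_of_ne h0 (Ne.symm h), fun h => h.ne'⟩

/-- Segments in a chart. -/
theorem exists_nhds_segments (x₀ : M₁) : ∃ U ∈ 𝓝 x₀, ∀ a ∈ U, a ∈ (𝓡∂ 2).interior M₁ → ∀ x ∈ U,
    ∃ γ : ℝ → M₁, ContMDiffOn 𝓘(ℝ, ℝ) (𝓡∂ 2) 1 γ (Set.Icc 0 1) ∧ γ 0 = a ∧ γ 1 = x ∧
      ∀ s ∈ Set.Ico (0 : ℝ) 1, γ s ∈ (𝓡∂ 2).interior M₁ := by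
  set e := extChartAt (𝓡∂ 2) x₀ with he
  obtain ⟨r, hr, hball⟩ := Metric.mem_nhdsWithin_iff.1 (extChartAt_target_mem_nhdsWithin
    (I := 𝓡∂ 2) x₀)
  set B := Metric.ball (e x₀) r ∩ {w : EuclideanSpace ℝ (Fin 2) | 0 ≤ w 0} with hB
  have hBt : B ⊆ e.target := fun w hw => hball ⟨hw.1, mem_range_halfSpace.2 hw.2⟩
  have hBc : Convex ℝ B := by
    refine (convex_ball _ _).inter fun a ha b hb s t hs ht _ => ?_
    simp only [Set.mem_ofPred_eq] at ha hb ⊢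
    have := mul_nonneg hs ha
    have := mul_nonneg ht hb
    simp only [PiLp.add_apply, PiLp.smul_apply, smul_eq_mul]
    linarith
  have hr0 : ∀ y : M₁, 0 ≤ e y 0 := fun y => mem_range_halfSpace.1 (Set.mem_range_self _)
  refine ⟨e.source ∩ e ⁻¹' Metric.ball (e x₀) r, Filter.inter_mem (extChartAt_source_mem_nhds x₀)
    ((continuousAt_extChartAt x₀).preimage_mem_nhds (Metric.ball_mem_nhds _ hr)),
    fun a ha hai x hx => ?_⟩
  have haB : e a ∈ B := ⟨ha.2, hr0 a⟩
  have hxB : e x ∈ B := ⟨hx.2, hr0 x⟩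
  set c : ℝ → EuclideanSpace ℝ (Fin 2) := fun s => e a + s • (e x - e a) with hc
  have hcB : Set.MapsTo c (Set.Icc 0 1) B := fun s hs => hBc.add_smul_sub_mem haB hxB hs
  have hcs : ContMDiff 𝓘(ℝ, ℝ) 𝓘(ℝ, EuclideanSpace ℝ (Fin 2)) 1 c := by
    apply ContDiff.contMDiff
    fun_prop
  refine ⟨fun s => e.symm (c s), ?_, ?_, ?_, fun s hs => ?_⟩
  · exact (contMDiffOn_extChartAt_symm x₀).comp hcs.contMDiffOn fun s hs => hBt (hcB hs)
  · simp only [hc, zero_smul, add_zero]; exact e.left_inv ha.1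
  · simp only [hc, one_smul, add_sub_cancel]; exact e.left_inv hx.1
  -- The boundary coordinate is affine along the segment, positive at the start and nonnegative at
  -- the end, so it is positive before the end.
  · have hst := hBt (hcB (Set.Ico_subset_Icc_self hs))
    rw [interior_iff_chart (x := x₀) (e.map_target hst), ← he, e.right_inv hst]
    have ha0 : 0 < e a 0 := (interior_iff_chart ha.1).1 hai
    have hx0 := hr0 x
    simp only [hc, PiLp.add_apply, PiLp.smul_apply, PiLp.sub_apply, smul_eq_mul]
    have := mul_pos (sub_pos.2 hs.2) ha0
    have := mul_nonneg hs.1 hx0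
    linarith

/-- Every point of the first surface, with its normal, is a point of the second surface if this one
is complete and its boundary does not meet the interior of the first one. -/
theorem exists_eq_of_isMatch [T2Space M₂] [ConnectedSpace M₁] (h₁ : IsTranslatingSoliton f₁ η₁)
    (h₂ : IsTranslatingSoliton f₂ η₂) (hc₂ : IsCompleteSurface f₂)
    (hdisj : Disjoint (f₂ '' (𝓡∂ 2).boundary M₂) (f₁ '' (𝓡∂ 2).interior M₁))
    (hm : ∃ x y, IsMatch f₁ η₁ f₂ η₂ x y) (x : M₁) : ∃ z, f₁ x = f₂ z ∧ η₁ x = η₂ z := by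
  set A : Set M₁ := {x | ∃ y, IsMatch f₁ η₁ f₂ η₂ x y} with hA
  -- Boundary points never match, so the closure is used instead of `A`. Near a point of it there is
  -- a matching point `a`, and the chart segments from `a` consist of matching points except perhaps
  -- at their ends.
  have hopen : IsOpen (closure A) := by
    rw [isOpen_iff_mem_nhds]
    intro x₀ hx₀
    obtain ⟨U, hU, hseg⟩ := exists_nhds_segments x₀
    obtain ⟨a, haU, y, hay⟩ := mem_closure_iff_nhds.1 hx₀ U hU
    refine Filter.mem_of_superset hU fun x hx => ?_
    obtain ⟨γ, hγ, rfl, rfl, hint⟩ := hseg a haU hay.left x hx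
    have hmatch := (exists_match_of_curve h₁ h₂ hc₂ hdisj hγ hint hay).1
    have hlim : Filter.Tendsto γ (𝓝[Set.Ico 0 1] 1) (𝓝 (γ 1)) :=
      ((hγ.continuousOn 1 ⟨zero_le_one, le_rfl⟩).mono Set.Ico_subset_Icc_self).tendsto
    have : (𝓝[Set.Ico (0 : ℝ) 1] 1).NeBot := by
      rw [← mem_closure_iff_nhdsWithin_neBot, closure_Ico zero_ne_one]
      exact ⟨zero_le_one, le_rfl⟩
    exact mem_closure_of_tendsto hlim (by
      filter_upwards [self_mem_nhdsWithin] with s hs using hmatch s hs)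
  have huniv : closure A = Set.univ := by
    obtain ⟨x, y, hxy⟩ := hm
    exact IsClopen.eq_univ ⟨isClosed_closure, hopen⟩ ⟨x, subset_closure ⟨y, hxy⟩⟩
  -- A segment from a matching point that ends at `x` lifts up to its end. The limit of the lift is
  -- the desired point, even if `x` is on the boundary.
  obtain ⟨U, hU, hseg⟩ := exists_nhds_segments x
  obtain ⟨a, haU, y, hay⟩ := mem_closure_iff_nhds.1 (huniv.ge (Set.mem_univ x)) U hU
  obtain ⟨γ, hγ, rfl, rfl, hint⟩ := hseg a haU hay.left x (mem_of_mem_nhds hU)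
  exact (exists_match_of_curve h₁ h₂ hc₂ hdisj hγ hint hay).2

end H2R

end

/-! ### Proof of the tangency principle. -/

noncomputable section

namespace H2R

theorem IsMatch.symm {M₁ : Type*} [TopologicalSpace M₁] [ChartedSpace (EuclideanHalfSpace 2) M₁]
    {M₂ : Type*} [TopologicalSpace M₂] [ChartedSpace (EuclideanHalfSpace 2) M₂]
    {f₁ η₁ : M₁ → E3} {f₂ η₂ : M₂ → E3} {x : M₁} {y : M₂} (h : IsMatch f₁ η₁ f₂ η₂ x y) :
    IsMatch f₂ η₂ f₁ η₁ y x :=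
  ⟨h.right, h.left, h.map_eq.symm, h.normal.symm⟩

/-- Two functions that increase in the same direction are both positive at points near `c`. -/
theorem frequently_pos {ρ₁ ρ₂ : ℂ → ℝ} {R₁ R₂ : ℂ →L[ℝ] ℝ} {c e : ℂ}
    (hρ₁ : HasStrictFDerivAt ρ₁ R₁ c) (hρ₂ : HasStrictFDerivAt ρ₂ R₂ c)
    (h : (0 < ρ₁ c ∧ 0 < ρ₂ c) ∨ (ρ₁ c = 0 ∧ ρ₂ c = 0 ∧ 0 < R₁ e ∧ 0 < R₂ e)) :
    ∃ᶠ z in 𝓝 c, 0 < ρ₁ z ∧ 0 < ρ₂ z := by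
  rcases h with h | ⟨r₁, r₂, he₁, he₂⟩
  · exact Filter.Eventually.frequently
      ((hρ₁.hasFDerivAt.continuousAt.eventually (lt_mem_nhds h.1)).and
        (hρ₂.hasFDerivAt.continuousAt.eventually (lt_mem_nhds h.2)))
  · obtain ⟨δ₁, hδ₁, m₁, hm₁, h1⟩ := exists_cone hρ₁ he₁
    obtain ⟨δ₂, hδ₂, m₂, hm₂, h2⟩ := exists_cone hρ₂ he₂
    have hc : Continuous fun t : ℝ => c + t • e := by fun_prop
    have ht : Filter.Tendsto (fun t : ℝ => c + t • e) (𝓝[>] 0) (𝓝 c) := by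
      have := hc.tendsto 0
      simp only [zero_smul, add_zero] at this
      exact this.mono_left nhdsWithin_le_nhds
    have ht' : Filter.Tendsto (fun t : ℝ => (c, c + t • e)) (𝓝[>] 0) (𝓝 (c, c)) :=
      tendsto_const_nhds.prodMk_nhds ht
    refine ht.frequently (Filter.Eventually.frequently ?_)
    filter_upwards [ht'.eventually h1, ht'.eventually h2, self_mem_nhdsWithin] with t a1 a2 a3
    have a3' : 0 < t := a3
    have e0 : c + t • e - c - t • e = 0 := by ring
    have b1 := a1 t a3'.le (by rw [e0, norm_zero]; positivity)
    have b2 := a2 t a3'.le (by rw [e0, norm_zero]; positivity)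
    have c1 := mul_pos hm₁ a3'
    have c2 := mul_pos hm₂ a3'
    simp only [r₁] at b1
    simp only [r₂] at b2
    constructor <;> linarith

end H2R

end

theorem mainTheorem6
    {M₁ : Type*} [TopologicalSpace M₁] [T2Space M₁] [ConnectedSpace M₁]
    [ChartedSpace (EuclideanHalfSpace 2) M₁] [IsManifold (𝓡∂ 2) ∞ M₁]
    {M₂ : Type*} [TopologicalSpace M₂] [T2Space M₂] [ConnectedSpace M₂]
    [ChartedSpace (EuclideanHalfSpace 2) M₂] [IsManifold (𝓡∂ 2) ∞ M₂]
    (f₁ η₁ : M₁ → H2R.E3) (f₂ η₂ : M₂ → H2R.E3)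
    (h₁ : H2R.IsTranslatingSoliton f₁ η₁) (h₂ : H2R.IsTranslatingSoliton f₂ η₂)
    (p₁ : M₁) (p₂ : M₂)
    (hpoint : f₁ p₁ = f₂ p₂) (hnormal : η₁ p₁ = η₂ p₂)
    (hcontact :
      (p₁ ∈ (𝓡∂ 2).interior M₁ ∧ p₂ ∈ (𝓡∂ 2).interior M₂) ∨
      (p₁ ∈ (𝓡∂ 2).boundary M₁ ∧ p₂ ∈ (𝓡∂ 2).boundary M₂ ∧
        ∃ ξ : H2R.E3, H2R.IsInteriorConormal f₁ p₁ ξ ∧ H2R.IsInteriorConormal f₂ p₂ ξ))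
    (hside : H2R.LiesOnOneSide f₁ f₂ p₁ p₂ (η₁ p₁)) :
    -- the surfaces agree near the contact point, wherever both are defined
    H2R.AgreeAsGraphs f₁ f₂ p₁ p₂ (η₁ p₁) ∧
    -- at an interior contact point they have the same image near it
    (p₁ ∈ (𝓡∂ 2).interior M₁ → p₂ ∈ (𝓡∂ 2).interior M₂ →
      H2R.SameGerm f₁ Set.univ p₁ f₂ Set.univ p₂) ∧
    -- at a boundary contact point too, as soon as the boundary curves are the same near it
    (H2R.SameGerm f₁ ((𝓡∂ 2).boundary M₁) p₁ f₂ ((𝓡∂ 2).boundary M₂) p₂ →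
      H2R.SameGerm f₁ Set.univ p₁ f₂ Set.univ p₂) ∧
    -- complete surfaces coincide, with their unit normals
    (H2R.IsCompleteSurface f₁ → H2R.IsCompleteSurface f₂ →
      Disjoint (f₁ '' (𝓡∂ 2).boundary M₁) (f₂ '' (𝓡∂ 2).interior M₂) →
      Disjoint (f₂ '' (𝓡∂ 2).boundary M₂) (f₁ '' (𝓡∂ 2).interior M₁) →
      Set.range (fun x => (f₁ x, η₁ x)) = Set.range (fun y => (f₂ y, η₂ y))) := by
  open H2R in
  obtain ⟨v, hv, hside⟩ := hside
  have hv0 : v ≠ 0 := fun h => by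
    rw [h, metric_comm, metric_zero_right] at hv; exact hv rfl
  -- Coordinates in which the direction of the one-sidedness assumption is the vertical of the
  -- graphs.
  obtain ⟨Φ, hΦv⟩ := exists_coordinates hv0
  have hΦ : metric (f₁ p₁) (η₁ p₁) (Φ.symm (0, 1)) ≠ 0 := by rwa [hΦv, metric_comm]
  rw [← hΦv] at hside
  obtain ⟨u₁, ρ₁, σ₁, L₁, -⟩ := exists_localGraph h₁ p₁ Φ hΦ
  obtain ⟨u₂, ρ₂, σ₂, L₂, -⟩ := exists_localGraph h₂ p₂ Φ (by rwa [← hpoint, ← hnormal])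
  have heq := eventually_eq_of_contact L₁ L₂ h₁ h₂ hΦ hpoint hnormal hcontact
    (eventually_le_of_side L₁ L₂ hpoint hside)
  obtain ⟨e, he⟩ := exists_direction L₁ L₂ h₁ h₂ hpoint hcontact
  have s₁ := L₁.strict.2
  have s₂ := L₂.strict.2
  have c₁ := L₁.contDiffAt_ρ.self_of_nhds.continuousAt
  have c₂ := L₂.contDiffAt_ρ.self_of_nhds.continuousAt
  rw [← hpoint] at s₂ c₂
  have hinterior : 0 < ρ₁ (proj Φ (f₁ p₁)) ∧ 0 < ρ₂ (proj Φ (f₁ p₁)) →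
      SameGerm f₁ Set.univ p₁ f₂ Set.univ p₂ := fun h => by
    rw [sameGerm_iff, nhdsWithin_univ, nhdsWithin_univ]
    refine map_eq_of_graph L₁ L₂ hpoint ?_ heq
    filter_upwards [c₁.eventually (lt_mem_nhds h.1), c₂.eventually (lt_mem_nhds h.2)] with z a b
    exact ⟨fun _ => b.le, fun _ => a.le⟩
  refine ⟨?_, fun i₁ i₂ => ?_, fun hgerm => ?_, fun hc₁ hc₂ hd₁ hd₂ => ?_⟩
  · refine agreeAsGraphs_of_eq L₁ L₂ h₁ h₂ hΦ hpoint hnormal (e := e) ?_ ?_ heq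
    · exact he.imp (fun h => h.1) fun h => h.2.2.1
    · exact he.imp (fun h => h.2) fun h => h.2.2.2
  · refine hinterior ⟨L₁.interior_iff.self_of_nhds.1 i₁, ?_⟩
    rw [hpoint]
    exact L₂.interior_iff.self_of_nhds.1 i₂
  · rcases he with h | ⟨r₁, r₂, he₁, he₂⟩
    · exact hinterior h
    · rw [sameGerm_iff, nhdsWithin_univ, nhdsWithin_univ]
      exact map_eq_of_graph L₁ L₂ hpoint
        (eventually_nonneg_iff_of_boundary L₁ L₂ hpoint r₁ r₂ he₁ he₂ hgerm) heq
  -- The contact points may be on the boundary. Points where `ρ₁` and `ρ₂` are both positive exist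
  -- arbitrarily near, and there the local agreement gives the matching pair that starts the
  -- continuation in both directions.
  · obtain ⟨x, y, hm⟩ := exists_isMatch L₁ L₂ h₁ h₂ hΦ hpoint hnormal
      (frequently_pos s₁ s₂ he) heq
    apply Set.Subset.antisymm
    · rintro _ ⟨x', rfl⟩
      obtain ⟨z, hz, hz'⟩ := exists_eq_of_isMatch h₁ h₂ hc₂ hd₂ ⟨x, y, hm⟩ x'
      exact ⟨z, by simp only [hz, hz']⟩
    · rintro _ ⟨y', rfl⟩
      obtain ⟨z, hz, hz'⟩ := exists_eq_of_isMatch h₂ h₁ hc₁ hd₁ ⟨y, x, hm.symm⟩ y'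
      exact ⟨z, by simp only [hz, hz']⟩
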